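/- **Setting.** Let $M$ be a one-dimensional complex manifold and $G$ a connected complex semisimple Lie group with Lie algebra $\mathfrak g=\bigoplus_{m\in\mathbb Z}\mathfrak g_m$, a $\mathbb Z$-graded Lie algebra. Let $\tilde N_\pm$, $\tilde B_\pm$, $\tilde H$ be the connected subgroups of $G$ corresponding to the subalgebras $\tilde{\mathfrak n}_\pm=\bigoplus_{\pm m>0}\mathfrak g_m$, $\tilde{\mathfrak b}_\pm=\bigoplus_{\pm m\ge 0}\mathfrak g_m$, $\tilde{\mathfrak h}=\mathfrak g_0$, and let $\pi_\pm:G\to F_\pm=G/\tilde B_\mp$ be the projections. Let $\Sigma$ be an antiholomorphic automorphism of $G$ whose differential $\sigma$ on $\mathfrak g$ is involutive and satisfies $\sigma(\mathfrak g_m)=\mathfrak g_{-m}$ for all $m$. Put $g^\star=\Sigma(g^{-1})$, and let $\Sigma_+:F_+\to F_-$, $\Sigma_+(g\tilde B_-)=\Sigma(g)\tilde B_+$. For a smooth mapping $\varphi:M\to G$ put $\varphi_\pm=\pi_\pm\circ\varphi$ and ${}^\varphi\omega=\varphi^*\theta$, where $\theta$ is the left-invariant ($\mathfrak g$-valued,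 type $(1,0)$) Maurer–Cartan form of $G$. The reality condition is $\Sigma_+\circ\varphi_+=\varphi_-$. Fix nonzero $x_\pm\in\mathfrak g_{\pm1}$ with $\sigma(x_+)=-x_-$, and let $\mathcal O_\pm=\mathrm{Ad}(\tilde H)x_\pm$. The mapping $\varphi$ is *admissible* if the $(1,0)$-part of ${}^\varphi\omega$ takes values in $\mathfrak g_{-1}\oplus\mathfrak g_0$, its $(0,1)$-part takes values in $\mathfrak g_0\oplus\mathfrak g_{1}$, and, for every local coordinate $z$ and every $q$ in its domain, $\varphi_{-*}(\partial_{z})\in\pi_{-*}(L_{\varphi(q)*}\mathcal O_-)$ and $\varphi_{+*}(\partial_{\bar z})\in\pi_{+*}(L_{\varphi(q)*}\mathcal O_+)$ at $q$. Let $z$ be a local coordinate on $M$, $g\in G$, and $W$ an open subset of the domain of $z$. A *Toda mapping* of $\varphi$ on $W$ (relative to $z$, $g$) is a mapping $\gamma=\gamma_+^{-1}\,\eta_-\eta_+^{-1}\,\gamma_-$ on $W$, where * $\varphi=\mu_+\nu_-\eta_-=\mu_-\nu_+\eta_+$ on $W$ with smooth $\mu_\pm,\nu_\pm,\eta_\pm$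 taking values as follows: $\mu_+$ in $g\tilde N_+$, $\mu_-$ in $\Sigma(g)\tilde N_-$, $\nu_\pm$ in $\tilde N_\pm$, $\eta_\pm$ in $\tilde H$; * $\gamma_\pm$ take values in $\tilde H$, $\gamma_-$ is holomorphic, $\gamma_+$ is antiholomorphic, and ${}^{\mu_-}\omega=\sqrt{-1}\,\mathrm{Ad}(\gamma_-)x_-\,dz$, ${}^{\mu_+}\omega=\sqrt{-1}\,\mathrm{Ad}(\gamma_+)x_+\,d\bar z$ on $W$. **Theorem.** Let $\varphi:M\to G$ be smooth. 1. $\varphi$ satisfies the reality condition if and only if $\Sigma\circ\varphi=\varphi\psi$ for some smooth mapping $\psi:M\to G$ taking values in $\tilde H$. 2. Suppose that $\varphi$ is admissible and satisfies the reality condition. Then for every local coordinate $z$ on $M$, every point $p$ of its domain and every $g\in G$ with $\varphi(p)\in g\tilde N_+\tilde B_-$ (for instance $g=\varphi(p)$), there are an open neighbourhood $W$ of $p$ in the domain of $z$ and a Toda mapping $\gamma$ of $\varphi$ on $W$ relative to $z$ and $g$ that is $\Sigma$-hermitean, $\gamma(q)^\star=\gamma(q)$ for all $q\in W$. This $\gamma$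 is a smooth mapping to $\tilde H$ which solves the Toda equations on $W$: $$\partial_{\bar z}\big(({}^\gamma\omega)(\partial_z)\big)=[\mathrm{Ad}(\gamma^{-1})x_+,\,x_-]$$ (for a linear group, $\partial_{\bar z}(\gamma^{-1}\partial_z\gamma)=[\gamma^{-1}x_+\gamma,x_-]$). -/

import Mathlib

open scoped Manifold ContDiff

noncomputable section

namespace Toda

/-! ### Holomorphic and antiholomorphic objects

A complex manifold modelled on `F` is also a real manifold modelled on `F`, with the same charts.
The tangent space of either is (a copy of) `F`, and the complex structure `J` of the tangent space is
multiplication by `Complex.I`. -/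

/-- The real differential of a map of complex manifolds, as a map of the tangent spaces. -/
def rdiff (F E : Type*) [NormedAddCommGroup F] [NormedSpace ℝ F]
    [NormedAddCommGroup E] [NormedSpace ℝ E]
    {X : Type*} [TopologicalSpace X] [ChartedSpace F X]
    {Y : Type*} [TopologicalSpace Y] [ChartedSpace E Y] (f : X → Y) (p : X) (v : F) : E :=
  mfderiv 𝓘(ℝ, F) 𝓘(ℝ, E) f p v

/-- `f` is antiholomorphic on the (open) set `W`: it is smooth as a map of real manifolds and its
real differential is conjugate-linear, `f_* ∘ J = - J ∘ f_*`. -/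
def AntiholomorphicOn (F E : Type*) [NormedAddCommGroup F] [NormedSpace ℂ F]
    [NormedAddCommGroup E] [NormedSpace ℂ E]
    {X : Type*} [TopologicalSpace X] [ChartedSpace F X]
    {Y : Type*} [TopologicalSpace Y] [ChartedSpace E Y] (f : X → Y) (W : Set X) : Prop :=
  ContMDiffOn 𝓘(ℝ, F) 𝓘(ℝ, E) ∞ f W ∧
    ∀ p ∈ W, ∀ v : F, rdiff F E f p (Complex.I • v) = -(Complex.I • rdiff F E f p v)

section Group

variable (E : Type*) [NormedAddCommGroup E] [NormedSpace ℂ E]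
  {G : Type*} [TopologicalSpace G] [ChartedSpace E G] [Group G]
  {M : Type*} [TopologicalSpace M] [ChartedSpace ℂ M]

/-- The adjoint representation: `Ad g = (L_g ∘ R_{g⁻¹})_*` at the identity. -/
def Ad (g : G) (x : GroupLieAlgebra 𝓘(ℂ, E) G) : GroupLieAlgebra 𝓘(ℂ, E) G :=
  (mfderiv 𝓘(ℂ, E) 𝓘(ℂ, E) (fun h : G => g * h * g⁻¹) 1 x : E)

/-- The automorphism `σ` of the Lie algebra induced by an automorphism `S` of the group: the real
differential of `S` at the identity. -/
def diffOne (S : G → G) (x : GroupLieAlgebra 𝓘(ℂ, E) G) : GroupLieAlgebra 𝓘(ℂ, E) G :=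
  rdiff E E S 1 x

/-- The smooth one-parameter subgroups `c : ℝ → G` whose velocity at `0` is `x`. -/
def IsOneParam (c : ℝ → G) (x : GroupLieAlgebra 𝓘(ℂ, E) G) : Prop :=
  ContMDiff 𝓘(ℝ, ℝ) 𝓘(ℝ, E) ∞ c ∧ (∀ s t, c (s + t) = c s * c t) ∧
    rdiff ℝ E c 0 1 = x

/-- The connected subgroup of `G` corresponding to a Lie subalgebra `k`: the subgroup generated by
the exponentials `exp x = c 1`, `x ∈ k`, where `c` is the one-parameter subgroup of `x`. -/
def connSubgroup (k : Submodule ℂ (GroupLieAlgebra 𝓘(ℂ, E) G)) : Subgroup G :=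
  Subgroup.closure {g | ∃ x ∈ k, ∃ c : ℝ → G, IsOneParam E c x ∧ c 1 = g}

/-- The value on the real tangent vector `v ∈ T_q M` of the pull-back `φ^* θ` of the left-invariant
Maurer-Cartan form: `v` is pushed forward by `φ` and translated back to the identity of `G`
by left multiplication with `(φ q)⁻¹`. -/
def pullMC (φ : M → G) (q : M) (v : ℂ) : GroupLieAlgebra 𝓘(ℂ, E) G :=
  rdiff ℂ E (fun x => (φ q)⁻¹ * φ x) q v

/-- The value of the connection form `φ^* θ` (extended complex-linearly to the complexified tangent
space) on the vector `(v - √-1 J v) / 2` of type (1,0). For `v = ∂_x` this vector is `∂_z`. -/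
def conn10 (φ : M → G) (q : M) (v : ℂ) : GroupLieAlgebra 𝓘(ℂ, E) G :=
  (1 / 2 : ℂ) • (pullMC E φ q v - Complex.I • pullMC E φ q (Complex.I * v))

/-- The value of the connection form `φ^* θ` on the vector `(v + √-1 J v) / 2` of type (0,1).
For `v = ∂_x` this vector is `∂_{z̄}`. -/
def conn01 (φ : M → G) (q : M) (v : ℂ) : GroupLieAlgebra 𝓘(ℂ, E) G :=
  (1 / 2 : ℂ) • (pullMC E φ q v + Complex.I • pullMC E φ q (Complex.I * v))

end Group

/-- The real coordinate vector `∂_x` at `q` of the local complex coordinate `z = x + √-1 y`. -/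
def coordVec {M : Type*} [TopologicalSpace M] [ChartedSpace ℂ M]
    (z : OpenPartialHomeomorph M ℂ) (q : M) : ℂ :=
  rdiff ℂ ℂ z.symm (z q) 1

/-- The derivative `∂_{z̄} f` at `q` of a vector-valued function with respect to the local complex
coordinate `z`. -/
def dbar {M : Type*} [TopologicalSpace M] [ChartedSpace ℂ M]
    {V : Type*} [NormedAddCommGroup V] [NormedSpace ℂ V]
    (z : OpenPartialHomeomorph M ℂ) (f : M → V) (q : M) : V :=
  (1 / 2 : ℂ) • (rdiff ℂ V f q (coordVec z q)
    + Complex.I • rdiff ℂ V f q (Complex.I * coordVec z q))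

/-! ### The subalgebras and subgroups of a `ℤ`-gradation -/

section Grading

variable {E : Type*} [NormedAddCommGroup E] [NormedSpace ℂ E]
  {G : Type*} [TopologicalSpace G] [ChartedSpace E G] [Group G]
  (gr : ℤ → Submodule ℂ (GroupLieAlgebra 𝓘(ℂ, E) G))

/-- `ñ_+ = ⨁_{m > 0} g_m`. -/
def nPlus : Submodule ℂ (GroupLieAlgebra 𝓘(ℂ, E) G) := ⨆ m : ℤ, ⨆ _ : 0 < m, gr m

/-- `ñ_- = ⨁_{m < 0} g_m`. -/
def nMinus : Submodule ℂ (GroupLieAlgebra 𝓘(ℂ, E) G) := ⨆ m : ℤ, ⨆ _ : m < 0, gr m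

/-- `b̃_+ = ⨁_{m ≥ 0} g_m`. -/
def bPlus : Submodule ℂ (GroupLieAlgebra 𝓘(ℂ, E) G) := ⨆ m : ℤ, ⨆ _ : 0 ≤ m, gr m

/-- `b̃_- = ⨁_{m ≤ 0} g_m`. -/
def bMinus : Submodule ℂ (GroupLieAlgebra 𝓘(ℂ, E) G) := ⨆ m : ℤ, ⨆ _ : m ≤ 0, gr m

/-- The connected subgroup `Ñ_+` of `ñ_+`. -/
def NPlus : Subgroup G := connSubgroup E (nPlus gr)

/-- The connected subgroup `Ñ_-` of `ñ_-`. -/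
def NMinus : Subgroup G := connSubgroup E (nMinus gr)

/-- The connected subgroup `B̃_+` of `b̃_+`. -/
def BPlus : Subgroup G := connSubgroup E (bPlus gr)

/-- The connected subgroup `B̃_-` of `b̃_-`. -/
def BMinus : Subgroup G := connSubgroup E (bMinus gr)

/-- The connected subgroup `H̃` of `h̃ = g_0`. -/
def HZero : Subgroup G := connSubgroup E (gr 0)

/-- The orbit of `x` under the adjoint action of `H̃`. -/
def orbit (x : GroupLieAlgebra 𝓘(ℂ, E) G) : Set (GroupLieAlgebra 𝓘(ℂ, E) G) :=
  {y | ∃ h ∈ HZero gr, y = Ad E h x}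

/-! ### The antiholomorphic automorphism and the reality condition -/

/-- `S` is an antiholomorphic automorphism of `G` whose differential `σ` is involutive and satisfies
`σ(g_m) = g_{-m}` for all `m`. -/
structure IsCompatible (S : G ≃* G) : Prop where
  antiholomorphic : AntiholomorphicOn E E (S : G → G) Set.univ
  involutive : ∀ x, diffOne E S (diffOne E S x) = x
  image_grade : ∀ m : ℤ, diffOne E S '' (gr m : Set (GroupLieAlgebra 𝓘(ℂ, E) G))
    = (gr (-m) : Set (GroupLieAlgebra 𝓘(ℂ, E) G))

variable {gr}

theorem isOneParam_comp {S : G ≃* G} (hS : IsCompatible gr S) {c : ℝ → G}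
    {x : GroupLieAlgebra 𝓘(ℂ, E) G} (hc : IsOneParam E c x) :
    IsOneParam E (fun t => S (c t)) (diffOne E S x) := by
  obtain ⟨h1, h2, h3⟩ := hc
  have hs : ContMDiff 𝓘(ℝ, E) 𝓘(ℝ, E) ∞ (S : G → G) := contMDiffOn_univ.1 hS.antiholomorphic.1
  have h0 : c 0 = 1 := by simpa using h2 0 0
  refine ⟨hs.comp h1, fun s t => by simp [h2], ?_⟩
  have hd := mfderiv_comp_apply (I := 𝓘(ℝ, ℝ)) (I' := 𝓘(ℝ, E)) (I'' := 𝓘(ℝ, E)) (0 : ℝ)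
    (hs.mdifferentiableAt (x := c 0) (by simp)) (h1.mdifferentiableAt (x := 0) (by simp)) (1 : ℝ)
  refine hd.trans ?_
  rw [h0]
  exact congrArg (fun w : E => (mfderiv 𝓘(ℝ, E) 𝓘(ℝ, E) S 1 w : E)) h3

theorem diffOne_mem {S : G ≃* G} (hS : IsCompatible gr S)
    {x : GroupLieAlgebra 𝓘(ℂ, E) G} (hx : x ∈ bMinus gr) : diffOne E S x ∈ bPlus gr := by
  have hadd : ∀ a b, diffOne E S (a + b) = diffOne E S a + diffOne E S b := fun a b =>
    (mfderiv 𝓘(ℝ, E) 𝓘(ℝ, E) S 1).map_add a b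
  have hzero : diffOne E S (0 : GroupLieAlgebra 𝓘(ℂ, E) G) = 0 :=
    (mfderiv 𝓘(ℝ, E) 𝓘(ℝ, E) S 1).map_zero
  unfold bMinus at hx
  induction hx using Submodule.iSup_induction' with
  | mem m y hy =>
    by_cases hm : m ≤ 0
    · simp only [hm, iSup_pos] at hy
      have : diffOne E S y ∈ (gr (-m) : Set (GroupLieAlgebra 𝓘(ℂ, E) G)) := by
        rw [← hS.image_grade m]; exact ⟨y, hy, rfl⟩
      exact Submodule.mem_iSup_of_mem (-m)
        (Submodule.mem_iSup_of_mem (by omega) this)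
    · simp only [hm, iSup_neg, not_false_eq_true, Submodule.mem_bot] at hy
      rw [hy, hzero]; exact Submodule.zero_mem _
  | zero => rw [hzero]; exact Submodule.zero_mem _
  | add y w _ _ h1 h2 => rw [hadd]; exact Submodule.add_mem _ h1 h2

/-- `S` maps `B̃_-` to `B̃_+`; so `g B̃_- ↦ S(g) B̃_+` is well defined. -/
theorem map_BMinus {S : G ≃* G} (hS : IsCompatible gr S) {b : G} (hb : b ∈ BMinus gr) :
    S b ∈ BPlus gr := by
  have h : BMinus gr ≤ (BPlus gr).comap S.toMonoidHom := by
    refine (Subgroup.closure_le _).2 ?_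
    rintro g ⟨x, hx, c, hc, rfl⟩
    exact Subgroup.subset_closure ⟨_, diffOne_mem hS hx, _, isOneParam_comp hS hc, rfl⟩
  exact h hb

/-- The projection `π_+ : G → F_+ = G / B̃_-`. -/
def piPlus (gr : ℤ → Submodule ℂ (GroupLieAlgebra 𝓘(ℂ, E) G)) (g : G) : G ⧸ BMinus gr :=
  QuotientGroup.mk g

/-- The projection `π_- : G → F_- = G / B̃_+`. -/
def piMinus (gr : ℤ → Submodule ℂ (GroupLieAlgebra 𝓘(ℂ, E) G)) (g : G) : G ⧸ BPlus gr :=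
  QuotientGroup.mk g

/-- The map `Σ_+ : F_+ → F_-`, `Σ_+(g B̃_-) = S(g) B̃_+`. -/
def flagMap {S : G ≃* G} (hS : IsCompatible gr S) : G ⧸ BMinus gr → G ⧸ BPlus gr :=
  Quotient.map' S (fun a b h => by
    rw [QuotientGroup.leftRel_apply] at h ⊢
    rw [← map_inv, ← map_mul]
    exact map_BMinus hS h)

/-- The reality condition `Σ_+ ∘ φ_+ = φ_-`, where `φ_± = π_± ∘ φ`. -/
def RealityCondition {M : Type*} {S : G ≃* G} (hS : IsCompatible gr S) (φ : M → G) : Prop :=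
  flagMap hS ∘ (piPlus gr ∘ φ) = piMinus gr ∘ φ

/-! ### Admissible mappings, Toda mappings and the Toda equations -/

variable (gr)
variable {M : Type*} [TopologicalSpace M] [ChartedSpace ℂ M]

/-- A smooth mapping `φ : M → G` is admissible.
* Grading condition: the (1,0)-component of `φ^* θ` takes values in `g_{-1} ⊕ g_0` and
  the (0,1)-component takes values in `g_0 ⊕ g_{+1}`.
* For every local coordinate `z` the vector `φ_{-*}(∂_z)` lies in `π_{-*}(O_-)` and
  `φ_{+*}(∂_{z̄})` lies in `π_{+*}(O_+)`, where `O_±` is the `H̃`-orbit of `x_±`, left-translated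
  to the point `φ q` of `G`. Here left translation by `φ q` identifies the tangent space of `G / B̃_+`
  at `φ_-(q)` with `g / b̃_+`, the differential of `π_-` becoming the quotient map; likewise
  for `G / B̃_-`. The nonzero real tangent vectors `v` are the `∂_x` of the local coordinates. -/
structure IsAdmissible (xp xm : GroupLieAlgebra 𝓘(ℂ, E) G) (φ : M → G) : Prop where
  smooth : ContMDiff 𝓘(ℝ, ℂ) 𝓘(ℝ, E) ∞ φ
  grading10 : ∀ q v, conn10 E φ q v ∈ gr (-1) ⊔ gr 0
  grading01 : ∀ q v, conn01 E φ q v ∈ gr 0 ⊔ gr 1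
  tangentMinus : ∀ q, ∀ v : ℂ, v ≠ 0 →
    (bPlus gr).mkQ (conn10 E φ q v) ∈ (bPlus gr).mkQ '' orbit gr xm
  tangentPlus : ∀ q, ∀ v : ℂ, v ≠ 0 →
    (bMinus gr).mkQ (conn01 E φ q v) ∈ (bMinus gr).mkQ '' orbit gr xp

/-- The choices from which a Toda mapping of `φ` on the open set `W` with local coordinate `z` is
constructed: the modified Gauss decompositions
`φ = μ_+ ν_- η_-`, with `μ_+` in `gp Ñ_+`, and `φ = μ_- ν_+ η_+`, with `μ_-` in `gm Ñ_-`, and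
lifts `γ_±` to `H̃` of the mappings `λ_±` given by `μ_-^* θ = λ_- dz`, `μ_+^* θ = λ_+ dz̄`,
that is, `λ_± = √-1 Ad(γ_±) x_±`, with `γ_-` holomorphic and `γ_+` antiholomorphic. -/
structure TodaData (xp xm : GroupLieAlgebra 𝓘(ℂ, E) G) (gp gm : G) (φ : M → G)
    (z : OpenPartialHomeomorph M ℂ) (W : Set M) where
  (μp μm νp νm ηp ηm γp γm : M → G)
  smooth_μp : ContMDiffOn 𝓘(ℝ, ℂ) 𝓘(ℝ, E) ∞ μp W
  smooth_μm : ContMDiffOn 𝓘(ℝ, ℂ) 𝓘(ℝ, E) ∞ μm W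
  smooth_νp : ContMDiffOn 𝓘(ℝ, ℂ) 𝓘(ℝ, E) ∞ νp W
  smooth_νm : ContMDiffOn 𝓘(ℝ, ℂ) 𝓘(ℝ, E) ∞ νm W
  smooth_ηp : ContMDiffOn 𝓘(ℝ, ℂ) 𝓘(ℝ, E) ∞ ηp W
  smooth_ηm : ContMDiffOn 𝓘(ℝ, ℂ) 𝓘(ℝ, E) ∞ ηm W
  mem_μp : ∀ q ∈ W, gp⁻¹ * μp q ∈ NPlus gr
  mem_μm : ∀ q ∈ W, gm⁻¹ * μm q ∈ NMinus gr
  mem_νp : ∀ q ∈ W, νp q ∈ NPlus gr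
  mem_νm : ∀ q ∈ W, νm q ∈ NMinus gr
  mem_ηp : ∀ q ∈ W, ηp q ∈ HZero gr
  mem_ηm : ∀ q ∈ W, ηm q ∈ HZero gr
  decomp_plus : ∀ q ∈ W, φ q = μp q * νm q * ηm q
  decomp_minus : ∀ q ∈ W, φ q = μm q * νp q * ηp q
  mem_γp : ∀ q ∈ W, γp q ∈ HZero gr
  mem_γm : ∀ q ∈ W, γm q ∈ HZero gr
  antihol_γp : AntiholomorphicOn ℂ E γp W
  hol_γm : MDifferentiableOn 𝓘(ℂ, ℂ) 𝓘(ℂ, E) γm W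
  lift_γp : ∀ q ∈ W, conn01 E μp q (coordVec z q) = Complex.I • Ad E (γp q) xp
  type_μp : ∀ q ∈ W, conn10 E μp q (coordVec z q) = 0
  lift_γm : ∀ q ∈ W, conn10 E μm q (coordVec z q) = Complex.I • Ad E (γm q) xm
  type_μm : ∀ q ∈ W, conn01 E μm q (coordVec z q) = 0

/-- The Toda mapping `γ = γ_+⁻¹ η γ_-`, where `η = η_- η_+⁻¹`. -/
def TodaData.toda {gr : ℤ → Submodule ℂ (GroupLieAlgebra 𝓘(ℂ, E) G)}
    {xp xm : GroupLieAlgebra 𝓘(ℂ, E) G} {gp gm : G} {φ : M → G}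
    {z : OpenPartialHomeomorph M ℂ} {W : Set M}
    (D : TodaData gr xp xm gp gm φ z W) (q : M) : G :=
  (D.γp q)⁻¹ * (D.ηm q * (D.ηp q)⁻¹) * D.γm q

/-- `γ` is a solution on `W` of the Toda equations
`∂_{z̄} ((γ^* θ)(∂_z)) = [Ad(γ⁻¹) x_+, x_-]` (for matrix groups:
`∂_{z̄} (γ⁻¹ ∂_z γ) = [γ⁻¹ x_+ γ, x_-]`): a smooth mapping to `H̃` that satisfies them. -/
structure IsTodaSolution (xp xm : GroupLieAlgebra 𝓘(ℂ, E) G) (γ : M → G)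
    (z : OpenPartialHomeomorph M ℂ) (W : Set M) : Prop where
  smooth : ContMDiffOn 𝓘(ℝ, ℂ) 𝓘(ℝ, E) ∞ γ W
  mem : ∀ q ∈ W, γ q ∈ HZero gr
  equation : ∀ q ∈ W,
    dbar (V := E) z (fun q' => conn10 E γ q' (coordVec z q')) q
      = (⁅Ad E (γ q)⁻¹ xp, xm⁆ : GroupLieAlgebra 𝓘(ℂ, E) G)

end Grading

/-- The conjugation `g^⋆ = S(g⁻¹)`. -/
def star {G : Type*} [Group G] (S : G ≃* G) (g : G) : G := S g⁻¹

end Toda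

end

open scoped Manifold ContDiff Pointwise

set_option linter.unusedSectionVars false

noncomputable section

/-! The calculus of maps into `G` is carried by the adjoint representation. The Lie algebra is
semisimple, so its centre vanishes and ad is injective (`adL_injective`); a linear left inverse of
ad composed with Ad is then a chart of `G` at 1 (`exists_adChart`). Through it, the smoothness and
uniqueness of one-parameter subgroups, canonical coordinates of the second kind
(`exists_productChart`), the product rule for logarithmic derivatives and the Maurer-Cartan equation
(`fderiv_logDeriv`) become statements about operator-valued functions. The degrees of the
logarithmic derivative of a map to a graded subgroup are read off from ad in the same way
(`logDeriv_mem`).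

The first statement rests on B̃₊ ∩ B̃₋ = H̃. The reality condition says that ψ = φ⁻¹Σ(φ) lies in
B̃₊; since Σ² = 1 (true on exponentials, which generate the connected group), Σ(ψ) = ψ⁻¹, so ψ also
lies in B̃₋. For the intersection, B̃₊ = Ñ₊H̃ reduces the claim to Ñ₊ ∩ B̃₋ = 1. For an element of
Ñ₊ ∩ B̃₋ the degrees force Ad = 1, so it is central; but conjugation by exp(t h₀), with h₀ the
grading element, contracts Ñ₊ to 1 as t → -∞.

For the second statement, coordinates of the second kind give φ = μ₊ν₋η₋ near p. Admissibility
forces the (1,0)-part of the connection of μ₊ to vanish and its (0,1)-part Λ to lie in the orbit of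
x₊; by Maurer-Cartan Λ is antiholomorphic. It lifts to H̃ (`exists_orbit_lift`, transported by
conjugation): in a chart adapted to a slice transversal to the orbit, the slice coordinate of the
curve takes countably many values, `G` being second countable, hence is constant, and the other
coordinate exponentiates to the lift γ₊. The second decomposition is the Σ-image of the first: μ₋ =
Σ(μ₊), ν₊ = Σ(ν₋), η₊ = Σ(η₋)ψ⁻¹, γ₋ = Σ(γ₊). Then γ = γ₊⁻¹η₋ψΣ(η₋)⁻¹Σ(γ₊), which is hermitean
because Σ(ψ) = ψ⁻¹.

The Toda equation is the degree 0 part of Maurer-Cartan for f = φη₊⁻¹γ₋ = μ₊ν₋γ₊γ = μ₋ν₊γ₋.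
Comparing degrees in the two factorizations shows that the (0,1)-component of f is √-1 Ad(γ⁻¹)x₊ and
the (1,0)-component is that of γ plus √-1 x₋ (`IsLieGrading.wirtinger_conn_toda`). -/

namespace Toda

open Set Filter Topology

/-! ### Connected topological groups -/

section ConnectedGroup

theorem subgroup_eq_top_of_mem_nhds {G : Type*} [TopologicalSpace G] [Group G]
    [IsTopologicalGroup G] [ConnectedSpace G] {K : Subgroup G} (h : (K : Set G) ∈ 𝓝 (1 : G)) :
    K = ⊤ := by
  have ho : IsOpen (K : Set G) := K.isOpen_of_mem_nhds h
  have hc : IsClopen (K : Set G) := ⟨K.isClosed_of_isOpen ho, ho⟩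
  exact SetLike.coe_injective (hc.eq_univ ⟨1, K.one_mem⟩)

/-- A compact neighbourhood L of 1 generates a connected group, which is therefore the union of the
compact sets (L ∪ L⁻¹)ⁿ. This leads to second countability, the source of the countability argument
for orbits. -/
theorem sigmaCompactSpace_of_connectedSpace (G : Type*) [TopologicalSpace G] [Group G]
    [IsTopologicalGroup G] [ConnectedSpace G] [LocallyCompactSpace G] : SigmaCompactSpace G := by
  obtain ⟨L, hLc, hL⟩ := exists_compact_mem_nhds (1 : G)
  have htop : Subgroup.closure L = ⊤ :=
    subgroup_eq_top_of_mem_nhds (mem_of_superset hL Subgroup.subset_closure)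
  let K : ℕ → Set G := fun n => Nat.rec {1} (fun _ s => s * (L ∪ L⁻¹)) n
  have hK : ∀ n, IsCompact (K n) := by
    intro n
    induction n with
    | zero => exact isCompact_singleton
    | succ n ih => exact ih.mul (hLc.union hLc.inv)
  refine ⟨⟨K, hK, eq_univ_of_forall fun g => ?_⟩⟩
  have hg : g ∈ Subgroup.closure L := by rw [htop]; trivial
  induction hg using Subgroup.closure_induction_right with
  | one => exact mem_iUnion.2 ⟨0, rfl⟩
  | mul_right x _ y hy ih =>
    obtain ⟨n, hn⟩ := mem_iUnion.1 ih
    exact mem_iUnion.2 ⟨n + 1, mul_mem_mul hn (Or.inl hy)⟩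
  | mul_inv_cancel x _ y hy ih =>
    obtain ⟨n, hn⟩ := mem_iUnion.1 ih
    exact mem_iUnion.2 ⟨n + 1, mul_mem_mul hn (Or.inr (by simpa using hy))⟩

end ConnectedGroup

/-! ### From complex to real smoothness -/

section RestrictScalars

variable {F H E : Type*} [NormedAddCommGroup F] [NormedSpace ℂ F] [TopologicalSpace H]
  [NormedAddCommGroup E] [NormedSpace ℂ E]
  {I : ModelWithCorners ℂ F H} {I' : ModelWithCorners ℝ F H}
  {X : Type*} [TopologicalSpace X] [ChartedSpace H X]
  {Y : Type*} [TopologicalSpace Y] [ChartedSpace E Y] {f : X → Y} {n : WithTop ℕ∞}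

theorem contMDiffAt_restrictScalars (hI : ⇑I = ⇑I') (hIs : ⇑I.symm = ⇑I'.symm) {x : X}
    (h : ContMDiffAt I 𝓘(ℂ, E) n f x) : ContMDiffAt I' 𝓘(ℝ, E) n f x := by
  rw [contMDiffAt_iff] at h ⊢
  refine ⟨h.1, ?_⟩
  have h2 := h.2.restrict_scalars ℝ
  rw [hI] at h2
  simpa [extChartAt, OpenPartialHomeomorph.extend, hI, hIs, Function.comp_def] using h2

theorem contMDiff_restrictScalars (hI : ⇑I = ⇑I') (hIs : ⇑I.symm = ⇑I'.symm)
    (h : ContMDiff I 𝓘(ℂ, E) n f) : ContMDiff I' 𝓘(ℝ, E) n f :=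
  fun x => contMDiffAt_restrictScalars hI hIs (h x)

end RestrictScalars

/-! ### Complex manifolds and Lie groups as real ones; separation and countability -/

section Model

variable {F E : Type*} [NormedAddCommGroup F] [NormedSpace ℂ F]
  [NormedAddCommGroup E] [NormedSpace ℂ E]
  {X : Type*} [TopologicalSpace X] [ChartedSpace F X]
  {Y : Type*} [TopologicalSpace Y] [ChartedSpace E Y] {f : X → Y}

theorem hasMFDerivAt_restrictScalars {x : X} {f' : F →L[ℂ] E}
    (h : HasMFDerivAt 𝓘(ℂ, F) 𝓘(ℂ, E) f x f') :
    HasMFDerivAt 𝓘(ℝ, F) 𝓘(ℝ, E) f x (f'.restrictScalars ℝ : F →L[ℝ] E) := by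
  refine ⟨h.1, ?_⟩
  have h2 := h.2
  have h3 : HasFDerivWithinAt (writtenInExtChartAt 𝓘(ℂ, F) 𝓘(ℂ, E) x f) f' (Set.range 𝓘(ℂ, F))
    (extChartAt 𝓘(ℂ, F) x x) := h2
  exact h3.restrictScalars ℝ

/-- Cauchy-Riemann: a real differential commuting with √-1 is complex linear, and the defining
little-o estimate is the same over both fields. -/
theorem mdifferentiableAt_of_rdiff_smul {x : X} (h : MDifferentiableAt 𝓘(ℝ, F) 𝓘(ℝ, E) f x)
    (hI : ∀ v, rdiff F E f x (Complex.I • v) = Complex.I • rdiff F E f x v) :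
    MDifferentiableAt 𝓘(ℂ, F) 𝓘(ℂ, E) f x := by
  have h1 := h.hasMFDerivAt
  let D : F →L[ℝ] E := mfderiv 𝓘(ℝ, F) 𝓘(ℝ, E) f x
  let D' : F →L[ℂ] E :=
    { toFun := D
      map_add' := D.map_add
      map_smul' := fun c v => by
        have hv : c • v = c.re • v + c.im • (Complex.I • v) := by
          conv_lhs => rw [← Complex.re_add_im c]
          rw [add_smul, mul_smul]
          simp only [Complex.coe_smul]
        have hw : c • D v = c.re • D v + c.im • (Complex.I • D v) := by
          conv_lhs => rw [← Complex.re_add_im c]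
          rw [add_smul, mul_smul]
          simp only [Complex.coe_smul]
        have := hI v
        change D (Complex.I • v) = Complex.I • D v at this
        simp only [RingHom.id_apply]
        rw [hv, hw, D.map_add, D.map_smul, D.map_smul, this]
      cont := D.cont }
  refine HasMFDerivAt.mdifferentiableAt (f' := D') ⟨h1.1, ?_⟩
  have h2 : HasFDerivWithinAt (writtenInExtChartAt 𝓘(ℝ, F) 𝓘(ℝ, E) x f) D (Set.range 𝓘(ℝ, F))
    (extChartAt 𝓘(ℝ, F) x x) := h1.2
  exact HasFDerivWithinAt.of_isLittleO h2.isLittleO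

theorem isManifold_restrictScalars {n : WithTop ℕ∞} [IsManifold 𝓘(ℂ, F) n X] :
    IsManifold 𝓘(ℝ, F) n X := by
  refine isManifold_of_contDiffOn _ _ _ fun e e' he he' => ?_
  have h := (contDiffGroupoid n 𝓘(ℂ, F)).compatible he he'
  rw [contDiffGroupoid, mem_groupoid_of_pregroupoid] at h
  have h1 := h.1
  simp only [contDiffPregroupoid] at h1
  exact h1.restrict_scalars ℝ

theorem lieGroup_restrictScalars {n : WithTop ℕ∞} {G : Type*} [TopologicalSpace G]
    [ChartedSpace E G] [Group G] [LieGroup 𝓘(ℂ, E) n G] : LieGroup 𝓘(ℝ, E) n G :=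
  { isManifold_restrictScalars (F := E) (X := G) with
    contMDiff_mul := contMDiff_restrictScalars (I := 𝓘(ℂ, E).prod 𝓘(ℂ, E)) rfl rfl
      (contMDiff_mul 𝓘(ℂ, E) n)
    contMDiff_inv := contMDiff_restrictScalars (I := 𝓘(ℂ, E)) rfl rfl (contMDiff_inv 𝓘(ℂ, E) n) }

/-- Points are closed in a space with charts in `E`, and a topological group with closed points is
Hausdorff. -/
theorem t2Space_of_lieGroup (G : Type*) [TopologicalSpace G]
    [ChartedSpace E G] [Group G] [LieGroup 𝓘(ℂ, E) ω G] : T2Space G := by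
  have : IsTopologicalGroup G := topologicalGroup_of_lieGroup 𝓘(ℂ, E) ω
  have : T1Space G := ChartedSpace.t1Space E G
  infer_instance

theorem secondCountable_of_lieGroup [FiniteDimensional ℂ E] (G : Type*) [TopologicalSpace G]
    [ChartedSpace E G] [Group G] [LieGroup 𝓘(ℂ, E) ω G] [ConnectedSpace G] :
    SecondCountableTopology G := by
  have : IsTopologicalGroup G := topologicalGroup_of_lieGroup 𝓘(ℂ, E) ω
  have : ProperSpace E := FiniteDimensional.proper ℂ E
  have : LocallyCompactSpace G := ChartedSpace.locallyCompactSpace E G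
  have : SigmaCompactSpace G := sigmaCompactSpace_of_connectedSpace G
  exact ChartedSpace.secondCountable_of_sigmaCompact E G

end Model

/-! ### The adjoint representation and its derivative -/

section AdjointRepresentation

variable (E : Type*) [NormedAddCommGroup E] [NormedSpace ℂ E]
  (G : Type*) [TopologicalSpace G] [ChartedSpace E G] [Group G]

/-- The group multiplication in the chart at the identity. -/
def mulChart (p : E × E) : E :=
  extChartAt 𝓘(ℂ, E) (1 : G)
    ((extChartAt 𝓘(ℂ, E) (1 : G)).symm p.1 * (extChartAt 𝓘(ℂ, E) (1 : G)).symm p.2)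

/-- The conjugation in the chart at the identity. -/
def conjChart (p : E × E) : E :=
  extChartAt 𝓘(ℂ, E) (1 : G)
    ((extChartAt 𝓘(ℂ, E) (1 : G)).symm p.1 * (extChartAt 𝓘(ℂ, E) (1 : G)).symm p.2 *
      ((extChartAt 𝓘(ℂ, E) (1 : G)).symm p.1)⁻¹)

/-- The chart at the identity, evaluated at the identity. -/
def chartOrigin : E := extChartAt 𝓘(ℂ, E) (1 : G) 1

variable {E G}

theorem symm_chartOrigin : (extChartAt 𝓘(ℂ, E) (1 : G)).symm (chartOrigin E G) = 1 :=
  extChartAt_to_inv (I := 𝓘(ℂ, E)) (1 : G)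

/-- The tangent space at 1 is identified with `E` through this very chart, which therefore reads as
the identity in coordinates. -/
theorem hasMFDerivAt_extChartAt_one : HasMFDerivAt 𝓘(ℂ, E) 𝓘(ℂ, E)
    (extChartAt 𝓘(ℂ, E) (1 : G)) 1 (ContinuousLinearMap.id ℂ E) := by
  refine ⟨continuousAt_extChartAt (I := 𝓘(ℂ, E)) (1 : G), ?_⟩
  have h : HasFDerivAt (fun x : E => x) (ContinuousLinearMap.id ℂ E) (chartOrigin E G) :=
    hasFDerivAt_id _
  refine HasFDerivAt.hasFDerivWithinAt (h.congr_of_eventuallyEq ?_)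
  filter_upwards [extChartAt_target_mem_nhds (I := 𝓘(ℂ, E)) (1 : G)] with u hu
  exact (extChartAt 𝓘(ℂ, E) (1 : G)).right_inv hu

theorem hasMFDerivAt_extChartAt_one_symm : HasMFDerivAt 𝓘(ℂ, E) 𝓘(ℂ, E)
    (extChartAt 𝓘(ℂ, E) (1 : G)).symm (chartOrigin E G) (ContinuousLinearMap.id ℂ E) := by
  refine ⟨continuousAt_extChartAt_symm (I := 𝓘(ℂ, E)) (1 : G), ?_⟩
  have h : HasFDerivAt (fun x : E => x) (ContinuousLinearMap.id ℂ E) (chartOrigin E G) :=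
    hasFDerivAt_id _
  refine HasFDerivAt.hasFDerivWithinAt (h.congr_of_eventuallyEq ?_)
  filter_upwards [extChartAt_target_mem_nhds (I := 𝓘(ℂ, E)) (1 : G)] with u hu
  simp only [writtenInExtChartAt, symm_chartOrigin]
  exact (extChartAt 𝓘(ℂ, E) (1 : G)).right_inv hu

theorem mfderiv_one_eq_fderiv {f : G → G} (hf : MDifferentiableAt 𝓘(ℂ, E) 𝓘(ℂ, E) f 1)
    (h1 : f 1 = 1) : (mfderiv 𝓘(ℂ, E) 𝓘(ℂ, E) f 1 : E →L[ℂ] E) =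
      fderiv ℂ (fun u => extChartAt 𝓘(ℂ, E) (1 : G) (f ((extChartAt 𝓘(ℂ, E) (1 : G)).symm u)))
        (chartOrigin E G) := by
  have h := hf.mfderiv
  have h2 : fderivWithin ℂ (writtenInExtChartAt 𝓘(ℂ, E) 𝓘(ℂ, E) (1 : G) f) (range 𝓘(ℂ, E))
      (extChartAt 𝓘(ℂ, E) (1 : G) 1) =
      fderiv ℂ (fun u => extChartAt 𝓘(ℂ, E) (1 : G) (f ((extChartAt 𝓘(ℂ, E) (1 : G)).symm u)))
        (chartOrigin E G) := by
    rw [modelWithCornersSelf_coe, range_id, fderivWithin_univ, writtenInExtChartAt, h1]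
    rfl
  exact h.trans h2

theorem chartOrigin_mem_target : (extChartAt 𝓘(ℂ, E) (1 : G)).target ∈ 𝓝 (chartOrigin E G) :=
  extChartAt_target_mem_nhds (I := 𝓘(ℂ, E)) (1 : G)

variable [LieGroup 𝓘(ℂ, E) ω G]

theorem contMDiffAt_extChartAt_one_symm : ContMDiffAt 𝓘(ℂ, E) 𝓘(ℂ, E) ω
    (extChartAt 𝓘(ℂ, E) (1 : G)).symm (chartOrigin E G) :=
  (contMDiffOn_extChartAt_symm (I := 𝓘(ℂ, E)) (n := ω) (1 : G)).contMDiffAt chartOrigin_mem_target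

theorem contMDiffAt_extChartAt_one : ContMDiffAt 𝓘(ℂ, E) 𝓘(ℂ, E) ω
    (extChartAt 𝓘(ℂ, E) (1 : G)) 1 := contMDiffAt_extChartAt (I := 𝓘(ℂ, E)) (n := ω)

theorem contDiffAt_mulChart :
    ContDiffAt ℂ ω (mulChart E G) (chartOrigin E G, chartOrigin E G) := by
  have h1 : ContMDiffAt 𝓘(ℂ, E × E) 𝓘(ℂ, E) ω
      (fun p : E × E => (extChartAt 𝓘(ℂ, E) (1 : G)).symm p.1) (chartOrigin E G, chartOrigin E G) :=
    ContMDiffAt.comp (I' := 𝓘(ℂ, E)) (g := (extChartAt 𝓘(ℂ, E) (1 : G)).symm)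
      (f := Prod.fst) (chartOrigin E G, chartOrigin E G)
      contMDiffAt_extChartAt_one_symm contDiff_fst.contMDiff.contMDiffAt
  have h2 : ContMDiffAt 𝓘(ℂ, E × E) 𝓘(ℂ, E) ω
      (fun p : E × E => (extChartAt 𝓘(ℂ, E) (1 : G)).symm p.2) (chartOrigin E G, chartOrigin E G) :=
    ContMDiffAt.comp (I' := 𝓘(ℂ, E)) (g := (extChartAt 𝓘(ℂ, E) (1 : G)).symm)
      (f := Prod.snd) (chartOrigin E G, chartOrigin E G)
      contMDiffAt_extChartAt_one_symm contDiff_snd.contMDiff.contMDiffAt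
  have h3 := h1.mul h2
  refine contMDiffAt_iff_contDiffAt.1 ?_
  refine ContMDiffAt.comp_of_eq (I' := 𝓘(ℂ, E)) (g := extChartAt 𝓘(ℂ, E) (1 : G)) (y := (1 : G))
    contMDiffAt_extChartAt_one h3 ?_
  simp only [symm_chartOrigin, mul_one]

theorem contDiffAt_conjChart :
    ContDiffAt ℂ ω (conjChart E G) (chartOrigin E G, chartOrigin E G) := by
  have h1 : ContMDiffAt 𝓘(ℂ, E × E) 𝓘(ℂ, E) ω
      (fun p : E × E => (extChartAt 𝓘(ℂ, E) (1 : G)).symm p.1) (chartOrigin E G, chartOrigin E G) :=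
    ContMDiffAt.comp (I' := 𝓘(ℂ, E)) (g := (extChartAt 𝓘(ℂ, E) (1 : G)).symm)
      (f := Prod.fst) (chartOrigin E G, chartOrigin E G)
      contMDiffAt_extChartAt_one_symm contDiff_fst.contMDiff.contMDiffAt
  have h2 : ContMDiffAt 𝓘(ℂ, E × E) 𝓘(ℂ, E) ω
      (fun p : E × E => (extChartAt 𝓘(ℂ, E) (1 : G)).symm p.2) (chartOrigin E G, chartOrigin E G) :=
    ContMDiffAt.comp (I' := 𝓘(ℂ, E)) (g := (extChartAt 𝓘(ℂ, E) (1 : G)).symm)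
      (f := Prod.snd) (chartOrigin E G, chartOrigin E G)
      contMDiffAt_extChartAt_one_symm contDiff_snd.contMDiff.contMDiffAt
  have h3 := (h1.mul h2).mul h1.inv
  refine contMDiffAt_iff_contDiffAt.1 ?_
  refine ContMDiffAt.comp_of_eq (I' := 𝓘(ℂ, E)) (g := extChartAt 𝓘(ℂ, E) (1 : G)) (y := (1 : G))
    contMDiffAt_extChartAt_one h3 ?_
  simp only [symm_chartOrigin, inv_one, mul_one]

theorem contMDiff_conj (g : G) : ContMDiff 𝓘(ℂ, E) 𝓘(ℂ, E) ω (fun h : G => g * h * g⁻¹) :=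
  (contMDiff_mul_right (a := g⁻¹)).comp (contMDiff_mul_left (a := g))

theorem mdifferentiableAt_conj (g h : G) :
    MDifferentiableAt 𝓘(ℂ, E) 𝓘(ℂ, E) (fun h : G => g * h * g⁻¹) h :=
  ((contMDiff_conj g).contMDiffAt).mdifferentiableAt (by simp)

variable (E) in
/-- The differential of the conjugation by `g` as an endomorphism of the model space. -/
def AdFun (g : G) : E →L[ℂ] E := mfderiv 𝓘(ℂ, E) 𝓘(ℂ, E) (fun h : G => g * h * g⁻¹) 1

theorem hasMFDerivAt_conj (g : G) :
    HasMFDerivAt 𝓘(ℂ, E) 𝓘(ℂ, E) (fun h : G => g * h * g⁻¹) 1 (AdFun E g) :=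
  (mdifferentiableAt_conj g 1).hasMFDerivAt

variable (E G) in
/-- The adjoint representation as a homomorphism of monoids. -/
def AdL : G →* (E →L[ℂ] E) where
  toFun := AdFun E
  map_one' := by
    have h := hasMFDerivAt_conj (E := E) (1 : G)
    have h2 : (fun h : G => 1 * h * 1⁻¹) = id := by ext; simp
    rw [h2] at h
    exact hasMFDerivAt_unique h (hasMFDerivAt_id (I := 𝓘(ℂ, E)) (1 : G))
  map_mul' g k := by
    have h := hasMFDerivAt_conj (E := E) (g * k)
    have h2 : (fun h : G => g * k * h * (g * k)⁻¹) =
        (fun h : G => g * h * g⁻¹) ∘ (fun h : G => k * h * k⁻¹) := by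
      ext; simp [mul_assoc]
    rw [h2] at h
    have hk := hasMFDerivAt_conj (E := E) k
    have hg : HasMFDerivAt 𝓘(ℂ, E) 𝓘(ℂ, E) (fun h : G => g * h * g⁻¹) (k * 1 * k⁻¹)
        (AdFun E g) := by
      have := hasMFDerivAt_conj (E := E) g
      have h1 : (1 : G) = k * 1 * k⁻¹ := by simp
      rwa [h1] at this
    exact hasMFDerivAt_unique h (HasMFDerivAt.comp (1 : G) hg hk)

theorem AdL_symm_eq_fderiv (x : E) : AdL E G ((extChartAt 𝓘(ℂ, E) (1 : G)).symm x) =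
    fderiv ℂ (fun u => conjChart E G (x, u)) (chartOrigin E G) :=
  mfderiv_one_eq_fderiv (mdifferentiableAt_conj _ _) (by simp)

/-- Exhibits Ad near 1 as a partial derivative of the conjugation, which is analytic in both
variables jointly; the analyticity of Ad comes from here. -/
theorem AdL_symm_eventuallyEq :
    (fun x => AdL E G ((extChartAt 𝓘(ℂ, E) (1 : G)).symm x)) =ᶠ[𝓝 (chartOrigin E G)]
      fun x => (fderiv ℂ (conjChart E G) (x, chartOrigin E G)).comp
        (ContinuousLinearMap.inr ℂ E E) := by
  have h1 : ∀ᶠ x in 𝓝 (chartOrigin E G),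
      ContDiffAt ℂ ω (conjChart E G) (x, chartOrigin E G) := by
    have h := contDiffAt_conjChart (E := E) (G := G) |>.eventually (by simp)
    have hc : ContinuousAt (fun x : E => (x, chartOrigin E G)) (chartOrigin E G) := by fun_prop
    exact hc.eventually h
  filter_upwards [h1] with x hx
  rw [AdL_symm_eq_fderiv]
  have h2 := (hx.differentiableAt (by simp)).hasFDerivAt
  have h3 : HasFDerivAt (fun u : E => (x, u)) (ContinuousLinearMap.inr ℂ E E) (chartOrigin E G) :=
    hasFDerivAt_prodMk_right x _
  exact (h2.comp _ h3).fderiv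

theorem contDiffAt_AdL_symm : ContDiffAt ℂ ω
    (fun x => AdL E G ((extChartAt 𝓘(ℂ, E) (1 : G)).symm x)) (chartOrigin E G) := by
  refine ContDiffAt.congr_of_eventuallyEq ?_ AdL_symm_eventuallyEq
  have h := (contDiffAt_conjChart (E := E) (G := G)).fderiv_right (m := ω) (by simp)
  have h2 : ContDiffAt ℂ ω (fun x : E => fderiv ℂ (conjChart E G) (x, chartOrigin E G))
      (chartOrigin E G) :=
    ContDiffAt.comp (chartOrigin E G) (g := fderiv ℂ (conjChart E G))
      (f := fun x : E => (x, chartOrigin E G)) h (by fun_prop)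
  exact h2.clm_comp contDiffAt_const

/-- Analyticity at 1 is carried to g by Ad(h) = Ad(g) Ad(g⁻¹h). -/
theorem contMDiff_AdL : ContMDiff 𝓘(ℂ, E) 𝓘(ℂ, E →L[ℂ] E) ω (AdL E G) := by
  have h1 : ContMDiffAt 𝓘(ℂ, E) 𝓘(ℂ, E →L[ℂ] E) ω (AdL E G) 1 := by
    have h2 : ContMDiffAt 𝓘(ℂ, E) 𝓘(ℂ, E →L[ℂ] E) ω
        ((fun x => AdL E G ((extChartAt 𝓘(ℂ, E) (1 : G)).symm x)) ∘ extChartAt 𝓘(ℂ, E) (1 : G)) 1 :=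
      ContMDiffAt.comp (I' := 𝓘(ℂ, E)) (1 : G) contDiffAt_AdL_symm.contMDiffAt
        contMDiffAt_extChartAt_one
    refine h2.congr_of_eventuallyEq ?_
    filter_upwards [extChartAt_source_mem_nhds (I := 𝓘(ℂ, E)) (1 : G)] with g hg
    simp only [Function.comp_apply, (extChartAt 𝓘(ℂ, E) (1 : G)).left_inv hg]
  intro g
  have h2 : AdL E G = (fun T : E →L[ℂ] E => AdL E G g * T) ∘ AdL E G ∘ (fun h => g⁻¹ * h) := by
    ext h v
    simp [← map_mul]
  have h3 : ContMDiffAt 𝓘(ℂ, E) 𝓘(ℂ, E →L[ℂ] E) ω (AdL E G ∘ (fun h => g⁻¹ * h)) g :=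
    ContMDiffAt.comp_of_eq (I' := 𝓘(ℂ, E)) (y := (1 : G)) h1
      (contMDiff_mul_left.contMDiffAt) (by simp)
  have h4 : ContDiff ℂ ω (fun T : E →L[ℂ] E => AdL E G g * T) :=
    (ContinuousLinearMap.mul ℂ (E →L[ℂ] E) (AdL E G g)).contDiff
  rw [h2]
  exact ContMDiffAt.comp (I' := 𝓘(ℂ, E →L[ℂ] E)) g h4.contMDiff.contMDiffAt h3

theorem eventually_chartOrigin_contDiffAt_mulChart : ∀ᶠ x in 𝓝 (chartOrigin E G),
    ContDiffAt ℂ ω (mulChart E G) (x, chartOrigin E G) := by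
  have h := contDiffAt_mulChart (E := E) (G := G) |>.eventually (by simp)
  have hc : ContinuousAt (fun x : E => (x, chartOrigin E G)) (chartOrigin E G) := by fun_prop
  exact hc.eventually h

variable (E G) in
/-- The left-invariant vector field of `v`, in the chart at the identity. -/
def chartField (v : E) : E → E := VectorField.mpullbackWithin 𝓘(ℂ, E) 𝓘(ℂ, E) (extChartAt 𝓘(ℂ, E) (1 : G)).symm
      (mulInvariantVectorField (I := 𝓘(ℂ, E)) (G := G) v) (range 𝓘(ℂ, E))

variable (E G) in
/-- The bracket of the Lie algebra of `G`, on the model space. -/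
def lieBr (v w : E) : E := Bracket.bracket (L := GroupLieAlgebra 𝓘(ℂ, E) G)
  (M := GroupLieAlgebra 𝓘(ℂ, E) G) v w

/-- In the chart, left translation by the point with coordinate x is the multiplication with first
argument x, so transporting `v` from the identity differentiates in the second argument. -/
theorem chartField_eventuallyEq (v : E) :
    chartField E G v =ᶠ[𝓝 (chartOrigin E G)] fun x => fderiv ℂ (mulChart E G) (x, chartOrigin E G) (0, v) := by
  filter_upwards [chartOrigin_mem_target (E := E) (G := G),
    eventually_chartOrigin_contDiffAt_mulChart] with x hx hm
  have hinv := ContinuousLinearMap.inverse_eq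
    (mfderivWithin_extChartAt_symm_comp_mfderiv_extChartAt (I := 𝓘(ℂ, E)) hx)
    (mfderiv_extChartAt_comp_mfderivWithin_extChartAt_symm (I := 𝓘(ℂ, E)) hx)
  rw [chartField, VectorField.mpullbackWithin_apply, hinv]
  set g := (extChartAt 𝓘(ℂ, E) (1 : G)).symm x with hg
  have hgs : g ∈ (chartAt E (1 : G)).source := by
    rw [← extChartAt_source 𝓘(ℂ, E)]; exact (extChartAt 𝓘(ℂ, E) (1 : G)).map_target hx
  let D1 : E →L[ℂ] E := mfderiv 𝓘(ℂ, E) 𝓘(ℂ, E) (extChartAt 𝓘(ℂ, E) (1 : G)) g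
  let D2 : E →L[ℂ] E := mfderiv 𝓘(ℂ, E) 𝓘(ℂ, E) (fun h : G => g * h) 1
  have h1 : HasMFDerivAt 𝓘(ℂ, E) 𝓘(ℂ, E) (extChartAt 𝓘(ℂ, E) (1 : G)) (g * 1) D1 := by
    have : HasMFDerivAt 𝓘(ℂ, E) 𝓘(ℂ, E) (extChartAt 𝓘(ℂ, E) (1 : G)) g D1 :=
      (mdifferentiableAt_extChartAt (I := 𝓘(ℂ, E)) hgs).hasMFDerivAt
    rwa [← mul_one g] at this
  have h2 : HasMFDerivAt 𝓘(ℂ, E) 𝓘(ℂ, E) (fun h : G => g * h) 1 D2 :=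
    ((contMDiff_mul_left (I := 𝓘(ℂ, E)) (n := ω) (a := g)).contMDiffAt.mdifferentiableAt
      (by simp)).hasMFDerivAt
  have h12 : HasMFDerivAt 𝓘(ℂ, E) 𝓘(ℂ, E)
      (fun h : G => extChartAt 𝓘(ℂ, E) (1 : G) (g * h))
      ((extChartAt 𝓘(ℂ, E) (1 : G)).symm (chartOrigin E G)) (D1.comp D2) := by
    rw [symm_chartOrigin]
    exact HasMFDerivAt.comp (1 : G) h1 h2
  have h3 := HasMFDerivAt.comp (chartOrigin E G) h12 hasMFDerivAt_extChartAt_one_symm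
  have h4 : HasFDerivAt (fun u => mulChart E G (x, u))
      ((D1.comp D2).comp (ContinuousLinearMap.id ℂ E)) (chartOrigin E G) := h3.hasFDerivAt
  have h5 : HasFDerivAt (fun u => mulChart E G (x, u))
      ((fderiv ℂ (mulChart E G) (x, chartOrigin E G)).comp (ContinuousLinearMap.inr ℂ E E))
      (chartOrigin E G) :=
    ((hm.differentiableAt (by simp)).hasFDerivAt).comp _ (hasFDerivAt_prodMk_right x _)
  have h6 := congrArg (fun L : E →L[ℂ] E => L v) (h4.unique h5)
  exact h6

theorem fderiv_mulChart_left (v : E) :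
    fderiv ℂ (mulChart E G) (chartOrigin E G, chartOrigin E G) (v, 0) = v := by
  have h := (contDiffAt_mulChart (E := E) (G := G)).differentiableAt (by simp)
  have h2 : HasFDerivAt (fun u => mulChart E G (u, chartOrigin E G))
      ((fderiv ℂ (mulChart E G) (chartOrigin E G, chartOrigin E G)).comp
        (ContinuousLinearMap.inl ℂ E E)) (chartOrigin E G) :=
    HasFDerivAt.comp (f := fun u : E => (u, chartOrigin E G)) _ h.hasFDerivAt (hasFDerivAt_prodMk_left _ _)
  have h3 : HasFDerivAt (fun u => mulChart E G (u, chartOrigin E G))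
      (ContinuousLinearMap.id ℂ E) (chartOrigin E G) := by
    refine (hasFDerivAt_id _).congr_of_eventuallyEq ?_
    filter_upwards [chartOrigin_mem_target (E := E) (G := G)] with u hu
    simp only [mulChart, symm_chartOrigin, mul_one, (extChartAt 𝓘(ℂ, E) (1 : G)).right_inv hu, id]
  exact congrArg (fun L : E →L[ℂ] E => L v) (h2.unique h3)

theorem fderiv_mulChart_right (v : E) :
    fderiv ℂ (mulChart E G) (chartOrigin E G, chartOrigin E G) (0, v) = v := by
  have h := (contDiffAt_mulChart (E := E) (G := G)).differentiableAt (by simp)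
  have h2 : HasFDerivAt (fun u => mulChart E G (chartOrigin E G, u))
      ((fderiv ℂ (mulChart E G) (chartOrigin E G, chartOrigin E G)).comp
        (ContinuousLinearMap.inr ℂ E E)) (chartOrigin E G) :=
    h.hasFDerivAt.comp _ (hasFDerivAt_prodMk_right _ _)
  have h3 : HasFDerivAt (fun u => mulChart E G (chartOrigin E G, u))
      (ContinuousLinearMap.id ℂ E) (chartOrigin E G) := by
    refine (hasFDerivAt_id _).congr_of_eventuallyEq ?_
    filter_upwards [chartOrigin_mem_target (E := E) (G := G)] with u hu
    simp only [mulChart, symm_chartOrigin, one_mul, (extChartAt 𝓘(ℂ, E) (1 : G)).right_inv hu, id]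
  exact congrArg (fun L : E →L[ℂ] E => L v) (h2.unique h3)

/-- The derivative of the left-invariant field of w along v is a mixed second derivative of the
multiplication; the bracket of vector fields antisymmetrizes it. -/
theorem bracket_eq_fderiv_fderiv (v w : E) :
    lieBr E G v w =
      fderiv ℂ (fderiv ℂ (mulChart E G)) (chartOrigin E G, chartOrigin E G) (v, 0) (0, w) -
      fderiv ℂ (fderiv ℂ (mulChart E G)) (chartOrigin E G, chartOrigin E G) (w, 0) (0, v) := by
  have hD : ∀ w : E, fderiv ℂ (chartField E G w)
      (chartOrigin E G) = ((fderiv ℂ (fderiv ℂ (mulChart E G))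
        (chartOrigin E G, chartOrigin E G)).comp (ContinuousLinearMap.inl ℂ E E)).flip (0, w) := by
    intro w
    rw [(chartField_eventuallyEq (G := G) w).fderiv_eq]
    have h := ((contDiffAt_mulChart (E := E) (G := G)).fderiv_right (m := ω)
      (by simp)).differentiableAt (by simp)
    have h2 : HasFDerivAt (fun x => fderiv ℂ (mulChart E G) (x, chartOrigin E G))
      ((fderiv ℂ (fderiv ℂ (mulChart E G)) (chartOrigin E G, chartOrigin E G)).comp
        (ContinuousLinearMap.inl ℂ E E)) (chartOrigin E G) :=
      HasFDerivAt.comp (f := fun u : E => (u, chartOrigin E G)) _ h.hasFDerivAt (hasFDerivAt_prodMk_left _ _)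
    have h3 := h2.clm_apply (hasFDerivAt_const ((0 : E), w) (chartOrigin E G))
    rw [h3.fderiv]
    ext u
    simp
  have hV : ∀ w : E, chartField E G w (chartOrigin E G) = w := fun w =>
    (chartField_eventuallyEq (G := G) w).self_of_nhds.trans (fderiv_mulChart_right w)
  have key : VectorField.lieBracketWithin ℂ (chartField E G v) (chartField E G w)
      ((extChartAt 𝓘(ℂ, E) (1 : G)).symm ⁻¹' univ ∩ range 𝓘(ℂ, E)) (chartOrigin E G) =
      fderiv ℂ (fderiv ℂ (mulChart E G)) (chartOrigin E G, chartOrigin E G) (v, 0) (0, w) -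
      fderiv ℂ (fderiv ℂ (mulChart E G)) (chartOrigin E G, chartOrigin E G) (w, 0) (0, v) := by
    rw [modelWithCornersSelf_coe, range_id, preimage_univ, inter_univ,
      VectorField.lieBracketWithin_univ, VectorField.lieBracket_eq]
    simp only [hD, hV]
    rfl
  let D : E →L[ℂ] E := mfderiv 𝓘(ℂ, E) 𝓘(ℂ, E) (extChartAt 𝓘(ℂ, E) (1 : G)) 1
  have h0 : D = ContinuousLinearMap.id ℂ E := (hasMFDerivAt_extChartAt_one (G := G)).mfderiv
  have h1 : lieBr E G v w = D.inverse (VectorField.lieBracketWithin ℂ (chartField E G v)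
      (chartField E G w) ((extChartAt 𝓘(ℂ, E) (1 : G)).symm ⁻¹' univ ∩ range 𝓘(ℂ, E))
      (chartOrigin E G)) :=
    VectorField.mlieBracketWithin_apply (I := 𝓘(ℂ, E)) (M := G) (x₀ := 1) (s := univ)
      (V := mulInvariantVectorField (I := 𝓘(ℂ, E)) v) (W := mulInvariantVectorField (I := 𝓘(ℂ, E)) w)
  rw [h1, key, h0, ContinuousLinearMap.inverse_id]
  rfl

/-- Differentiate (g u g⁻¹) g = g u in u at 1, which is `hmul`, and then in g at 1. Besides the
derivative of Ad only second derivatives of the multiplication appear, and by their symmetry these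
combine to the bracket. -/
theorem fderiv_AdL_symm (v w : E) :
    fderiv ℂ (fun x => AdL E G ((extChartAt 𝓘(ℂ, E) (1 : G)).symm x)) (chartOrigin E G) v w =
      lieBr E G v w := by
  set o := chartOrigin E G with ho
  set m := mulChart E G with hm
  have hmd := contDiffAt_mulChart (E := E) (G := G)
  have hdm : DifferentiableAt ℂ (fderiv ℂ m) (o, o) :=
    (hmd.fderiv_right (m := ω) (by simp)).differentiableAt (by simp)
  have hmul : ∀ᶠ x in 𝓝 o,
      (fderiv ℂ m (o, x)) (AdL E G ((extChartAt 𝓘(ℂ, E) (1 : G)).symm x) w, 0) =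
        fderiv ℂ m (x, o) (0, w) := by
    have e1 : ∀ᶠ x in 𝓝 o, ContDiffAt ℂ ω m (o, x) := by
      have hc : ContinuousAt (fun x : E => (o, x)) o := by fun_prop
      exact hc.eventually (hmd.eventually (by simp))
    have e2 : ∀ᶠ x in 𝓝 o, ContDiffAt ℂ ω (conjChart E G) (x, o) := by
      have hc : ContinuousAt (fun x : E => (x, o)) o := by fun_prop
      exact hc.eventually ((contDiffAt_conjChart (E := E) (G := G)).eventually (by simp))
    have e3 : ∀ᶠ x in 𝓝 o, (conjChart E G (x, o) = o) ∧
        (fun u => m (conjChart E G (x, u), x)) =ᶠ[𝓝 o] fun u => m (x, u) := by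
      filter_upwards [chartOrigin_mem_target (E := E) (G := G)] with x hx
      set g := (extChartAt 𝓘(ℂ, E) (1 : G)).symm x with hg
      refine ⟨?_, ?_⟩
      · simp only [conjChart, ho, symm_chartOrigin, mul_one, mul_inv_cancel]; rfl
      have hc : ContinuousAt (fun u : E => g * (extChartAt 𝓘(ℂ, E) (1 : G)).symm u * g⁻¹) o :=
        ((contMDiff_conj (E := E) g).continuous.continuousAt).comp
          (continuousAt_extChartAt_symm (I := 𝓘(ℂ, E)) (1 : G))
      have h1 : (extChartAt 𝓘(ℂ, E) (1 : G)).source ∈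
          𝓝 (g * (extChartAt 𝓘(ℂ, E) (1 : G)).symm o * g⁻¹) := by
        rw [ho, symm_chartOrigin, mul_one, mul_inv_cancel]
        exact extChartAt_source_mem_nhds (I := 𝓘(ℂ, E)) (1 : G)
      filter_upwards [hc h1] with u hu
      simp only [hm, mulChart, conjChart, ← hg]
      rw [(extChartAt 𝓘(ℂ, E) (1 : G)).left_inv hu]
      simp
    filter_upwards [e1, e2, e3, eventually_chartOrigin_contDiffAt_mulChart] with x h1 h2 h3 h4
    have d1 : HasFDerivAt (fun u => conjChart E G (x, u))
        (AdL E G ((extChartAt 𝓘(ℂ, E) (1 : G)).symm x)) o := by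
      rw [AdL_symm_eq_fderiv]
      refine DifferentiableAt.hasFDerivAt ?_
      exact ((h2.differentiableAt (by simp)).hasFDerivAt.comp o
        (hasFDerivAt_prodMk_right x o)).differentiableAt
    have d2 : HasFDerivAt (fun u => (conjChart E G (x, u), x))
        ((AdL E G ((extChartAt 𝓘(ℂ, E) (1 : G)).symm x)).prod 0) o :=
      d1.prodMk (hasFDerivAt_const x o)
    have d3 : HasFDerivAt m (fderiv ℂ m (o, x)) (conjChart E G (x, o), x) := by
      rw [h3.1]; exact (h1.differentiableAt (by simp)).hasFDerivAt
    have d4 := (d3.comp o d2).congr_of_eventuallyEq h3.2.symm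
    have d5 : HasFDerivAt (fun u => m (x, u))
      ((fderiv ℂ m (x, o)).comp (ContinuousLinearMap.inr ℂ E E)) o :=
      ((h4.differentiableAt (by simp)).hasFDerivAt).comp _ (hasFDerivAt_prodMk_right x _)
    exact congrArg (fun L : E →L[ℂ] E => L w) (d4.unique d5)
  have hA : HasFDerivAt (fun x => AdL E G ((extChartAt 𝓘(ℂ, E) (1 : G)).symm x))
      (fderiv ℂ (fun x => AdL E G ((extChartAt 𝓘(ℂ, E) (1 : G)).symm x)) o) o :=
    (contDiffAt_AdL_symm.differentiableAt (by simp)).hasFDerivAt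
  have hR : HasFDerivAt (fun x => fderiv ℂ m (o, x))
      ((fderiv ℂ (fderiv ℂ m) (o, o)).comp (ContinuousLinearMap.inr ℂ E E)) o :=
    hdm.hasFDerivAt.comp _ (hasFDerivAt_prodMk_right o o)
  have hL : HasFDerivAt (fun x => fderiv ℂ m (x, o))
      ((fderiv ℂ (fderiv ℂ m) (o, o)).comp (ContinuousLinearMap.inl ℂ E E)) o :=
    HasFDerivAt.comp (f := fun u : E => (u, o)) _ hdm.hasFDerivAt (hasFDerivAt_prodMk_left o o)
  have hAw := (hA.clm_apply (hasFDerivAt_const w o)).prodMk (hasFDerivAt_const (0 : E) o)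
  have hl := hR.clm_apply hAw
  have hr := (hL.clm_apply (hasFDerivAt_const ((0 : E), w) o)).congr_of_eventuallyEq hmul
  have h := congrArg (fun L : E →L[ℂ] E => L v) (hl.unique hr)
  have hone : AdL E G ((extChartAt 𝓘(ℂ, E) (1 : G)).symm o) = 1 := by
    rw [ho, symm_chartOrigin, map_one]
  have hsym : fderiv ℂ (fderiv ℂ m) (o, o) (0, v) (w, 0) =
      fderiv ℂ (fderiv ℂ m) (o, o) (w, 0) (0, v) :=
    hmd.isSymmSndFDerivAt (by simp) (0, v) (w, 0)
  simp [-extChartAt, hone] at h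
  rw [hm, fderiv_mulChart_left, ← hm, hsym] at h
  rw [bracket_eq_fderiv_fderiv, ← ho, ← hm, eq_sub_iff_add_eq]
  exact h

end AdjointRepresentation

/-- Such an x is central, and a trivial radical leaves no centre. -/
theorem eq_zero_of_lie_eq_zero {L : Type*} [LieRing L] [LieAlgebra ℂ L]
    [LieAlgebra.HasTrivialRadical ℂ L] {x : L} (h : ∀ y : L, ⁅x, y⁆ = 0) : x = 0 := by
  have hx : x ∈ LieAlgebra.center ℂ L := by
    rw [LieModule.mem_maxTrivSubmodule]
    intro y
    rw [← lie_skew, h, neg_zero]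
  rwa [LieAlgebra.center_eq_bot, LieSubmodule.mem_bot] at hx

/-! ### Logarithmic derivatives through Ad -/

section Differential

variable (E : Type*) [NormedAddCommGroup E] [NormedSpace ℂ E] [FiniteDimensional ℂ E]
  (G : Type*) [TopologicalSpace G] [ChartedSpace E G] [Group G] [LieGroup 𝓘(ℂ, E) ω G]

/-- The adjoint representation of the Lie algebra of `G` on the model space. -/
def adL : E →L[ℂ] E →L[ℂ] E :=
  fderiv ℂ (fun x => AdL E G ((extChartAt 𝓘(ℂ, E) (1 : G)).symm x)) (chartOrigin E G)

variable {E G}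

theorem adL_apply (v w : E) : adL E G v w = lieBr E G v w := fderiv_AdL_symm v w

theorem hasMFDerivAt_AdL_one :
    HasMFDerivAt 𝓘(ℂ, E) 𝓘(ℂ, E →L[ℂ] E) (AdL E G) 1 (adL E G) := by
  refine ⟨contMDiff_AdL.continuous.continuousAt, ?_⟩
  have h : HasFDerivAt (fun x => AdL E G ((extChartAt 𝓘(ℂ, E) (1 : G)).symm x)) (adL E G)
      (chartOrigin E G) := (contDiffAt_AdL_symm.differentiableAt (by simp)).hasFDerivAt
  exact h.hasFDerivWithinAt

theorem contMDiff_AdL_real : ContMDiff 𝓘(ℝ, E) 𝓘(ℝ, E →L[ℂ] E) ω (AdL E G) :=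
  contMDiff_restrictScalars (I := 𝓘(ℂ, E)) rfl rfl contMDiff_AdL

theorem AdL_inv_mul (g : G) : AdL E G g⁻¹ * AdL E G g = 1 := by rw [← map_mul]; simp

theorem AdL_mul_inv (g : G) : AdL E G g * AdL E G g⁻¹ = 1 := by rw [← map_mul]; simp

theorem AdL_inv_apply (g : G) (x : E) : AdL E G g⁻¹ (AdL E G g x) = x :=
  congrArg (fun T : E →L[ℂ] E => T x) (AdL_inv_mul (E := E) g)

theorem AdL_apply_inv (g : G) (x : E) : AdL E G g (AdL E G g⁻¹ x) = x :=
  congrArg (fun T : E →L[ℂ] E => T x) (AdL_mul_inv (E := E) g)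

/-- The two sides are the derivatives at h = 1 of Ad(g h g⁻¹) and of Ad(g) Ad(h) Ad(g)⁻¹. -/
theorem adL_AdL (g : G) (x : E) :
    adL E G (AdL E G g x) = AdL E G g * adL E G x * AdL E G g⁻¹ := by
  have h1 : HasMFDerivAt 𝓘(ℂ, E) 𝓘(ℂ, E →L[ℂ] E) (AdL E G ∘ fun h : G => g * h * g⁻¹) 1
      ((adL E G).comp (AdFun E g)) := by
    refine HasMFDerivAt.comp (1 : G) ?_ (hasMFDerivAt_conj g)
    have := hasMFDerivAt_AdL_one (E := E) (G := G)
    have h1 : (1 : G) = g * 1 * g⁻¹ := by simp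
    rwa [h1] at this
  let T : (E →L[ℂ] E) →L[ℂ] (E →L[ℂ] E) :=
    ((ContinuousLinearMap.mul ℂ (E →L[ℂ] E)).flip (AdL E G g⁻¹)).comp
      (ContinuousLinearMap.mul ℂ (E →L[ℂ] E) (AdL E G g))
  have h2 : HasMFDerivAt 𝓘(ℂ, E) 𝓘(ℂ, E →L[ℂ] E) (T ∘ AdL E G) 1 (T.comp (adL E G)) :=
    HasMFDerivAt.comp (1 : G) (T.hasFDerivAt.hasMFDerivAt) hasMFDerivAt_AdL_one
  have h3 : (AdL E G ∘ fun h : G => g * h * g⁻¹) = T ∘ AdL E G := by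
    ext h v; simp [T]
  rw [h3] at h1
  exact congrArg (fun L : E →L[ℂ] (E →L[ℂ] E) => L x) (hasMFDerivAt_unique h1 h2)

theorem AdL_adL_apply (g : G) (x y : E) :
    AdL E G g (adL E G x y) = adL E G (AdL E G g x) (AdL E G g y) := by
  rw [adL_AdL]
  simp [AdL_inv_apply]

section

variable {F : Type*} [NormedAddCommGroup F] [NormedSpace ℝ F]

variable (E) in
/-- The logarithmic derivative of a map to `G`: its differential, left-translated to the
identity. -/
def logDeriv (f : F → G) (q : F) : F →L[ℝ] E :=
  mfderiv 𝓘(ℝ, F) 𝓘(ℝ, E) (fun x => (f q)⁻¹ * f x) q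

theorem mdifferentiableAt_mul_left (g h : G) :
    MDifferentiableAt 𝓘(ℝ, E) 𝓘(ℝ, E) (fun x : G => g * x) h :=
  (contMDiff_restrictScalars (I := 𝓘(ℂ, E)) (I' := 𝓘(ℝ, E)) rfl rfl
    (contMDiff_mul_left (I := 𝓘(ℂ, E)) (n := ω) (a := g))).contMDiffAt.mdifferentiableAt (by simp)

theorem mdifferentiableAt_inv_mul {f : F → G} {q : F}
    (hf : MDifferentiableAt 𝓘(ℝ, F) 𝓘(ℝ, E) f q) (g : G) :
    MDifferentiableAt 𝓘(ℝ, F) 𝓘(ℝ, E) (fun x => g * f x) q :=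
  (mdifferentiableAt_mul_left g (f q)).comp q hf

/-- Ad(f x) = Ad(f q) Ad(f(q)⁻¹ f(x)), and the argument of the last factor passes through 1 at q,
where the derivative of Ad is ad. This is the bridge from `G`-valued to operator-valued calculus. -/
theorem hasFDerivAt_AdL_comp {f : F → G} {q : F}
    (hf : MDifferentiableAt 𝓘(ℝ, F) 𝓘(ℝ, E) f q) :
    HasFDerivAt (fun x => AdL E G (f x))
      ((((ContinuousLinearMap.mul ℂ (E →L[ℂ] E) (AdL E G (f q))).comp (adL E G)).restrictScalars
        ℝ).comp (logDeriv E f q)) q := by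
  let D₀ : F →L[ℝ] E := logDeriv E f q
  have h1 : HasMFDerivAt 𝓘(ℝ, F) 𝓘(ℝ, E) (fun x => (f q)⁻¹ * f x) q D₀ :=
    (mdifferentiableAt_inv_mul hf _).hasMFDerivAt
  have h2 : HasMFDerivAt 𝓘(ℝ, E) 𝓘(ℝ, E →L[ℂ] E) (AdL E G) ((f q)⁻¹ * f q)
      ((adL E G).restrictScalars ℝ) := by
    rw [inv_mul_cancel]
    exact hasMFDerivAt_restrictScalars hasMFDerivAt_AdL_one
  let D : F →L[ℝ] (E →L[ℂ] E) := ((adL E G).restrictScalars ℝ).comp D₀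
  have h3 : HasMFDerivAt 𝓘(ℝ, F) 𝓘(ℝ, E →L[ℂ] E) (fun x => AdL E G ((f q)⁻¹ * f x)) q D :=
    HasMFDerivAt.comp q h2 h1
  have h4 := (((ContinuousLinearMap.mul ℂ (E →L[ℂ] E) (AdL E G (f q))).restrictScalars
    ℝ).hasFDerivAt (x := AdL E G ((f q)⁻¹ * f q))).comp q
    h3.hasFDerivAt
  refine (h4.congr_of_eventuallyEq (Eventually.of_forall fun x => ?_))
  simp [← mul_assoc, ← map_mul]

theorem fderiv_AdL_comp {f : F → G} {q : F}
    (hf : MDifferentiableAt 𝓘(ℝ, F) 𝓘(ℝ, E) f q) (v : F) :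
    fderiv ℝ (fun x => AdL E G (f x)) q v = AdL E G (f q) * adL E G (logDeriv E f q v) := by
  rw [(hasFDerivAt_AdL_comp hf).fderiv]; rfl

theorem adL_logDeriv {f : F → G} {q : F}
    (hf : MDifferentiableAt 𝓘(ℝ, F) 𝓘(ℝ, E) f q) (v : F) :
    adL E G (logDeriv E f q v) = AdL E G (f q)⁻¹ * fderiv ℝ (fun x => AdL E G (f x)) q v := by
  rw [fderiv_AdL_comp hf, ← mul_assoc, AdL_inv_mul, one_mul]

end

variable (E G) in
-- The kernel of ad is the centre. Identities in the Lie algebra are proved below by applying ad and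
-- cancelling it.
theorem adL_injective [LieAlgebra.IsSemisimple ℂ (GroupLieAlgebra 𝓘(ℂ, E) G)] :
    Function.Injective (adL E G) := by
  refine (injective_iff_map_eq_zero (adL E G)).2 fun x hx => ?_
  refine eq_zero_of_lie_eq_zero (L := GroupLieAlgebra 𝓘(ℂ, E) G) fun y => ?_
  exact (adL_apply (G := G) x y).symm.trans (congrArg (fun T : E →L[ℂ] E => T y) hx)

end Differential

instance lieGroup_real {E : Type*} [NormedAddCommGroup E] [NormedSpace ℂ E]
    {G : Type*} [TopologicalSpace G] [ChartedSpace E G] [Group G] [LieGroup 𝓘(ℂ, E) ω G] :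
    LieGroup 𝓘(ℝ, E) ω G := lieGroup_restrictScalars

/-! ### One-parameter subgroups: existence, smoothness, uniqueness -/

section Exponential

variable {E : Type*} [NormedAddCommGroup E] [NormedSpace ℂ E] [FiniteDimensional ℂ E]
  {G : Type*} [TopologicalSpace G] [ChartedSpace E G] [Group G] [LieGroup 𝓘(ℂ, E) ω G]

/-- The left-invariant vector field of `x` on the underlying real Lie group. -/
def leftField (x : E) (g : G) : TangentSpace 𝓘(ℝ, E) g :=
  mulInvariantVectorField (I := 𝓘(ℝ, E)) (G := G) x g

theorem contMDiff_leftField (x : E) : ContMDiff 𝓘(ℝ, E) 𝓘(ℝ, E).tangent 1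
    (fun g : G => (⟨g, leftField x g⟩ : TangentBundle 𝓘(ℝ, E) G)) :=
  (contMDiff_mulInvariantVectorField (I := 𝓘(ℝ, E)) (G := G) x).of_le (by
    simp [minSmoothness_of_isRCLikeNormedField])

theorem hasMFDerivAt_mul_left (g h : G) : HasMFDerivAt 𝓘(ℝ, E) 𝓘(ℝ, E) (fun x : G => g * x) h
    (mfderiv 𝓘(ℝ, E) 𝓘(ℝ, E) (fun x : G => g * x) h) :=
  (mdifferentiableAt_mul_left g h).hasMFDerivAt

theorem leftField_mul (x : E) (g h : G) :
    leftField x (g * h) = mfderiv 𝓘(ℝ, E) 𝓘(ℝ, E) (fun x : G => g * x) h (leftField x h) := by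
  have h1 := hasMFDerivAt_mul_left (E := E) h 1
  have h2 : HasMFDerivAt 𝓘(ℝ, E) 𝓘(ℝ, E) (fun x : G => g * x) (h * 1)
      (mfderiv 𝓘(ℝ, E) 𝓘(ℝ, E) (fun x : G => g * x) h : E →L[ℝ] E) := by
    have : ∀ k, k = h → HasMFDerivAt 𝓘(ℝ, E) 𝓘(ℝ, E) (fun x : G => g * x) k
        (mfderiv 𝓘(ℝ, E) 𝓘(ℝ, E) (fun x : G => g * x) h : E →L[ℝ] E) := by
      rintro _ rfl; exact hasMFDerivAt_mul_left g _
    exact this _ (mul_one h)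
  have h3 := HasMFDerivAt.comp (1 : G) h2 h1
  have h4 : (fun x : G => g * x) ∘ (fun x : G => h * x) = fun x => g * h * x := by
    ext; simp [mul_assoc]
  rw [h4] at h3
  have h5 := hasMFDerivAt_unique h3 (hasMFDerivAt_mul_left (E := E) (g * h) 1)
  exact (congrArg (fun L : E →L[ℝ] E => L x) h5).symm

theorem isMIntegralCurve_mul_left {x : E} {c : ℝ → G} {s : Set ℝ}
    (hc : IsMIntegralCurveOn c (leftField x) s) (g : G) :
    IsMIntegralCurveOn (fun t => g * c t) (leftField x) s := by
  intro t ht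
  have h1 := hc t ht
  have h2 := HasMFDerivAt.comp_hasMFDerivWithinAt t (hasMFDerivAt_mul_left (E := E) g (c t)) h1
  refine h2.congr_mfderiv ?_
  refine ContinuousLinearMap.ext fun r => ?_
  have h3 := leftField_mul x g (c t)
  let L : E →L[ℝ] E := mfderiv 𝓘(ℝ, E) 𝓘(ℝ, E) (fun x : G => g * x) (c t)
  have h4 : (leftField x (g * c t) : E) = L (leftField x (c t) : E) := h3
  change L ((1 : ℝ →L[ℝ] ℝ) r • (leftField x (c t) : E)) = (1 : ℝ →L[ℝ] ℝ) r • (leftField x (g * c t) : E)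
  rw [h4]
  exact L.map_smul _ _

/-- Left translates of one local solution through 1 are solutions through every other point with the
same lifespan ε, so a solution extends to all times. -/
theorem exists_integralCurve (x : E) : ∃ c : ℝ → G, c 0 = 1 ∧ IsMIntegralCurve c (leftField x) := by
  have : CompleteSpace E := FiniteDimensional.complete ℂ E
  have : T2Space G := t2Space_of_lieGroup (E := E) G
  have : IsManifold 𝓘(ℝ, E) 1 G := IsManifold.of_le (n := ω) le_top
  obtain ⟨c, hc0, hc⟩ := exists_isMIntegralCurveAt_of_contMDiffAt_boundaryless (I := 𝓘(ℝ, E))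
    (0 : ℝ) (contMDiff_leftField x (1 : G))
  rw [isMIntegralCurveAt_iff'] at hc
  obtain ⟨ε, hε, hc⟩ := hc
  rw [Real.ball_eq_Ioo, zero_sub, zero_add] at hc
  exact exists_isMIntegralCurve_of_isMIntegralCurveOn (contMDiff_leftField x) hε
    (fun g => ⟨fun t => g * c t, by simp [hc0], isMIntegralCurve_mul_left hc g⟩) 1

/-- Both t ↦ c(s + t) and t ↦ c(s) c(t) are integral curves starting at c(s). -/
theorem integralCurve_add {x : E} {c : ℝ → G} (h0 : c 0 = 1)
    (hc : IsMIntegralCurve c (leftField x)) (s t : ℝ) : c (s + t) = c s * c t := by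
  have : CompleteSpace E := FiniteDimensional.complete ℂ E
  have : T2Space G := t2Space_of_lieGroup (E := E) G
  have : IsManifold 𝓘(ℝ, E) 1 G := IsManifold.of_le (n := ω) le_top
  have h1 := hc.comp_add s
  have h2 : IsMIntegralCurve (fun t => c s * c t) (leftField x) := by
    rw [isMIntegralCurve_iff_isMIntegralCurveOn] at hc ⊢
    exact isMIntegralCurve_mul_left hc _
  have h3 := isMIntegralCurve_Ioo_eq_of_contMDiff_boundaryless (t₀ := 0) (contMDiff_leftField x)
    h1 h2 (by simp [h0])
  have h4 := congrFun h3 t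
  rw [add_comm]
  exact h4

theorem leftField_one (x : E) : (leftField x (1 : G) : E) = x := by
  have h := hasMFDerivAt_mul_left (E := E) (1 : G) 1
  have h1 : (fun x : G => 1 * x) = id := by ext; simp
  rw [h1] at h
  have h2 := hasMFDerivAt_unique h (hasMFDerivAt_id (I := 𝓘(ℝ, E)) (1 : G))
  have h3 : (leftField x (1 : G) : E) = (mfderiv 𝓘(ℝ, E) 𝓘(ℝ, E) (fun x : G => 1 * x) 1 : E →L[ℝ] E) x := rfl
  rw [h3]
  have h4 := congrArg (fun L : E →L[ℝ] E => L x) h2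
  have h5 : (mfderiv 𝓘(ℝ, E) 𝓘(ℝ, E) (fun x : G => 1 * x) 1 : E →L[ℝ] E) =
    mfderiv 𝓘(ℝ, E) 𝓘(ℝ, E) (id : G → G) 1 := by rw [h1]
  rw [h5]
  have h6 : (mfderiv 𝓘(ℝ, E) 𝓘(ℝ, E) (id : G → G) 1 : E →L[ℝ] E) = ContinuousLinearMap.id ℝ E :=
    mfderiv_id
  rw [h6]; rfl

/-- A one-parameter group of invertible operators is the exponential of its generator. -/
theorem eq_exp_of_hasDerivAt {A : Type*} [NormedRing A] [NormedAlgebra ℝ A] [CompleteSpace A]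
    {u : ℝ → A} {a : A} (h0 : u 0 = 1) (hu : ∀ t, HasDerivAt u (u t * a) t) (t : ℝ) :
    u t = NormedSpace.exp (t • a) := by
  have : NormedAlgebra ℚ A := NormedAlgebra.restrictScalars ℚ ℝ A
  have h1 : ∀ t, HasDerivAt (fun t => u t * NormedSpace.exp (t • (-a))) 0 t := by
    intro t
    have h2 := (hu t).mul (hasDerivAt_exp_smul_const' (𝕂 := ℝ) (-a) t)
    exact h2.congr_deriv (by rw [mul_assoc, ← mul_add, neg_mul, add_neg_cancel, mul_zero])
  have h3 : u t * NormedSpace.exp (t • (-a)) = 1 := by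
    have := is_const_of_deriv_eq_zero (fun t => (h1 t).differentiableAt) (fun t => (h1 t).deriv) t 0
    simpa [h0] using this
  have h4 : NormedSpace.exp (t • (-a)) * NormedSpace.exp (t • a) = 1 := by
    rw [← NormedSpace.exp_add_of_commute, smul_neg, neg_add_cancel, NormedSpace.exp_zero]
    simp
  calc u t = u t * (NormedSpace.exp (t • (-a)) * NormedSpace.exp (t • a)) := by rw [h4, mul_one]
    _ = NormedSpace.exp (t • a) := by rw [← mul_assoc, h3, one_mul]

/-- Ad ∘ c is a one-parameter group of operators with generator ad x. Only differentiability at 0 is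
asked for, because the smoothness of c is deduced from this formula. -/
theorem AdL_eq_exp {x : E} {c : ℝ → G} (hmul : ∀ s t, c (s + t) = c s * c t)
    (hd : MDifferentiableAt 𝓘(ℝ, ℝ) 𝓘(ℝ, E) c 0) (hx : rdiff ℝ E c 0 1 = x) (t : ℝ) :
    AdL E G (c t) = NormedSpace.exp (t • adL E G x) := by
  have h0 : c 0 = 1 := by simpa using hmul 0 0
  have h1 : HasDerivAt (fun t => AdL E G (c t)) (adL E G x) 0 := by
    have h := (hasFDerivAt_AdL_comp hd).hasDerivAt
    have h2 : (fun t => (c 0)⁻¹ * c t) = c := by ext; simp [h0]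
    have h3 : logDeriv E c 0 = mfderiv 𝓘(ℝ, ℝ) 𝓘(ℝ, E) c 0 := by
      rw [logDeriv, h2]
    have h4 : logDeriv E c 0 1 = x := by rw [h3]; exact hx
    refine h.congr_deriv ?_
    change AdL E G (c 0) * adL E G (logDeriv E c 0 1) = _
    rw [h4, h0, map_one, one_mul]
  refine eq_exp_of_hasDerivAt (u := fun t => AdL E G (c t)) (by simp only [h0, map_one]) (fun t => ?_) t
  have h2 : (fun s => AdL E G (c s)) = fun s => AdL E G (c t) * AdL E G (c (-t + s)) := by
    funext s
    rw [← map_mul, ← hmul, add_neg_cancel_left]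
  rw [h2]
  have h3 : HasDerivAt (fun s => AdL E G (c (-t + s))) (adL E G x) t :=
    HasDerivAt.comp_const_add (-t) t (f := fun s => AdL E G (c s)) (by rw [neg_add_cancel]; exact h1)
  exact h3.const_mul (AdL E G (c t))

variable (E G) in
/-- A linear left inverse of the adjoint representation of the Lie algebra. -/
def adLeftInv : (E →L[ℂ] E) →L[ℂ] E :=
  -- `invFun` is arbitrary when ad has no left inverse; in the semisimple case `adLeftInv_adL` shows
  -- that one is chosen.
  LinearMap.toContinuousLinearMap (Function.invFun
    (fun P : (E →L[ℂ] E) →ₗ[ℂ] E => P ∘ₗ (adL E G : E →ₗ[ℂ] (E →L[ℂ] E))) LinearMap.id)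

theorem adLeftInv_adL [LieAlgebra.IsSemisimple ℂ (GroupLieAlgebra 𝓘(ℂ, E) G)] (x : E) :
    adLeftInv E G (adL E G x) = x := by
  have h : ∃ P : (E →L[ℂ] E) →ₗ[ℂ] E, P ∘ₗ (adL E G : E →ₗ[ℂ] (E →L[ℂ] E)) = LinearMap.id :=
    LinearMap.exists_leftInverse_of_injective _ (LinearMap.ker_eq_bot.2 (adL_injective E G))
  exact congrArg (fun L : E →ₗ[ℂ] E => L x) (Function.invFun_eq h)

variable [LieAlgebra.IsSemisimple ℂ (GroupLieAlgebra 𝓘(ℂ, E) G)]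

variable (E G) in
/-- `adLeftInv ∘ Ad` is a chart of `G` at the identity, with smooth inverse. -/
theorem exists_adChart : ∃ e : OpenPartialHomeomorph G E, 1 ∈ e.source ∧
    (∀ g ∈ e.source, e g = adLeftInv E G (AdL E G g)) ∧
    ContMDiffOn 𝓘(ℝ, E) 𝓘(ℝ, E) ω e.symm e.target := by
  have : CompleteSpace E := FiniteDimensional.complete ℂ E
  let f : E → E := fun x => adLeftInv E G (AdL E G ((extChartAt 𝓘(ℂ, E) (1 : G)).symm x))
  have hf : ContDiffAt ℂ ω f (chartOrigin E G) :=
    (adLeftInv E G).contDiff.contDiffAt.comp _ contDiffAt_AdL_symm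
  -- The derivative of Ad at 1 is ad, which the left inverse cancels, so the inverse function
  -- theorem applies to `f`.
  have hd : HasFDerivAt f ((ContinuousLinearEquiv.refl ℂ E : E ≃L[ℂ] E) : E →L[ℂ] E)
      (chartOrigin E G) := by
    have h := (adLeftInv E G).hasFDerivAt.comp (chartOrigin E G)
      ((contDiffAt_AdL_symm (E := E) (G := G)).differentiableAt (by simp)).hasFDerivAt
    refine h.congr_fderiv ?_
    ext x
    exact adLeftInv_adL (G := G) x
  let ψ := hf.toOpenPartialHomeomorph f hd (by simp)
  have hψ : ContDiffAt ℂ ω ψ.symm (f (chartOrigin E G)) := hf.to_localInverse hd (by simp)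
  let e₀ : OpenPartialHomeomorph G E := (chartAt E (1 : G)).trans ψ
  have hsrc : (1 : G) ∈ e₀.source := by
    rw [OpenPartialHomeomorph.trans_source]
    exact ⟨mem_chart_source E 1, hf.mem_toOpenPartialHomeomorph_source hd (by simp)⟩
  have hval : ∀ g ∈ e₀.source, e₀ g = adLeftInv E G (AdL E G g) := by
    intro g hg
    rw [OpenPartialHomeomorph.trans_source] at hg
    have h1 : e₀ g = f (chartAt E (1 : G) g) := rfl
    have h2 : (extChartAt 𝓘(ℂ, E) (1 : G)).symm (chartAt E (1 : G) g) = g :=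
      (chartAt E (1 : G)).left_inv hg.1
    rw [h1]
    simp only [f, h2]
  have h1 : e₀ 1 = f (chartOrigin E G) := rfl
  obtain ⟨O, hO, hOo, hmO⟩ := eventually_nhds_iff.1 (hψ.eventually (by simp))
  -- The chart is cut down to `O`, where the local inverse is analytic at every point and not only
  -- at the image of 1.
  refine ⟨(e₀.symm.restrOpen O hOo).symm, ?_, ?_, ?_⟩
  · rw [OpenPartialHomeomorph.symm_source, ← OpenPartialHomeomorph.symm_source]
    have : e₀ 1 ∈ (e₀.symm.restrOpen O hOo).source := by
      rw [OpenPartialHomeomorph.restrOpen_source]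
      exact ⟨e₀.map_source hsrc, by rw [h1]; exact hmO⟩
    have h2 := (e₀.symm.restrOpen O hOo).map_source this
    have h3 : (e₀.symm.restrOpen O hOo) (e₀ 1) = 1 := e₀.left_inv hsrc
    rwa [h3] at h2
  · intro g hg
    refine hval g ?_
    have h2 := (e₀.symm.restrOpen O hOo).symm.map_source hg
    have h3 : e₀ g ∈ e₀.target := h2.1
    have h4 := e₀.map_target h3
    have h5 : e₀.symm (e₀ g) = g := (e₀.symm.restrOpen O hOo).right_inv hg
    rwa [h5] at h4
  · intro y hy
    have hy1 : y ∈ e₀.target := hy.1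
    have hy2 : y ∈ O := hy.2
    have h2 : ContMDiffAt 𝓘(ℝ, E) 𝓘(ℝ, E) ω ψ.symm y :=
      ((hO y hy2).restrict_scalars ℝ).contMDiffAt
    have h3 : ContMDiffAt 𝓘(ℝ, E) 𝓘(ℝ, E) ω (chartAt E (1 : G)).symm (ψ.symm y) := by
      have h4 := contMDiffOn_extChartAt_symm (I := 𝓘(ℝ, E)) (n := ω) (1 : G)
      have h5 : ψ.symm y ∈ (chartAt E (1 : G)).target := by
        have := hy1
        rw [OpenPartialHomeomorph.trans_target] at this
        exact this.2
      refine (h4 _ (by simpa using h5)).contMDiffAt ?_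
      simpa using (chartAt E (1 : G)).open_target.mem_nhds h5
    exact (h3.comp y h2).contMDiffWithinAt

/-- The integral curve c is a priori only differentiable. In the chart of `exists_adChart` it reads
as a linear image of exp(t ad x), hence is smooth near 0, and c(s) = c(t) c(s - t) gives smoothness
at every t. -/
theorem exists_isOneParam (x : E) : ∃ c : ℝ → G, IsOneParam E c x := by
  obtain ⟨c, h0, hc⟩ := exists_integralCurve (G := G) x
  have hmul := integralCurve_add h0 hc
  have hd0 := hc 0
  have hx : rdiff ℝ E c 0 1 = x := by
    have h2 : (mfderiv 𝓘(ℝ, ℝ) 𝓘(ℝ, E) c 0 : ℝ →L[ℝ] E) =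
      (1 : ℝ →L[ℝ] ℝ).smulRight (leftField x (c 0) : E) := hd0.mfderiv
    have h3 : (leftField x (c 0) : E) = x := by rw [h0]; exact leftField_one x
    rw [h3] at h2
    refine (congrArg (fun L : ℝ →L[ℝ] E => L 1) h2).trans ?_
    exact one_smul ℝ x
  have hA := AdL_eq_exp hmul hd0.mdifferentiableAt hx
  obtain ⟨e, he1, hev, hes⟩ := exists_adChart E G
  have hcont : ContinuousAt c 0 := hd0.continuousAt
  have hsmooth0 : ContMDiffAt 𝓘(ℝ, ℝ) 𝓘(ℝ, E) ∞ c 0 := by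
    have h1 : ContDiff ℝ ω (fun t : ℝ => adLeftInv E G (NormedSpace.exp (t • adL E G x))) := by
      have he : ContDiff ℝ ω (NormedSpace.exp : (E →L[ℂ] E) → (E →L[ℂ] E)) :=
        contDiff_iff_contDiffAt.2 fun y => (NormedSpace.exp_analytic (𝕂 := ℝ) y).contDiffAt
      exact ((adLeftInv E G).restrictScalars ℝ).contDiff.comp (he.comp (by fun_prop))
    have h2 : ∀ t, c t ∈ e.source →
        e (c t) = adLeftInv E G (NormedSpace.exp (t • adL E G x)) := fun t ht => by
      rw [hev _ ht, hA]
    have h3 : ContMDiffAt 𝓘(ℝ, E) 𝓘(ℝ, E) ∞ e.symm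
        (adLeftInv E G (NormedSpace.exp ((0 : ℝ) • adL E G x))) := by
      refine ((hes.contMDiffAt (e.open_target.mem_nhds ?_)).of_le (by simp))
      rw [← h2 0 (by rwa [h0])]
      exact e.map_source (by rwa [h0])
    have h4 := ContMDiffAt.comp (0 : ℝ) h3 (h1.contDiffAt.contMDiffAt.of_le (by simp))
    refine h4.congr_of_eventuallyEq ?_
    filter_upwards [hcont (e.open_source.mem_nhds (by rwa [h0]))] with t ht
    rw [Function.comp_apply, ← h2 t ht, e.left_inv ht]
  refine ⟨c, fun t => ?_, hmul, hx⟩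
  have h5 : c = (fun g => c t * g) ∘ c ∘ (fun s => -t + s) := by
    funext s
    change c s = c t * c (-t + s)
    rw [← hmul, add_neg_cancel_left]
  rw [h5]
  have h6 : ContMDiffAt 𝓘(ℝ, ℝ) 𝓘(ℝ, E) ∞ (c ∘ (fun s => -t + s)) t :=
    ContMDiffAt.comp_of_eq (I' := 𝓘(ℝ, ℝ)) (y := (0 : ℝ)) hsmooth0
      (contDiffAt_const.add contDiffAt_id).contMDiffAt (by simp)
  exact ContMDiffAt.comp (I' := 𝓘(ℝ, E)) t (contMDiff_mul_left.contMDiffAt) h6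

theorem IsOneParam.AdL {c : ℝ → G} {x : E} (hc : IsOneParam E c x) (t : ℝ) :
    AdL E G (c t) = NormedSpace.exp (t • adL E G x) :=
  AdL_eq_exp hc.2.1 (hc.1.mdifferentiableAt (by simp)) hc.2.2 t

theorem IsOneParam.zero {c : ℝ → G} {x : E} (hc : IsOneParam E c x) : c 0 = 1 := by
  simpa using hc.2.1 0 0

theorem IsOneParam.neg {c : ℝ → G} {x : E} (hc : IsOneParam E c x) (t : ℝ) :
    c (-t) = (c t)⁻¹ := by
  rw [eq_inv_iff_mul_eq_one, ← hc.2.1, neg_add_cancel, hc.zero]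

theorem IsOneParam.nsmul {c : ℝ → G} {x : E} (hc : IsOneParam E c x) (n : ℕ) (t : ℝ) :
    c (n * t) = c t ^ n := by
  induction n with
  | zero => simp [hc.zero]
  | succ n ih => rw [Nat.cast_succ, add_mul, one_mul, hc.2.1, ih, pow_succ]

/-- Both curves are sent by Ad to exp(t ad x), and Ad is injective near 1, so they agree for small
t; c(t) = c(t/n)ⁿ does the rest. -/
theorem IsOneParam.unique {c c' : ℝ → G} {x : E} (hc : IsOneParam E c x)
    (hc' : IsOneParam E c' x) : c = c' := by
  obtain ⟨e, he1, hev, -⟩ := exists_adChart E G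
  have h1 : ∀ᶠ t in 𝓝 (0 : ℝ), c t ∈ e.source :=
    hc.1.continuous.continuousAt (e.open_source.mem_nhds (by rwa [hc.zero]))
  have h2 : ∀ᶠ t in 𝓝 (0 : ℝ), c' t ∈ e.source :=
    hc'.1.continuous.continuousAt (e.open_source.mem_nhds (by rwa [hc'.zero]))
  have h3 : ∀ᶠ t in 𝓝 (0 : ℝ), c t = c' t := by
    filter_upwards [h1, h2] with t ht ht'
    refine e.injOn ht ht' ?_
    rw [hev _ ht, hev _ ht', hc.AdL, hc'.AdL]
  funext t
  have h4 : Tendsto (fun n : ℕ => t / n) atTop (𝓝 0) := tendsto_const_div_atTop_nhds_zero_nat t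
  obtain ⟨n, hn, hn0⟩ := ((h4.eventually h3).and (eventually_gt_atTop 0)).exists
  have h5 : (n : ℝ) * (t / n) = t := by field_simp
  rw [← h5, hc.nsmul, hc'.nsmul, hn]

end Exponential

/-! ### The exponential map and canonical coordinates of the second kind -/

section Exponential

variable {E : Type*} [NormedAddCommGroup E] [NormedSpace ℂ E] [FiniteDimensional ℂ E]
  {G : Type*} [TopologicalSpace G] [ChartedSpace E G] [Group G] [LieGroup 𝓘(ℂ, E) ω G]
  [LieAlgebra.IsSemisimple ℂ (GroupLieAlgebra 𝓘(ℂ, E) G)]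

variable (E G) in
/-- The exponential map of `G`. -/
def expG (x : E) : G := (exists_isOneParam (G := G) x).choose 1

theorem IsOneParam.smul {c : ℝ → G} {x : E} (hc : IsOneParam E c x) (s : ℝ) :
    IsOneParam E (fun t => c (s * t)) (s • x : E) := by
  refine ⟨hc.1.comp (contDiff_const.mul contDiff_id).contMDiff,
    fun a b => by simp only [mul_add, hc.2.1], ?_⟩
  let D : ℝ →L[ℝ] E := mfderiv 𝓘(ℝ, ℝ) 𝓘(ℝ, E) c 0
  have hD : D 1 = x := hc.2.2
  have h1 : HasMFDerivAt 𝓘(ℝ, ℝ) 𝓘(ℝ, E) c (s * 0) D := by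
    rw [mul_zero]
    exact (hc.1.mdifferentiableAt (by simp)).hasMFDerivAt
  have h2 : HasMFDerivAt 𝓘(ℝ, ℝ) 𝓘(ℝ, ℝ) (fun t : ℝ => s * t) 0 (s • (1 : ℝ →L[ℝ] ℝ)) :=
    ((hasFDerivAt_id (𝕜 := ℝ) (0 : ℝ)).const_mul s).hasMFDerivAt
  have h3 := (HasMFDerivAt.comp (0 : ℝ) h1 h2).mfderiv
  refine (congrArg (fun L : ℝ →L[ℝ] E => L 1) h3).trans ?_
  change D (s • (1 : ℝ)) = s • x
  rw [D.map_smul, hD]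

theorem IsOneParam.eq_expG {c : ℝ → G} {x : E} (hc : IsOneParam E c x) (t : ℝ) :
    c t = expG E G (t • x) := by
  have h := (hc.smul t).unique (exists_isOneParam (G := G) (t • x)).choose_spec
  have h1 := congrFun h 1
  simp only [mul_one] at h1
  exact h1

theorem isOneParam_expG (x : E) : IsOneParam E (fun t : ℝ => expG E G (t • x)) x := by
  obtain ⟨c, hc⟩ := exists_isOneParam (G := G) x
  have : c = fun t : ℝ => expG E G (t • x) := funext hc.eq_expG
  rwa [← this]

theorem AdL_expG (x : E) : AdL E G (expG E G x) = NormedSpace.exp (adL E G x) := by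
  simpa using (isOneParam_expG (G := G) x).AdL 1

theorem expG_zero : expG E G 0 = 1 := by
  simpa using (isOneParam_expG (G := G) (0 : E)).zero

theorem expG_neg (x : E) : expG E G (-x) = (expG E G x)⁻¹ := by
  simpa using (isOneParam_expG (G := G) x).neg 1

theorem expG_nsmul (n : ℕ) (x : E) : expG E G ((n : ℝ) • x) = expG E G x ^ n := by
  simpa using (isOneParam_expG (G := G) x).nsmul n 1

/-- The curve t ↦ g exp(tx) g⁻¹ is a one-parameter subgroup with velocity Ad(g)x, and such a
subgroup is unique. -/
theorem conj_expG (g : G) (x : E) : g * expG E G x * g⁻¹ = expG E G (AdL E G g x) := by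
  have h := isOneParam_expG (G := G) x
  have hc : IsOneParam E (fun t : ℝ => g * expG E G (t • x) * g⁻¹) (AdL E G g x) := by
    refine ⟨(contMDiff_const.mul h.1).mul contMDiff_const, fun s t => ?_, ?_⟩
    · simp only [h.2.1]; group
    · have h1 : HasMFDerivAt 𝓘(ℝ, E) 𝓘(ℝ, E) (fun h : G => g * h * g⁻¹)
          (expG E G ((0 : ℝ) • x)) ((AdL E G g).restrictScalars ℝ : E →L[ℝ] E) := by
        rw [zero_smul, expG_zero]
        exact hasMFDerivAt_restrictScalars (hasMFDerivAt_conj g)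
      let D : ℝ →L[ℝ] E := mfderiv 𝓘(ℝ, ℝ) 𝓘(ℝ, E) (fun t : ℝ => expG E G (t • x)) 0
      have hD : HasMFDerivAt 𝓘(ℝ, ℝ) 𝓘(ℝ, E) (fun t : ℝ => expG E G (t • x)) 0 D :=
        (h.1.mdifferentiableAt (by simp)).hasMFDerivAt
      have hD1 : D 1 = x := h.2.2
      have h3 := (HasMFDerivAt.comp (0 : ℝ) h1 hD).mfderiv
      refine (congrArg (fun L : ℝ →L[ℝ] E => L 1) h3).trans ?_
      change AdL E G g (D 1) = _
      rw [hD1]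
  simpa using hc.eq_expG 1

theorem contDiff_exp {A : Type*} [NormedRing A] [NormedAlgebra ℝ A] [CompleteSpace A] :
    ContDiff ℝ ω (NormedSpace.exp : A → A) :=
  contDiff_iff_contDiffAt.2 fun y => (NormedSpace.exp_analytic (𝕂 := ℝ) y).contDiffAt

theorem contDiff_exp_adL : ContDiff ℝ ω (fun x : E => NormedSpace.exp (adL E G x)) :=
  (contDiff_exp (A := E →L[ℂ] E)).comp ((adL E G).restrictScalars ℝ).contDiff

/-- Continuity of exp in its argument is not available yet, only along rays. On a ray, exp(tx) is
compared with the curve that has the same image under Ad and stays in the chart: the set of t in [0,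
1] where they agree is closed, contains 0, and is a neighbourhood of each of its points, since
agreement places exp(tx) in the open chart domain. -/
theorem exists_ball_expG_mem {e : OpenPartialHomeomorph G E} (he1 : 1 ∈ e.source)
    (hev : ∀ g ∈ e.source, e g = adLeftInv E G (AdL E G g)) :
    ∃ r > 0, ∀ x ∈ Metric.ball (0 : E) r, expG E G x ∈ e.source := by
  have : T2Space G := t2Space_of_lieGroup (E := E) G
  let f : E → E := fun x => adLeftInv E G (NormedSpace.exp (adL E G x))
  have hf : Continuous f := (adLeftInv E G).continuous.comp contDiff_exp_adL.continuous
  have hf0 : f 0 = e 1 := by simp [f, hev 1 he1]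
  have h1 : f ⁻¹' e.target ∈ 𝓝 (0 : E) :=
    hf.continuousAt (e.open_target.mem_nhds (by rw [hf0]; exact e.map_source he1))
  obtain ⟨r, hr, hball⟩ := Metric.mem_nhds_iff.1 h1
  refine ⟨r, hr, fun x hx => ?_⟩
  have hx' : ∀ t ∈ Icc (0 : ℝ) 1, f (t • x) ∈ e.target := by
    intro t ht
    refine hball ?_
    rw [mem_ball_zero_iff] at hx ⊢
    rw [norm_smul, Real.norm_of_nonneg ht.1]
    exact (mul_le_of_le_one_left (norm_nonneg x) ht.2).trans_lt hx
  let c : ℝ → G := fun t => expG E G (t • x)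
  have hc : Continuous c := (isOneParam_expG (G := G) x).1.continuous
  let d : ℝ → G := fun t => e.symm (f (t • x))
  have hd : ContinuousOn d (Icc 0 1) :=
    e.symm.continuousOn.comp (hf.comp (by fun_prop)).continuousOn hx'
  have hAc : ∀ t, c t ∈ e.source → e (c t) = f (t • x) := fun t ht => by
    rw [hev _ ht, AdL_expG]
  have hs : IsClosed ({t | c t = d t} ∩ Icc (0 : ℝ) 1) := by
    have := (hc.continuousOn.prodMk hd).preimage_isClosed_of_isClosed isClosed_Icc
      (isClosed_diagonal (X := G))
    rwa [inter_comm] at this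
  have hsub : Icc (0 : ℝ) 1 ⊆ {t | c t = d t} := by
    refine hs.Icc_subset_of_forall_mem_nhdsWithin ?_ fun t ht => ?_
    · simp only [mem_ofPred_eq, c, d, zero_smul, expG_zero, hf0, e.left_inv he1]
    · have h2 : c t ∈ e.source := by
        rw [ht.1]; exact e.map_target (hx' t ⟨ht.2.1, ht.2.2.le⟩)
      refine mem_nhdsWithin_of_mem_nhds ?_
      filter_upwards [hc.continuousAt (e.open_source.mem_nhds h2)] with s hs
      change c s = e.symm (f (s • x))
      rw [← hAc s hs, e.left_inv hs]
  have h3 : c 1 = d 1 := hsub ⟨zero_le_one, le_rfl⟩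
  have h4 : d 1 ∈ e.source := e.map_target (hx' 1 ⟨zero_le_one, le_rfl⟩)
  rw [← h3] at h4
  simpa [c] using h4

variable (E G) in
theorem exists_contMDiffOn_expG :
    ∃ r > 0, ContMDiffOn 𝓘(ℝ, E) 𝓘(ℝ, E) ω (expG E G) (Metric.ball 0 r) := by
  obtain ⟨e, he1, hev, hes⟩ := exists_adChart E G
  obtain ⟨r, hr, hball⟩ := exists_ball_expG_mem he1 hev
  refine ⟨r, hr, ?_⟩
  have h1 : ContMDiffOn 𝓘(ℝ, E) 𝓘(ℝ, E) ω
      (e.symm ∘ fun x => adLeftInv E G (NormedSpace.exp (adL E G x))) (Metric.ball 0 r) := by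
    refine hes.comp (((adLeftInv E G).restrictScalars ℝ).contDiff.comp
      contDiff_exp_adL).contMDiff.contMDiffOn fun x hx => ?_
    have := e.map_source (hball x hx)
    rwa [hev _ (hball x hx), AdL_expG] at this
  refine h1.congr fun x hx => ?_
  rw [Function.comp_apply, ← AdL_expG, ← hev _ (hball x hx), e.left_inv (hball x hx)]

theorem hasFDerivAt_mul_of_eq_one {F A : Type*} [NormedAddCommGroup F] [NormedSpace ℝ F]
    [NormedRing A] [NormedAlgebra ℝ A] {a b : F → A} {a' b' : F →L[ℝ] A} {x : F}
    (ha : HasFDerivAt a a' x) (hb : HasFDerivAt b b' x) (ha1 : a x = 1) (hb1 : b x = 1) :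
    HasFDerivAt (fun y => a y * b y) (a' + b') x := by
  refine (ha.mul' hb).congr_fderiv ?_
  ext v
  simp [ha1, hb1, add_comm]

variable (G) in
/-- Canonical coordinates of the second kind: if the linear maps `p₀, p₁, p₂` add up to the
identity, then `v ↦ exp (p₀ v) exp (p₁ v) exp (p₂ v)` is a local diffeomorphism at `0`. -/
theorem exists_productChart (p₀ p₁ p₂ : E →L[ℝ] E) (hp : p₀ + p₁ + p₂ = ContinuousLinearMap.id ℝ E) :
    ∃ Φ : OpenPartialHomeomorph E G, 0 ∈ Φ.source ∧
      (∀ v ∈ Φ.source, Φ v = expG E G (p₀ v) * expG E G (p₁ v) * expG E G (p₂ v)) ∧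
      (∀ p ∈ [p₀, p₁, p₂], ContMDiffOn 𝓘(ℝ, E) 𝓘(ℝ, E) ω (fun v => expG E G (p v)) Φ.source) ∧
      ContMDiffOn 𝓘(ℝ, E) 𝓘(ℝ, E) ω Φ.symm Φ.target := by
  have : CompleteSpace E := FiniteDimensional.complete ℂ E
  obtain ⟨e, he1, hev, hes⟩ := exists_adChart E G
  obtain ⟨r, hr, hexp⟩ := exists_contMDiffOn_expG E G
  let prod : E → G := fun v => expG E G (p₀ v) * expG E G (p₁ v) * expG E G (p₂ v)
  let B : Set E := p₀ ⁻¹' Metric.ball 0 r ∩ p₁ ⁻¹' Metric.ball 0 r ∩ p₂ ⁻¹' Metric.ball 0 r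
  have hBo : IsOpen B := ((Metric.isOpen_ball.preimage p₀.continuous).inter
    (Metric.isOpen_ball.preimage p₁.continuous)).inter (Metric.isOpen_ball.preimage p₂.continuous)
  have hB0 : (0 : E) ∈ B := by simp [B, hr]
  have hp' : ∀ p ∈ [p₀, p₁, p₂],
      ContMDiffOn 𝓘(ℝ, E) 𝓘(ℝ, E) ω (fun v => expG E G (p v)) B := by
    intro p hp
    refine hexp.comp p.contDiff.contMDiff.contMDiffOn fun v hv => ?_
    simp only [List.mem_cons, List.not_mem_nil, or_false] at hp
    rcases hp with rfl | rfl | rfl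
    exacts [hv.1.1, hv.1.2, hv.2]
  have hprod : ContinuousOn prod B :=
    (((hp' p₀ (by simp)).mul (hp' p₁ (by simp))).mul (hp' p₂ (by simp))).continuousOn
  let N : Set E := B ∩ prod ⁻¹' e.source
  have hNo : IsOpen N := hprod.isOpen_inter_preimage hBo e.open_source
  have hprod0 : prod 0 = 1 := by simp [prod, expG_zero]
  have hN0 : (0 : E) ∈ N := ⟨hB0, by rw [mem_preimage, hprod0]; exact he1⟩
  let F : E → E := fun v => adLeftInv E G (NormedSpace.exp (adL E G (p₀ v)) *
    NormedSpace.exp (adL E G (p₁ v)) * NormedSpace.exp (adL E G (p₂ v)))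
  have hF : ContDiff ℝ ω F := ((adLeftInv E G).restrictScalars ℝ).contDiff.comp
    (((contDiff_exp_adL.comp p₀.contDiff).mul (contDiff_exp_adL.comp p₁.contDiff)).mul
      (contDiff_exp_adL.comp p₂.contDiff))
  have hexpd : ∀ p : E →L[ℝ] E, HasFDerivAt (fun v => NormedSpace.exp (adL E G (p v)))
      (((adL E G).restrictScalars ℝ).comp p) 0 := by
    intro p
    have h1 : HasFDerivAt (NormedSpace.exp : (E →L[ℂ] E) → (E →L[ℂ] E))
        (1 : (E →L[ℂ] E) →L[ℝ] (E →L[ℂ] E)) ((adL E G) (p 0)) := by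
      rw [map_zero, map_zero]; exact hasFDerivAt_exp_zero
    exact h1.comp (0 : E) ((((adL E G).restrictScalars ℝ).comp p).hasFDerivAt)
  -- All three factors are 1 at 0, so the derivative of the product is ad(p₀v + p₁v + p₂v) = ad v,
  -- and the left inverse of ad returns v.
  have hFd : HasFDerivAt F ((ContinuousLinearEquiv.refl ℝ E : E ≃L[ℝ] E) : E →L[ℝ] E) 0 := by
    have h1 := hasFDerivAt_mul_of_eq_one (hasFDerivAt_mul_of_eq_one (hexpd p₀) (hexpd p₁)
      (by simp) (by simp)) (hexpd p₂) (by simp) (by simp)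
    have h2 := ((adLeftInv E G).restrictScalars ℝ).hasFDerivAt.comp (0 : E) h1
    refine h2.congr_fderiv ?_
    ext v
    have h3 : p₀ v + p₁ v + p₂ v = v := congrArg (fun L : E →L[ℝ] E => L v) hp
    change adLeftInv E G (adL E G (p₀ v) + adL E G (p₁ v) + adL E G (p₂ v)) = v
    rw [← map_add, ← map_add, adLeftInv_adL, h3]
  let ψ := hF.contDiffAt.toOpenPartialHomeomorph F hFd (by simp)
  have hψ : ContDiffAt ℝ ω ψ.symm (F 0) := hF.contDiffAt.to_localInverse hFd (by simp)
  obtain ⟨O, hO, hOo, hmO⟩ := eventually_nhds_iff.1 (hψ.eventually (by simp))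
  have hFe : ∀ v ∈ N, F v = e (prod v) := fun v hv => by
    rw [hev _ hv.2]; simp [F, prod, AdL_expG]
  let Φ := (ψ.trans e.symm).restrOpen (N ∩ F ⁻¹' O) (hNo.inter (hOo.preimage hF.continuous))
  have hΦs : ∀ v ∈ Φ.source, v ∈ ψ.source ∧ v ∈ N ∧ F v ∈ O := fun v hv => by
    exact ⟨hv.1.1, hv.2.1, hv.2.2⟩
  refine ⟨Φ, ?_, fun v hv => ?_, fun p hp => (hp' p hp).mono fun v hv => (hΦs v hv).2.1.1, ?_⟩
  · refine ⟨⟨hF.contDiffAt.mem_toOpenPartialHomeomorph_source hFd (by simp), ?_⟩, hN0, hmO⟩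
    change F 0 ∈ e.target
    rw [hFe 0 hN0]
    exact e.map_source hN0.2
  · have h1 : Φ v = e.symm (F v) := rfl
    rw [h1, hFe v (hΦs v hv).2.1, e.left_inv (hΦs v hv).2.1.2]
  · have hsymm : ∀ g ∈ Φ.target, g ∈ e.source ∧ e g ∈ O := by
      intro g hg
      have h1 := Φ.map_target hg
      have h2 : Φ (Φ.symm g) = g := Φ.right_inv hg
      have h3 : g = e.symm (F (Φ.symm g)) := h2.symm
      have h4 := hΦs _ h1
      have h5 : g = prod (Φ.symm g) := by
        refine h3.trans ?_
        rw [hFe _ h4.2.1, e.left_inv h4.2.1.2]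
      rw [h5]
      exact ⟨h4.2.1.2, by rw [← hFe _ h4.2.1]; exact h4.2.2⟩
    intro g hg
    have h1 : ContMDiffAt 𝓘(ℝ, E) 𝓘(ℝ, E) ω (fun g => adLeftInv E G (AdL E G g)) g :=
      ContMDiffAt.comp (I' := 𝓘(ℝ, E →L[ℂ] E)) g
        (((adLeftInv E G).restrictScalars ℝ).contDiff.contMDiff.contMDiffAt)
        contMDiff_AdL_real.contMDiffAt
    have h2 : ContMDiffAt 𝓘(ℝ, E) 𝓘(ℝ, E) ω ψ.symm (adLeftInv E G (AdL E G g)) := by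
      rw [← hev g (hsymm g hg).1]
      exact (hO _ (hsymm g hg).2).contMDiffAt
    refine ((ContMDiffAt.comp (I' := 𝓘(ℝ, E)) g h2 h1).congr_of_eventuallyEq ?_).contMDiffWithinAt
    filter_upwards [e.open_source.mem_nhds (hsymm g hg).1] with k hk
    rw [Function.comp_apply, ← hev k hk]
    rfl

theorem connSubgroup_eq_closure (k : Submodule ℂ E) :
    connSubgroup (G := G) E k = Subgroup.closure (expG E G '' k) := by
  unfold connSubgroup
  congr 1
  ext g
  constructor
  · rintro ⟨x, hx, c, hc, rfl⟩
    exact ⟨x, hx, (congrArg (expG E G) (one_smul ℝ (x : E))).symm.trans (hc.eq_expG 1).symm⟩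
  · rintro ⟨x, hx, rfl⟩
    exact ⟨x, hx, _, isOneParam_expG x, by simp⟩

theorem expG_mem_connSubgroup {k : Submodule ℂ E} {x : E} (hx : x ∈ k) :
    expG E G x ∈ connSubgroup (G := G) E k := by
  rw [connSubgroup_eq_closure]
  exact Subgroup.subset_closure ⟨x, hx, rfl⟩

variable (E G) in
-- For the splitting id + 0 + 0 the product chart is exp itself, so exponentials fill a
-- neighbourhood of 1.
theorem closure_range_expG [ConnectedSpace G] : Subgroup.closure (range (expG E G)) = ⊤ := by
  have : IsTopologicalGroup G := topologicalGroup_of_lieGroup 𝓘(ℂ, E) ω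
  obtain ⟨Φ, h0, hΦ, -⟩ := exists_productChart G (ContinuousLinearMap.id ℝ E) 0 0 (by simp)
  refine subgroup_eq_top_of_mem_nhds (mem_of_superset (Φ.open_target.mem_nhds
    (show (1 : G) ∈ Φ.target from ?_)) fun g hg => ?_)
  · have h1 := Φ.map_source h0
    rw [hΦ 0 h0] at h1
    simpa [expG_zero] using h1
  · rw [← Φ.right_inv hg, hΦ _ (Φ.map_target hg)]
    refine Subgroup.subset_closure ⟨Φ.symm g, ?_⟩
    simp [expG_zero]

end Exponential

/-! ### Graded vector spaces and degrees of endomorphisms -/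

section GradingProjections

variable {E : Type*} [NormedAddCommGroup E] [NormedSpace ℂ E] [FiniteDimensional ℂ E]

/-- `p` is the family of projections of a vector space to the summands of a gradation. -/
structure IsGradingProj (gr : ℤ → Submodule ℂ E) (p : ℤ → E →L[ℂ] E) : Prop where
  mem : ∀ m x, p m x ∈ gr m
  same : ∀ m, ∀ x ∈ gr m, p m x = x
  ne : ∀ m k, m ≠ k → ∀ x ∈ gr k, p m x = 0
  sum : ∀ x, ∃ s : Finset ℤ, x = ∑ m ∈ s, p m x

/-- The sum of the components of a gradation with degrees in `S`. -/
def gradeSum (gr : ℤ → Submodule ℂ E) (S : Set ℤ) : Submodule ℂ E := ⨆ m, ⨆ _ : m ∈ S, gr m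

/-- The endomorphisms all of whose homogeneous components have degrees in `S`. -/
def gradeEnd (gr : ℤ → Submodule ℂ E) (p : ℤ → E →L[ℂ] E) (S : Set ℤ) :
    Submodule ℂ (E →L[ℂ] E) where
  carrier := {T | ∀ k j, j - k ∉ S → ∀ x ∈ gr k, p j (T x) = 0}
  add_mem' := fun hT hT' k j hjk x hx => by simp [hT k j hjk x hx, hT' k j hjk x hx]
  zero_mem' := fun k j _ x _ => by simp
  smul_mem' := fun c T hT k j hjk x hx => by simp [hT k j hjk x hx]

/-- The projections to the components of a decomposition. -/
def gradeProj (gr : ℤ → Submodule ℂ E) [DirectSum.Decomposition gr] (m : ℤ) : E →L[ℂ] E :=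
  LinearMap.toContinuousLinearMap
    ((gr m).subtype ∘ₗ DirectSum.component ℂ ℤ (fun i => gr i) m ∘ₗ
      (DirectSum.decomposeLinearEquiv gr).toLinearMap)

theorem isGradingProj_gradeProj (gr : ℤ → Submodule ℂ E) [DirectSum.Decomposition gr] :
    IsGradingProj gr (gradeProj gr) := by
  have h : ∀ m x, gradeProj gr m x = (DirectSum.decompose gr x m : E) := fun m x => rfl
  refine ⟨fun m x => ?_, fun m x hx => ?_, fun m k hmk x hx => ?_, fun x => ?_⟩
  · rw [h]; exact Subtype.mem _
  · rw [h, DirectSum.decompose_of_mem_same gr hx]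
  · rw [h, DirectSum.decompose_of_mem_ne gr hx hmk.symm]
  · classical
    exact ⟨(DirectSum.decompose gr x).support, (DirectSum.sum_support_decompose gr x).symm⟩

theorem IsGradingProj.neg {gr : ℤ → Submodule ℂ E} {p : ℤ → E →L[ℂ] E} (h : IsGradingProj gr p) :
    IsGradingProj (fun m => gr (-m)) (fun m => p (-m)) := by
  refine ⟨fun m x => h.mem _ x, fun m x hx => h.same _ x hx,
    fun m k hmk x hx => h.ne _ _ (by simpa using hmk) x hx, fun x => ?_⟩
  obtain ⟨s, hs⟩ := h.sum x
  classical
  refine ⟨s.image (fun m => -m), ?_⟩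
  rw [Finset.sum_image (by simp)]
  simpa using hs

namespace IsGradingProj

variable {gr : ℤ → Submodule ℂ E} {p : ℤ → E →L[ℂ] E} (h : IsGradingProj gr p)
include h

theorem eq_zero {x : E} (hx : ∀ m, p m x = 0) : x = 0 := by
  obtain ⟨s, hs⟩ := h.sum x
  rw [hs]
  exact Finset.sum_eq_zero fun m _ => hx m

theorem mem_gradeSum {S : Set ℤ} {x : E} : x ∈ gradeSum gr S ↔ ∀ m ∉ S, p m x = 0 := by
  constructor
  · intro hx m hm
    have hle : gradeSum gr S ≤ LinearMap.ker (p m : E →ₗ[ℂ] E) := by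
      refine iSup₂_le fun k hk y hy => ?_
      exact h.ne m k (fun hmk => hm (hmk ▸ hk)) y hy
    exact hle hx
  · intro hx
    obtain ⟨s, hs⟩ := h.sum x
    rw [hs]
    refine Submodule.sum_mem _ fun m _ => ?_
    by_cases hm : m ∈ S
    · exact Submodule.mem_iSup_of_mem m (Submodule.mem_iSup_of_mem hm (h.mem m x))
    · rw [hx m hm]; exact Submodule.zero_mem _

theorem mem_iff {k : ℤ} {x : E} : x ∈ gr k ↔ ∀ m ≠ k, p m x = 0 := by
  constructor
  · exact fun hx m hm => h.ne m k hm x hx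
  · intro hx
    have h1 : x = p k x := by
      rw [← sub_eq_zero]
      refine h.eq_zero fun m => ?_
      rw [map_sub]
      by_cases hm : m = k
      · subst hm; rw [h.same m _ (h.mem m x), sub_self]
      · rw [hx m hm, h.ne m k hm _ (h.mem k x), sub_zero]
    rw [h1]; exact h.mem k x

theorem eq_zero_of_mem_mem {S S' : Set ℤ} (hS : ∀ m ∈ S, m ∉ S') {x : E}
    (hx : x ∈ gradeSum gr S) (hx' : x ∈ gradeSum gr S') : x = 0 := by
  rw [h.mem_gradeSum] at hx hx'
  refine h.eq_zero fun m => ?_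
  by_cases hm : m ∈ S
  · exact hx' m (hS m hm)
  · exact hx m hm

theorem gradeSum_singleton (k : ℤ) : gradeSum gr {k} = gr k := by
  ext x
  rw [h.mem_gradeSum, h.mem_iff]
  rfl

omit h in
theorem gradeEnd_mono {S S' : Set ℤ} (hS : S ⊆ S') : gradeEnd gr p S ≤ gradeEnd gr p S' :=
  fun _ hT k j hjk x hx => hT k j (fun h => hjk (hS h)) x hx

omit h in
theorem mem_gradeEnd_inter {S S' : Set ℤ} {T : E →L[ℂ] E} (hT : T ∈ gradeEnd gr p S)
    (hT' : T ∈ gradeEnd gr p S') : T ∈ gradeEnd gr p (S ∩ S') := by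
  intro k j hjk x hx
  by_cases hS : j - k ∈ S
  · exact hT' k j (fun h => hjk ⟨hS, h⟩) x hx
  · exact hT k j hS x hx

theorem eq_zero_of_mem_gradeEnd_empty {T : E →L[ℂ] E} (hT : T ∈ gradeEnd gr p ∅) : T = 0 := by
  ext x
  obtain ⟨s, hs⟩ := h.sum x
  rw [hs, map_sum]
  refine Finset.sum_eq_zero fun k _ => ?_
  exact h.eq_zero fun j => hT k j (by simp) _ (h.mem k x)

theorem eq_zero_of_mem_gradeEnd {S S' : Set ℤ} (hS : ∀ m ∈ S, m ∉ S') {T : E →L[ℂ] E}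
    (hT : T ∈ gradeEnd gr p S) (hT' : T ∈ gradeEnd gr p S') : T = 0 :=
  h.eq_zero_of_mem_gradeEnd_empty
    (gradeEnd_mono (fun m hm => hS m hm.1 hm.2) (mem_gradeEnd_inter hT hT'))

theorem one_mem_gradeEnd {S : Set ℤ} (hS : (0 : ℤ) ∈ S) : (1 : E →L[ℂ] E) ∈ gradeEnd gr p S := by
  intro k j hjk x hx
  refine h.ne j k (fun hjk' => hjk ?_) x hx
  rw [hjk', sub_self]; exact hS

theorem apply_mem_gradeSum {S S' S'' : Set ℤ} (hS : ∀ a ∈ S, ∀ b ∈ S', a + b ∈ S'')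
    {T : E →L[ℂ] E} (hT : T ∈ gradeEnd gr p S) {x : E} (hx : x ∈ gradeSum gr S') :
    T x ∈ gradeSum gr S'' := by
  rw [h.mem_gradeSum] at hx ⊢
  intro j hj
  obtain ⟨s, hs⟩ := h.sum x
  rw [hs, map_sum, map_sum]
  refine Finset.sum_eq_zero fun k _ => ?_
  by_cases hk : k ∈ S'
  · refine hT k j (fun hjk => hj ?_) _ (h.mem k x)
    have := hS _ hjk _ hk
    rwa [sub_add_cancel] at this
  · rw [hx k hk, map_zero, map_zero]

theorem mul_mem_gradeEnd {S S' S'' : Set ℤ} (hS : ∀ a ∈ S, ∀ b ∈ S', a + b ∈ S'')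
    {T T' : E →L[ℂ] E} (hT : T ∈ gradeEnd gr p S) (hT' : T' ∈ gradeEnd gr p S') :
    T * T' ∈ gradeEnd gr p S'' := by
  intro k j hjk x hx
  have h1 : T' x ∈ gradeSum gr ((fun a => a + k) '' S') := by
    rw [h.mem_gradeSum]
    exact fun m hm => hT' k m (fun hmk => hm ⟨m - k, hmk, by simp⟩) x hx
  have h2 := h.apply_mem_gradeSum (S'' := (fun a => a + k) '' S'') ?_ hT h1
  · rw [h.mem_gradeSum] at h2
    refine h2 j ?_
    rintro ⟨a, ha, rfl⟩
    simp at hjk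
    exact hjk ha
  · rintro a ha _ ⟨b, hb, rfl⟩
    exact ⟨a + b, hS a ha b hb, by ring⟩

/-- Every power of T from the first on has degrees in S, and a subspace of a finite-dimensional
space contains the limits of its partial sums. -/
theorem exp_sub_one_mem_gradeEnd {S : Set ℤ} (hS : ∀ a ∈ S, ∀ b ∈ S, a + b ∈ S)
    {T : E →L[ℂ] E} (hT : T ∈ gradeEnd gr p S) : NormedSpace.exp T - 1 ∈ gradeEnd gr p S := by
  have : CompleteSpace E := FiniteDimensional.complete ℂ E
  have hpow : ∀ n : ℕ, T ^ (n + 1) ∈ gradeEnd gr p S := by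
    intro n
    induction n with
    | zero => simpa using hT
    | succ n ih => rw [pow_succ]; exact h.mul_mem_gradeEnd hS ih hT
  have h1 := NormedSpace.exp_series_hasSum_exp' (𝕂 := ℂ) T
  have h2 := h1.tendsto_sum_nat
  have h3 : Tendsto (fun n : ℕ => (∑ i ∈ Finset.range (n + 1), ((i.factorial : ℂ)⁻¹) • T ^ i) - 1)
      atTop (𝓝 (NormedSpace.exp T - 1)) :=
    (h2.comp (tendsto_add_atTop_nat 1)).sub_const 1
  refine (gradeEnd gr p S).closed_of_finiteDimensional.mem_of_tendsto h3
    (Eventually.of_forall fun n => ?_)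
  rw [Finset.sum_range_succ']
  simp only [Nat.factorial_zero, Nat.cast_one, inv_one, pow_zero, one_smul, add_sub_cancel_right]
  exact Submodule.sum_mem _ fun i _ => Submodule.smul_mem _ _ (hpow i)

variable {br : E →L[ℂ] E →L[ℂ] E} (hbr : ∀ i j, ∀ x ∈ gr i, ∀ y ∈ gr j, br x y ∈ gr (i + j))
include hbr

theorem br_mem_gradeEnd {S : Set ℤ} {x : E} (hx : x ∈ gradeSum gr S) : br x ∈ gradeEnd gr p S := by
  rw [h.mem_gradeSum] at hx
  intro k j hjk y hy
  obtain ⟨s, hs⟩ := h.sum x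
  rw [hs, map_sum, sum_apply, map_sum]
  refine Finset.sum_eq_zero fun m _ => ?_
  by_cases hm : m ∈ S
  · refine h.ne j (m + k) (fun hj => hjk ?_) _ (hbr m k _ (h.mem m x) y hy)
    rw [hj, add_sub_cancel_right]; exact hm
  · rw [hx m hm, map_zero]; simp

/-- The degree m component of the operator of x is the operator of the degree m component of x, so
by injectivity the degrees of x can be read off from its operator. -/
theorem mem_gradeSum_of_br {S : Set ℤ} (hinj : Function.Injective br) {x : E}
    (hx : br x ∈ gradeEnd gr p S) : x ∈ gradeSum gr S := by
  rw [h.mem_gradeSum]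
  intro m hm
  refine hinj ?_
  rw [map_zero]
  have hcomp : ∀ k, ∀ y ∈ gr k, br (p m x) y = 0 := by
    intro k y hy
    have h1 := hx k (m + k) (by simpa using hm) y hy
    obtain ⟨s, hs⟩ := h.sum x
    have h2 : p (m + k) (br x y) = br (p m x) y := by
      have h3 : ∀ i, p (m + k) (br (p i x) y) = if i = m then br (p m x) y else 0 := by
        intro i
        split_ifs with him
        · rw [him]; exact h.same _ _ (hbr _ _ _ (h.mem m x) y hy)
        · exact h.ne _ (i + k) (fun hi => him (by linarith)) _ (hbr _ _ _ (h.mem i x) y hy)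
      by_cases hms : m ∈ s
      · conv_lhs => rw [hs]
        rw [map_sum, sum_apply, map_sum, Finset.sum_congr rfl fun i _ => h3 i,
          Finset.sum_ite_eq' s m, if_pos hms]
      · have h4 : p m x = 0 := by
          rw [hs, map_sum]
          exact Finset.sum_eq_zero fun i hi => h.ne m i (fun hmi => hms (hmi ▸ hi)) _ (h.mem i x)
        conv_lhs => rw [hs]
        rw [map_sum, sum_apply, map_sum, Finset.sum_congr rfl fun i _ => h3 i,
          Finset.sum_ite_eq' s m, if_neg hms, h4, map_zero]
        rfl
    rw [← h2, h1]
  ext y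
  obtain ⟨s, hs⟩ := h.sum y
  rw [hs, map_sum]
  exact Finset.sum_eq_zero fun k _ => hcomp k _ (h.mem k y)

end IsGradingProj

end GradingProjections

/-- A `ℤ`-graded semisimple Lie algebra has a grading element. -/
theorem exists_gradingElement {L : Type*} [LieRing L] [LieAlgebra ℂ L] [FiniteDimensional ℂ L]
    [LieAlgebra.IsSemisimple ℂ L] (gr : ℤ → Submodule ℂ L) [GradedLieAlgebra gr] :
    ∃ h₀ : L, ∀ m, ∀ x ∈ gr m, ⁅h₀, x⁆ = (m : ℂ) • x := by
  obtain ⟨h₀, hh⟩ := LieDerivation.IsKilling.exists_eq_ad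
    (LieDerivation.ofGrading gr (Int.castAddHom ℂ))
  refine ⟨h₀, fun m x hx => ?_⟩
  have h1 := LieDerivation.ofGrading_apply_apply gr (Int.castAddHom ℂ) hx
  rw [← hh] at h1
  simpa using h1

/-! ### The subgroups of a gradation: B̃₋ = Ñ₋H̃ and B̃₊ ∩ B̃₋ = H̃ -/

section LieGrading

variable {E : Type*} [NormedAddCommGroup E] [NormedSpace ℂ E] [FiniteDimensional ℂ E]
  {G : Type*} [TopologicalSpace G] [ChartedSpace E G] [Group G] [LieGroup 𝓘(ℂ, E) ω G]

variable (G) in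
/-- `gr` is a gradation of the Lie algebra of `G`, with projections `p` and with grading
element `h₀`. -/
structure IsLieGrading (gr : ℤ → Submodule ℂ E) (p : ℤ → E →L[ℂ] E) (h₀ : E) : Prop
    extends IsGradingProj gr p where
  adL_mem : ∀ i j, ∀ x ∈ gr i, ∀ y ∈ gr j, adL E G x y ∈ gr (i + j)
  adL_eq : ∀ m, ∀ x ∈ gr m, adL E G h₀ x = (m : ℂ) • x

theorem exists_isLieGrading [LieAlgebra.IsSemisimple ℂ (GroupLieAlgebra 𝓘(ℂ, E) G)]
    (gr : ℤ → Submodule ℂ (GroupLieAlgebra 𝓘(ℂ, E) G)) [GradedLieAlgebra gr] :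
    ∃ p h₀, IsLieGrading (E := E) G gr p h₀ := by
  have : FiniteDimensional ℂ (GroupLieAlgebra 𝓘(ℂ, E) G) := ‹FiniteDimensional ℂ E›
  obtain ⟨h₀, hh⟩ := exists_gradingElement gr
  have hmem : ∀ i j, ∀ x ∈ gr i, ∀ y ∈ gr j, ⁅x, y⁆ ∈ gr (i + j) :=
    fun i j x hx y hy => SetLike.GradedBracket.bracket_mem hx hy
  let h₀' : E := h₀
  let gr' : ℤ → Submodule ℂ E := gr
  let _ : DirectSum.Decomposition gr' := (inferInstance : DirectSum.Decomposition gr)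
  refine ⟨gradeProj gr', h₀', isGradingProj_gradeProj gr', fun i j x hx y hy => ?_,
    fun m x hx => ?_⟩
  · rw [adL_apply]
    exact hmem i j x hx y hy
  · exact (adL_apply (G := G) h₀' x).trans (hh m x hx)

theorem gradeSum_mono {gr : ℤ → Submodule ℂ E} {S S' : Set ℤ} (hS : S ⊆ S') :
    gradeSum gr S ≤ gradeSum gr S' :=
  iSup_mono fun _ => iSup_mono' fun hm => ⟨hS hm, le_rfl⟩

/-- Finitely many degrees occur in a basis, so the projections to all positive and to all negative
degrees are finite sums. The splitting feeds `exists_productChart`. -/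
theorem exists_splitting {gr : ℤ → Submodule ℂ E} {p : ℤ → E →L[ℂ] E} (h : IsGradingProj gr p) :
    ∃ qp qm : E →L[ℂ] E, (∀ x, qp x ∈ gradeSum gr (Ioi 0)) ∧ (∀ x, qm x ∈ gradeSum gr (Iio 0)) ∧
      qp + qm + p 0 = ContinuousLinearMap.id ℂ E := by
  classical
  obtain ⟨s, hs⟩ : ∃ s : Finset ℤ, ∀ x, x = ∑ m ∈ s, p m x := by
    let b := Module.finBasis ℂ E
    choose t ht using fun i => h.sum (b i)
    refine ⟨Finset.univ.biUnion t, fun x => ?_⟩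
    have h1 : LinearMap.id = ∑ m ∈ Finset.univ.biUnion t, (p m : E →ₗ[ℂ] E) := by
      refine b.ext fun i => ?_
      rw [LinearMap.sum_apply]
      refine (ht i).trans (Finset.sum_subset (Finset.subset_biUnion_of_mem t (Finset.mem_univ i))
        fun m _ hm => ?_)
      rw [ht i, map_sum]
      exact Finset.sum_eq_zero fun k hk => h.ne m k (fun hmk => hm (hmk ▸ hk)) _ (h.mem k _)
    simpa using congrArg (fun T : E →ₗ[ℂ] E => T x) h1
  have hmem : ∀ (T : Set ℤ) (u : Finset ℤ), (∀ m ∈ u, m ∈ T) → ∀ x,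
      (∑ m ∈ u, p m) x ∈ gradeSum gr T := by
    intro T u hu x
    rw [sum_apply]
    exact Submodule.sum_mem _ fun m hm =>
      Submodule.mem_iSup_of_mem m (Submodule.mem_iSup_of_mem (hu m hm) (h.mem m x))
  refine ⟨∑ m ∈ s with 0 < m, p m, ∑ m ∈ s with m < 0, p m, hmem _ _ (by simp), hmem _ _ (by simp),
    ?_⟩
  ext x
  have h0 : ∑ m ∈ s with m = 0, p m x = p 0 x := by
    rw [Finset.filter_eq']
    split_ifs with h0
    · simp
    · rw [Finset.sum_empty, hs x, map_sum]
      exact (Finset.sum_eq_zero fun k hk => h.ne 0 k (fun hmk => h0 (hmk ▸ hk)) _ (h.mem k _)).symm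
  simp only [add_apply, sum_apply, ContinuousLinearMap.coe_id', id_eq]
  conv_rhs => rw [hs x]
  rw [← h0, ← Finset.sum_filter_add_sum_filter_not s (fun m => 0 < m), add_assoc]
  congr 1
  rw [← Finset.sum_filter_add_sum_filter_not (s.filter fun m => ¬ 0 < m) (fun m => m < 0),
    Finset.filter_filter, Finset.filter_filter]
  congr 2
  · ext m; simp; omega
  · ext m; simp; omega

/-- The exponential of an operator on an eigenvector. -/
theorem exp_apply_of_eq_smul {T : E →L[ℂ] E} {c : ℂ} {x : E} (hx : T x = c • x) :
    NormedSpace.exp T x = Complex.exp c • x := by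
  have : CompleteSpace E := FiniteDimensional.complete ℂ E
  have hpow : ∀ n : ℕ, (T ^ n) x = c ^ n • x := by
    intro n
    induction n with
    | zero => simp
    | succ n ih => rw [pow_succ', mul_apply_eq_comp, ih, map_smul, hx, smul_smul, pow_succ]
  have h1 := (NormedSpace.exp_series_hasSum_exp' (𝕂 := ℂ) T).mapL
    (ContinuousLinearMap.apply ℂ E x)
  have h2 := (NormedSpace.exp_series_hasSum_exp' (𝕂 := ℂ) c).smul_const x
  rw [Complex.exp_eq_exp_ℂ]
  refine h1.unique (h2.congr_fun fun n => ?_)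
  simp [hpow, smul_smul]

variable [LieAlgebra.IsSemisimple ℂ (GroupLieAlgebra 𝓘(ℂ, E) G)]

variable (G) in
/-- The connected subgroup of `G` corresponding to a subalgebra of the model space. -/
def expSubgroup (k : Submodule ℂ E) : Subgroup G := connSubgroup (G := G) E k

theorem expSubgroup_eq_closure (k : Submodule ℂ E) :
    expSubgroup G k = Subgroup.closure (expG E G '' k) := connSubgroup_eq_closure k

theorem expG_mem_expSubgroup {k : Submodule ℂ E} {x : E} (hx : x ∈ k) :
    expG E G x ∈ expSubgroup G k := expG_mem_connSubgroup hx

theorem map_expSubgroup {k k' : Submodule ℂ E} (f : G →* G) (σ : E → E)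
    (hf : ∀ x, f (expG E G x) = expG E G (σ x)) (hσ : ∀ x ∈ k, σ x ∈ k') {g : G}
    (hg : g ∈ expSubgroup G k) : f g ∈ expSubgroup G k' := by
  have hle : expSubgroup G k ≤ (expSubgroup G k').comap f := by
    rw [expSubgroup_eq_closure, Subgroup.closure_le]
    rintro _ ⟨x, hx, rfl⟩
    change f (expG E G x) ∈ expSubgroup G k'
    rw [hf]
    exact expG_mem_expSubgroup (hσ x hx)
  exact hle hg

theorem conj_mem_expSubgroup {k k' : Submodule ℂ E} {g n : G}
    (hg : ∀ x ∈ k, AdL E G g x ∈ k') (hn : n ∈ expSubgroup G k) :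
    g * n * g⁻¹ ∈ expSubgroup G k' :=
  map_expSubgroup (MulAut.conj g).toMonoidHom (AdL E G g) (fun x => conj_expG g x) hg hn

theorem expSubgroup_mono {k k' : Submodule ℂ E} (hk : k ≤ k') :
    expSubgroup G k ≤ expSubgroup G k' :=
  fun _ hg => map_expSubgroup (MonoidHom.id G) id (fun _ => rfl) hk hg

theorem eqOn_of_expG [ConnectedSpace G] {f f' : G →* G}
    (h : ∀ x, f (expG E G x) = f' (expG E G x)) : f = f' := by
  refine MonoidHom.eq_of_eqOn_dense (closure_range_expG E G) ?_
  rintro _ ⟨x, rfl⟩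
  exact h x

/-- Conjugation by g fixes every exponential, and exponentials generate the connected group. -/
theorem commute_of_AdL_eq_one [ConnectedSpace G] {g : G} (hg : AdL E G g = 1) (k : G) :
    g * k * g⁻¹ = k := by
  have h := eqOn_of_expG (E := E) (f := (MulAut.conj g).toMonoidHom) (f' := MonoidHom.id G)
    fun x => by simpa [hg] using conj_expG g x
  exact congrArg (fun f : G →* G => f k) h

variable (E G) in
theorem tendsto_expG_zero : Tendsto (expG E G) (𝓝 0) (𝓝 1) := by
  obtain ⟨r, hr, h⟩ := exists_contMDiffOn_expG E G
  have h1 := (h.continuousOn).continuousAt (Metric.ball_mem_nhds 0 hr)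
  rw [ContinuousAt, expG_zero] at h1
  exact h1

namespace IsLieGrading

variable {gr : ℤ → Submodule ℂ E} {p : ℤ → E →L[ℂ] E} {h₀ : E} (h : IsLieGrading G gr p h₀)
include h

theorem neg : IsLieGrading G (fun m => gr (-m)) (fun m => p (-m)) (-h₀) := by
  refine ⟨h.toIsGradingProj.neg, fun i j x hx y hy => ?_, fun m x hx => ?_⟩
  · have := h.adL_mem _ _ x hx y hy
    rwa [← neg_add] at this
  · have := h.adL_eq _ x hx
    rw [map_neg, neg_apply, this]
    simp

theorem proj_adL (m : ℤ) (x : E) : p m (adL E G h₀ x) = (m : ℂ) • p m x := by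
  obtain ⟨s, hs⟩ := h.sum x
  rw [hs, map_sum, map_sum, map_sum, Finset.smul_sum]
  refine Finset.sum_congr rfl fun k _ => ?_
  rw [h.adL_eq k _ (h.mem k x), map_smul]
  by_cases hk : m = k
  · rw [hk]
  · rw [h.ne m k hk _ (h.mem k x), smul_zero, smul_zero]

/-- [h₀, h₀] = 0 says that m times the degree m component of h₀ vanishes for every m. -/
theorem gradingElement_mem : h₀ ∈ gr 0 := by
  have h1 : adL E G h₀ h₀ = 0 := by
    rw [adL_apply]
    exact lie_self (L := GroupLieAlgebra 𝓘(ℂ, E) G) _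
  rw [h.mem_iff]
  intro m hm
  have h3 := h.proj_adL m h₀
  rw [h1, map_zero] at h3
  exact (smul_eq_zero.1 h3.symm).resolve_left (by exact_mod_cast hm)

/-- True for exponentials, and AB - 1 = (A - 1)(B - 1) + (A - 1) + (B - 1) carries it to products.
The identity is subtracted because S need not contain 0. -/
theorem AdL_sub_one_mem {S : Set ℤ} (hS : ∀ a ∈ S, ∀ b ∈ S, a + b ∈ S) {g : G}
    (hg : g ∈ expSubgroup G (gradeSum gr S)) : AdL E G g - 1 ∈ gradeEnd gr p S := by
  have hmul : ∀ A B : E →L[ℂ] E, A - 1 ∈ gradeEnd gr p S → B - 1 ∈ gradeEnd gr p S →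
      A * B - 1 ∈ gradeEnd gr p S := by
    intro A B hA hB
    have h1 : A * B - 1 = (A - 1) * (B - 1) + (A - 1) + (B - 1) := by noncomm_ring
    rw [h1]
    exact Submodule.add_mem _ (Submodule.add_mem _ (h.mul_mem_gradeEnd hS hA hB) hA) hB
  have hexp : ∀ x ∈ gradeSum gr S, AdL E G (expG E G x) - 1 ∈ gradeEnd gr p S := by
    intro x hx
    rw [AdL_expG]
    exact h.exp_sub_one_mem_gradeEnd hS (h.br_mem_gradeEnd h.adL_mem hx)
  rw [expSubgroup_eq_closure] at hg
  -- The inverse is carried along so that the induction step for inverses is a swap.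
  refine (show AdL E G g - 1 ∈ gradeEnd gr p S ∧ AdL E G g⁻¹ - 1 ∈ gradeEnd gr p S from ?_).1
  induction hg using Subgroup.closure_induction with
  | mem g hg =>
    obtain ⟨x, hx, rfl⟩ := hg
    exact ⟨hexp x hx, by rw [← expG_neg]; exact hexp _ (Submodule.neg_mem _ hx)⟩
  | one => simp
  | mul a b _ _ ha hb =>
    rw [mul_inv_rev, map_mul, map_mul]
    exact ⟨hmul _ _ ha.1 hb.1, hmul _ _ hb.2 ha.2⟩
  | inv a _ ha => rw [inv_inv]; exact ⟨ha.2, ha.1⟩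

theorem AdL_mem_gradeEnd_singleton {g : G} (hg : g ∈ expSubgroup G (gr 0)) :
    AdL E G g ∈ gradeEnd gr p {0} := by
  have h1 := h.AdL_sub_one_mem (S := {0}) (by simp) (g := g)
    (by rw [h.gradeSum_singleton]; exact hg)
  have h2 := Submodule.add_mem _ h1 (h.one_mem_gradeEnd (S := {0}) rfl)
  rwa [sub_add_cancel] at h2

theorem AdL_apply_mem_gradeSum {g : G} (hg : g ∈ expSubgroup G (gr 0)) {S : Set ℤ} {x : E}
    (hx : x ∈ gradeSum gr S) : AdL E G g x ∈ gradeSum gr S :=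
  h.apply_mem_gradeSum (by simp) (h.AdL_mem_gradeEnd_singleton hg) hx

theorem AdL_apply_mem {g : G} (hg : g ∈ expSubgroup G (gr 0)) {m : ℤ} {x : E}
    (hx : x ∈ gr m) : AdL E G g x ∈ gr m := by
  rw [← h.gradeSum_singleton] at hx ⊢
  exact h.AdL_apply_mem_gradeSum hg hx

theorem conj_mem {g n : G} (hg : g ∈ expSubgroup G (gr 0)) {S : Set ℤ}
    (hn : n ∈ expSubgroup G (gradeSum gr S)) :
    g * n * g⁻¹ ∈ expSubgroup G (gradeSum gr S) :=
  conj_mem_expSubgroup (fun _ hx => h.AdL_apply_mem_gradeSum hg hx) hn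

theorem AdL_expG_smul (c : ℂ) {m : ℤ} {x : E} (hx : x ∈ gr m) :
    AdL E G (expG E G (c • h₀)) x = Complex.exp (c * m) • x := by
  rw [AdL_expG]
  refine exp_apply_of_eq_smul ?_
  rw [map_smul, smul_apply, h.adL_eq m x hx, smul_smul]

/-- Ad(exp(t h₀)) multiplies degree m by exp(tm), which tends to 0 as t → -∞ when m > 0. This
settles exponentials; conjugation is multiplicative, so products and inverses follow. -/
theorem tendsto_conj {g : G} (hg : g ∈ expSubgroup G (gradeSum gr (Ioi 0))) :
    Tendsto (fun t : ℝ => expG E G ((t : ℂ) • h₀) * g * (expG E G ((t : ℂ) • h₀))⁻¹) atBot (𝓝 1) := by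
  have : IsTopologicalGroup G := topologicalGroup_of_lieGroup 𝓘(ℂ, E) ω
  rw [expSubgroup_eq_closure] at hg
  induction hg using Subgroup.closure_induction with
  | mem g hg =>
    obtain ⟨x, hx, rfl⟩ := hg
    simp only [conj_expG]
    refine (tendsto_expG_zero E G).comp ?_
    obtain ⟨s, hs⟩ := h.sum x
    rw [hs]
    simp only [map_sum]
    rw [← Finset.sum_const_zero (s := s)]
    refine tendsto_finsetSum _ fun m _ => ?_
    by_cases hm : 0 < m
    · simp only [h.AdL_expG_smul _ (h.mem m x)]
      rw [← zero_smul ℂ (p m x)]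
      refine Tendsto.smul_const ?_ _
      rw [tendsto_zero_iff_norm_tendsto_zero]
      simp only [Complex.norm_exp]
      refine Real.tendsto_exp_atBot.comp ?_
      have : ∀ t : ℝ, ((t : ℂ) * m).re = t * m := fun t => by simp
      simp only [this]
      exact tendsto_id.atBot_mul_const (by exact_mod_cast hm)
    · rw [h.mem_gradeSum.1 hx m hm]; simp
  | one => simpa using tendsto_const_nhds
  | mul a b _ _ ha hb =>
    have h1 := ha.mul hb
    rw [one_mul] at h1
    refine h1.congr fun t => by group
  | inv a _ ha =>
    have h1 := ha.inv
    rw [inv_one] at h1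
    refine h1.congr fun t => by group

/-- Such a g is central, so the conjugations in `tendsto_conj` fix it while contracting it to 1. -/
theorem eq_one_of_AdL_eq_one [ConnectedSpace G] {g : G}
    (hg : g ∈ expSubgroup G (gradeSum gr (Ioi 0))) (hA : AdL E G g = 1) : g = 1 := by
  have : T2Space G := t2Space_of_lieGroup (E := E) G
  have h1 := h.tendsto_conj hg
  have h2 : ∀ t : ℝ, expG E G ((t : ℂ) • h₀) * g * (expG E G ((t : ℂ) • h₀))⁻¹ = g := by
    intro t
    have h3 := commute_of_AdL_eq_one hA (expG E G ((t : ℂ) • h₀))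
    rw [mul_inv_eq_iff_eq_mul] at h3 ⊢
    exact h3.symm
  simp only [h2] at h1
  exact tendsto_nhds_unique tendsto_const_nhds h1

/-- Ad(g) - 1 has only positive degrees and only nonpositive ones, so Ad(g) = 1. In particular Ñ₊ ∩
B̃₋ is trivial. -/
theorem eq_one_of_mem [ConnectedSpace G] {g : G}
    (hg : g ∈ expSubgroup G (gradeSum gr (Ioi 0)))
    (hA : AdL E G g ∈ gradeEnd gr p (Iic 0)) : g = 1 := by
  refine h.eq_one_of_AdL_eq_one hg (sub_eq_zero.1 ?_)
  refine h.eq_zero_of_mem_gradeEnd (S := Ioi 0) (S' := Iic 0) (by simp)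
    (h.AdL_sub_one_mem (fun a ha b hb => ?_) hg)
    (Submodule.sub_mem _ hA (h.one_mem_gradeEnd (by simp)))
  simp only [mem_Ioi] at *; omega

theorem gradeSum_neg (S : Set ℤ) : gradeSum (fun m => gr (-m)) S = gradeSum gr (-S) := by
  ext x
  rw [h.neg.mem_gradeSum, h.mem_gradeSum]
  exact ⟨fun hx m hm => by simpa using hx (-m) (by simpa using hm),
    fun hx m hm => hx (-m) (by simpa using hm)⟩

theorem AdL_mem_gradeEnd {S : Set ℤ} (hS : ∀ a ∈ S, ∀ b ∈ S, a + b ∈ S) (h0 : (0 : ℤ) ∈ S) {g : G}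
    (hg : g ∈ expSubgroup G (gradeSum gr S)) : AdL E G g ∈ gradeEnd gr p S := by
  have h2 := Submodule.add_mem _ (h.AdL_sub_one_mem hS hg) (h.one_mem_gradeEnd h0)
  rwa [sub_add_cancel] at h2

theorem grade_zero_le {S : Set ℤ} (h0 : (0 : ℤ) ∈ S) : gr 0 ≤ gradeSum gr S := by
  rw [← h.gradeSum_singleton]
  exact gradeSum_mono (singleton_subset_iff.2 h0)

/-- The products form a subgroup `Q`, since H̃ normalizes Ñ₋. For small x in b̃₋ the product chart
writes exp x with one factor in Ñ₊; solving for that factor shows that it lies in B̃₋, so it is 1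
and exp x is in `Q`. Larger x are reached by exp x = exp(x/n)ⁿ. -/
theorem exists_eq_mul [ConnectedSpace G] {b : G} (hb : b ∈ expSubgroup G (gradeSum gr (Iic 0))) :
    ∃ n ∈ expSubgroup G (gradeSum gr (Iio 0)), ∃ k ∈ expSubgroup G (gr 0), b = n * k := by
  obtain ⟨qp, qm, hqp, hqm, hq⟩ := exists_splitting h.toIsGradingProj
  obtain ⟨Φ, h0, hΦ, -⟩ := exists_productChart G (qp.restrictScalars ℝ) (qm.restrictScalars ℝ)
    ((p 0).restrictScalars ℝ) (by ext x; exact congrArg (fun T : E →L[ℂ] E => T x) hq)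
  let Q : Subgroup G :=
    { carrier := {g | ∃ n ∈ expSubgroup G (gradeSum gr (Iio 0)), ∃ k ∈ expSubgroup G (gr 0),
        g = n * k}
      one_mem' := ⟨1, one_mem _, 1, one_mem _, by simp⟩
      mul_mem' := by
        rintro _ _ ⟨n, hn, k, hk, rfl⟩ ⟨n', hn', k', hk', rfl⟩
        exact ⟨n * (k * n' * k⁻¹), mul_mem hn (h.conj_mem hk hn'), k * k', mul_mem hk hk', by group⟩
      inv_mem' := by
        rintro _ ⟨n, hn, k, hk, rfl⟩
        refine ⟨k⁻¹ * n⁻¹ * k⁻¹⁻¹, h.conj_mem (inv_mem hk) (inv_mem hn), k⁻¹, inv_mem hk, by group⟩ }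
  have hQ : ∀ n ∈ expSubgroup G (gradeSum gr (Iio 0)), ∀ k ∈ expSubgroup G (gr 0), n * k ∈ Q :=
    fun n hn k hk => ⟨n, hn, k, hk, rfl⟩
  have h1 : ∀ᶠ x in 𝓝 (0 : E), x ∈ gradeSum gr (Iic 0) → expG E G x ∈ Q := by
    have htgt : (1 : G) ∈ Φ.target := by
      have h1 := Φ.map_source h0
      rw [hΦ 0 h0] at h1
      simpa [expG_zero] using h1
    filter_upwards [tendsto_expG_zero E G (Φ.open_target.mem_nhds htgt)] with x hx hx'
    let v := Φ.symm (expG E G x)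
    have hv := hΦ v (Φ.map_target hx)
    rw [Φ.right_inv hx] at hv
    have hsm : expG E G (qm v) * expG E G (p 0 v) ∈ Q :=
      hQ _ (expG_mem_expSubgroup (hqm v)) _ (expG_mem_expSubgroup (h.mem 0 v))
    have hQle : ∀ g ∈ Q, g ∈ expSubgroup G (gradeSum gr (Iic 0)) := by
      rintro _ ⟨n, hn, k, hk, rfl⟩
      exact mul_mem (expSubgroup_mono (gradeSum_mono Iio_subset_Iic_self) hn)
        (expSubgroup_mono (h.grade_zero_le (by simp)) hk)
    have hone : expG E G (qp v) = 1 := by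
      refine h.eq_one_of_mem (expG_mem_expSubgroup (hqp v))
        (h.AdL_mem_gradeEnd (fun a ha b hb => ?_) (by simp) ?_)
      · simp only [mem_Iic] at *; omega
      · have h2 : expG E G (qp v) = expG E G x * (expG E G (qm v) * expG E G (p 0 v))⁻¹ := by
          rw [eq_mul_inv_iff_mul_eq, hv, mul_assoc]; rfl
        rw [h2]
        exact mul_mem (expG_mem_expSubgroup hx') (inv_mem (hQle _ hsm))
    have h3 : expG E G x = expG E G (qm v) * expG E G (p 0 v) := by
      rw [hv]
      change expG E G (qp v) * _ * _ = _
      rw [hone, one_mul]; rfl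
    rw [h3]; exact hsm
  have h2 : ∀ x ∈ gradeSum gr (Iic 0), expG E G x ∈ Q := by
    intro x hx
    have hlim : Tendsto (fun n : ℕ => ((n : ℝ)⁻¹) • x) atTop (𝓝 0) := by
      rw [← zero_smul ℝ x]
      exact (tendsto_inv_atTop_nhds_zero_nat (𝕜 := ℝ)).smul_const x
    obtain ⟨n, hn, hn0⟩ := ((hlim.eventually h1).and (eventually_ne_atTop 0)).exists
    have h3 : x = (n : ℝ) • ((n : ℝ)⁻¹ • x) := by
      rw [smul_smul, mul_inv_cancel₀ (by exact_mod_cast hn0), one_smul]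
    rw [h3, expG_nsmul]
    refine pow_mem (hn ?_) n
    exact Submodule.smul_of_tower_mem _ _ hx
  have h3 : expSubgroup G (gradeSum gr (Iic 0)) ≤ Q := by
    rw [expSubgroup_eq_closure, Subgroup.closure_le]
    rintro _ ⟨x, hx, rfl⟩
    exact h2 x hx
  exact h3 hb

/-- For the opposite gradation the preceding factorization reads g = nk with n in Ñ₊ and k in H̃.
Then n lies in Ñ₊ ∩ B̃₋, so n = 1. -/
theorem mem_of_mem_of_mem [ConnectedSpace G] {g : G}
    (hg : g ∈ expSubgroup G (gradeSum gr (Iic 0))) (hg' : g ∈ expSubgroup G (gradeSum gr (Ici 0))) :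
    g ∈ expSubgroup G (gr 0) := by
  obtain ⟨n, hn, k, hk, rfl⟩ := h.neg.exists_eq_mul
    (b := g) (by rwa [h.gradeSum_neg, neg_Iic, neg_zero])
  rw [h.gradeSum_neg, neg_Iio, neg_zero] at hn
  rw [neg_zero] at hk
  have hk' := expSubgroup_mono (h.grade_zero_le (S := Iic 0) (by simp)) hk
  have h1 : n = 1 := by
    refine h.eq_one_of_mem hn (h.AdL_mem_gradeEnd (fun a ha b hb => ?_) (by simp) ?_)
    · simp only [mem_Iic] at *; omega
    · exact (Subgroup.mul_mem_cancel_right _ hk').1 hg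
  rwa [h1, one_mul]

end IsLieGrading

end LieGrading

/-! ### The antiholomorphic automorphism and the reality condition -/

section Compatible

variable {E : Type*} [NormedAddCommGroup E] [NormedSpace ℂ E] [FiniteDimensional ℂ E]
  {G : Type*} [TopologicalSpace G] [ChartedSpace E G] [Group G] [LieGroup 𝓘(ℂ, E) ω G]

variable (E) in
/-- The differential at the identity of an automorphism of `G`, as a continuous linear map. -/
def autDiff (S : G ≃* G) : E →L[ℝ] E := mfderiv 𝓘(ℝ, E) 𝓘(ℝ, E) S 1

namespace IsCompatible

variable {gr : ℤ → Submodule ℂ E} {S : G ≃* G} (hS : IsCompatible (E := E) gr S)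
include hS

theorem contMDiff : ContMDiff 𝓘(ℝ, E) 𝓘(ℝ, E) ∞ (S : G → G) := contMDiffOn_univ.1 hS.antiholomorphic.1

theorem hasMFDerivAt_one : HasMFDerivAt 𝓘(ℝ, E) 𝓘(ℝ, E) (S : G → G) 1 (autDiff E S) :=
  (hS.contMDiff.mdifferentiableAt (by simp)).hasMFDerivAt

theorem autDiff_autDiff (x : E) : autDiff E S (autDiff E S x) = x := hS.involutive x

theorem autDiff_smul (c : ℂ) (x : E) : autDiff E S (c • x) = starRingEnd ℂ c • autDiff E S x := by
  have hI : ∀ y : E, autDiff E S (Complex.I • y) = -(Complex.I • autDiff E S y) :=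
    fun y => hS.antiholomorphic.2 1 trivial y
  conv_lhs => rw [← Complex.re_add_im c]
  conv_rhs => rw [← Complex.re_add_im c]
  simp only [add_smul, mul_smul, map_add, map_mul, Complex.conj_ofReal, Complex.conj_I,
    neg_smul, smul_neg, Complex.coe_smul, map_smul, hI]

theorem autDiff_mem {m : ℤ} {x : E} (hx : x ∈ gr m) : autDiff E S x ∈ gr (-m) := by
  have h1 := (hS.image_grade m).subset ⟨x, hx, rfl⟩
  exact h1

theorem autDiff_mem_gradeSum {p : ℤ → E →L[ℂ] E} (h : IsGradingProj gr p) {T : Set ℤ} {x : E}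
    (hx : x ∈ gradeSum gr T) : autDiff E S x ∈ gradeSum gr (-T) := by
  rw [h.mem_gradeSum] at hx
  obtain ⟨s, hs⟩ := h.sum x
  rw [hs, map_sum]
  refine Submodule.sum_mem _ fun m _ => ?_
  by_cases hm : m ∈ T
  · exact Submodule.mem_iSup_of_mem (-m) (Submodule.mem_iSup_of_mem (by simpa using hm)
      (hS.autDiff_mem (h.mem m x)))
  · rw [hx m hm, map_zero]; exact Submodule.zero_mem _

theorem autDiff_AdL (g : G) (x : E) :
    autDiff E S (AdL E G g x) = AdL E G (S g) (autDiff E S x) := by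
  have hone : HasMFDerivAt 𝓘(ℝ, E) 𝓘(ℝ, E) (S : G → G) (g * 1 * g⁻¹) (autDiff E S) := by
    have h1 : ∀ k : G, k = 1 → HasMFDerivAt 𝓘(ℝ, E) 𝓘(ℝ, E) (S : G → G) k (autDiff E S) := by
      rintro _ rfl; exact hS.hasMFDerivAt_one
    exact h1 _ (by simp)
  have hconj : ∀ (g : G) (k : G), k = 1 → HasMFDerivAt 𝓘(ℝ, E) 𝓘(ℝ, E) (fun h : G => g * h * g⁻¹) k
      ((AdL E G g).restrictScalars ℝ) := by
    rintro g _ rfl; exact hasMFDerivAt_restrictScalars (hasMFDerivAt_conj g)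
  have h1 := HasMFDerivAt.comp (1 : G) hone (hconj g 1 rfl)
  have h2 := HasMFDerivAt.comp (1 : G) (hconj (S g) (S 1) (map_one S)) hS.hasMFDerivAt_one
  have h3 : (fun h : G => S g * h * (S g)⁻¹) ∘ S = S ∘ fun h : G => g * h * g⁻¹ := by
    ext; simp
  rw [h3] at h2
  exact congrArg (fun L : E →L[ℝ] E => L x) (hasMFDerivAt_unique h1 h2)

theorem logDeriv_comp {F : Type*} [NormedAddCommGroup F] [NormedSpace ℝ F] {f : F → G} {q : F}
    (hf : MDifferentiableAt 𝓘(ℝ, F) 𝓘(ℝ, E) f q) :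
    logDeriv E (fun x => S (f x)) q = (autDiff E S).comp (logDeriv E f q) := by
  let D₀ : F →L[ℝ] E := logDeriv E f q
  have h1 : HasMFDerivAt 𝓘(ℝ, F) 𝓘(ℝ, E) (fun x => (f q)⁻¹ * f x) q D₀ :=
    (mdifferentiableAt_inv_mul hf _).hasMFDerivAt
  have hone : HasMFDerivAt 𝓘(ℝ, E) 𝓘(ℝ, E) (S : G → G) ((f q)⁻¹ * f q) (autDiff E S) := by
    have h1 : ∀ k : G, k = 1 → HasMFDerivAt 𝓘(ℝ, E) 𝓘(ℝ, E) (S : G → G) k (autDiff E S) := by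
      rintro _ rfl; exact hS.hasMFDerivAt_one
    exact h1 _ (by simp)
  have h2 := HasMFDerivAt.comp q hone h1
  have h3 : (S ∘ fun x => (f q)⁻¹ * f x) = fun x => (S (f q))⁻¹ * S (f x) := by
    ext; simp
  rw [h3] at h2
  exact h2.mfderiv

variable [LieAlgebra.IsSemisimple ℂ (GroupLieAlgebra 𝓘(ℂ, E) G)]

theorem apply_expG (x : E) : S (expG E G x) = expG E G (autDiff E S x) := by
  have h1 := (isOneParam_comp hS (isOneParam_expG (G := G) x)).eq_expG 1
  have h2 : ∀ y : E, (1 : ℝ) • y = y := one_smul ℝ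
  rw [h2] at h1
  exact h1.trans (congrArg (expG E G) (h2 (autDiff E S x)))

/-- Involutivity is given for the differential only; S² and the identity are homomorphisms that
agree on exponentials. -/
theorem apply_apply [ConnectedSpace G] (g : G) : S (S g) = g := by
  have h := eqOn_of_expG (E := E) (f := (S.toMonoidHom).comp S.toMonoidHom) (f' := MonoidHom.id G)
    fun x => by
      change S (S (expG E G x)) = expG E G x
      rw [hS.apply_expG, hS.apply_expG, hS.autDiff_autDiff]
  exact congrArg (fun f : G →* G => f g) h

theorem map_mem {p : ℤ → E →L[ℂ] E} (h : IsGradingProj gr p) {T : Set ℤ} {g : G}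
    (hg : g ∈ expSubgroup G (gradeSum gr T)) : S g ∈ expSubgroup G (gradeSum gr (-T)) :=
  map_expSubgroup S.toMonoidHom (autDiff E S) hS.apply_expG
    (fun _ hx => hS.autDiff_mem_gradeSum h hx) hg

theorem map_mem_zero {p : ℤ → E →L[ℂ] E} (h : IsGradingProj gr p) {g : G}
    (hg : g ∈ expSubgroup G (gr 0)) : S g ∈ expSubgroup G (gr 0) := by
  rw [← h.gradeSum_singleton] at hg ⊢
  simpa using hS.map_mem h hg

/-- Put ψ = φ⁻¹S(φ). Equality of the cosets says ψ ∈ B̃₊; applying S and using S(ψ) = ψ⁻¹ gives ψ ∈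
B̃₋ as well, and B̃₊ ∩ B̃₋ = H̃. -/
theorem realityCondition_iff [ConnectedSpace G] {p : ℤ → E →L[ℂ] E} {h₀ : E}
    (h : IsLieGrading G gr p h₀) {M : Type*} (φ : M → G) :
    RealityCondition hS φ ↔ ∀ q, (φ q)⁻¹ * S (φ q) ∈ expSubgroup G (gr 0) := by
  have h1 : RealityCondition hS φ ↔ ∀ q, (S (φ q))⁻¹ * φ q ∈ expSubgroup G (gradeSum gr (Ici 0)) := by
    refine funext_iff.trans (forall_congr' fun q => ?_)
    exact QuotientGroup.eq (s := BPlus (E := E) gr) (a := S (φ q)) (b := φ q)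
  rw [h1]
  refine forall_congr' fun q => ?_
  have h2 : (S (φ q))⁻¹ * φ q = ((φ q)⁻¹ * S (φ q))⁻¹ := by group
  rw [h2, inv_mem_iff]
  refine ⟨fun hq => h.mem_of_mem_of_mem ?_ hq,
    fun hq => expSubgroup_mono (h.grade_zero_le (by simp)) hq⟩
  have h3 := hS.map_mem h.toIsGradingProj hq
  rw [neg_Ici, neg_zero, map_mul, map_inv, hS.apply_apply, h2, inv_mem_iff] at h3
  exact h3

end IsCompatible

theorem contMDiff_inv_mul {F : Type*} [NormedAddCommGroup F] [NormedSpace ℝ F]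
    {X : Type*} [TopologicalSpace X] [ChartedSpace F X] {f f' : X → G} {s : Set X}
    (hf : ContMDiffOn 𝓘(ℝ, F) 𝓘(ℝ, E) ∞ f s) (hf' : ContMDiffOn 𝓘(ℝ, F) 𝓘(ℝ, E) ∞ f' s) :
    ContMDiffOn 𝓘(ℝ, F) 𝓘(ℝ, E) ∞ (fun q => (f q)⁻¹ * f' q) s := by
  have : LieGroup 𝓘(ℝ, E) ∞ G := LieGroup.of_le (n := ω) (by simp)
  exact hf.inv.mul hf'

end Compatible

/-- The derivative of a map with values in a closed subspace takes values in that subspace. -/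
theorem hasFDerivAt_apply_mem {F V : Type*} [NormedAddCommGroup F] [NormedSpace ℝ F]
    [NormedAddCommGroup V] [NormedSpace ℝ V] {W : Submodule ℝ V} (hW : IsClosed (W : Set V))
    {f : F → V} {f' : F →L[ℝ] V} {x : F} (hf : HasFDerivAt f f' x)
    (hmem : ∀ᶠ y in 𝓝 x, f y ∈ W) (v : F) : f' v ∈ W := by
  have hline : HasDerivAt (fun t : ℝ => x + t • v) v 0 := by
    simpa using ((hasDerivAt_id (0 : ℝ)).smul_const v).const_add x
  have hx : x + (0 : ℝ) • v = x := by simp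
  have h1 : HasDerivAt (f ∘ fun t : ℝ => x + t • v) (f' v) 0 :=
    HasFDerivAt.comp_hasDerivAt (0 : ℝ) (by rwa [hx]) hline
  rw [hasDerivAt_iff_tendsto_slope] at h1
  have h2 : ∀ᶠ t in 𝓝 (0 : ℝ), f (x + t • v) ∈ W := by
    refine hline.continuousAt.eventually (p := fun y => f y ∈ W) ?_
    change ∀ᶠ y in 𝓝 (x + (0 : ℝ) • v), f y ∈ W
    rwa [hx]
  refine hW.mem_of_tendsto h1 (h2.filter_mono nhdsWithin_le_nhds |>.mono fun t ht => ?_)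
  rw [slope_def_module]
  refine W.smul_mem _ (W.sub_mem ht ?_)
  change f (x + (0 : ℝ) • v) ∈ W
  rw [hx]; exact hmem.self_of_nhds

/-! ### Product rule, graded values and the Maurer-Cartan equation -/

section Calculus

variable {E : Type*} [NormedAddCommGroup E] [NormedSpace ℂ E] [FiniteDimensional ℂ E]
  {G : Type*} [TopologicalSpace G] [ChartedSpace E G] [Group G] [LieGroup 𝓘(ℂ, E) ω G]
  {F : Type*} [NormedAddCommGroup F] [NormedSpace ℝ F]

theorem hasFDerivAt_AdL_inv_mul {f : F → G} {q : F}
    (hf : MDifferentiableAt 𝓘(ℝ, F) 𝓘(ℝ, E) f q) :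
    HasFDerivAt (fun x => AdL E G ((f q)⁻¹ * f x))
      (((adL E G).restrictScalars ℝ).comp (logDeriv E f q)) q := by
  have h1 := ((ContinuousLinearMap.mul ℂ (E →L[ℂ] E) (AdL E G (f q)⁻¹)).restrictScalars
    ℝ).hasFDerivAt.comp q (hasFDerivAt_AdL_comp hf)
  refine (h1.congr_of_eventuallyEq (Eventually.of_forall fun x => ?_)).congr_fderiv ?_
  · simp
  · ext v : 1
    change AdL E G (f q)⁻¹ * (AdL E G (f q) * adL E G (logDeriv E f q v)) = _
    rw [← mul_assoc, AdL_inv_mul, one_mul]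
    rfl

theorem adL_adL (x y : E) : adL E G (adL E G x y) =
    adL E G x * adL E G y - adL E G y * adL E G x := by
  ext z
  have h1 := lie_lie (L := GroupLieAlgebra 𝓘(ℂ, E) G) (M := GroupLieAlgebra 𝓘(ℂ, E) G) x y z
  change adL E G (adL E G x y) z = adL E G x (adL E G y z) - adL E G y (adL E G x z)
  simp only [adL_apply]
  exact h1

theorem logDeriv_congr {f f' : F → G} {q : F} (h : f =ᶠ[𝓝 q] f') :
    logDeriv E f q = logDeriv E f' q := by
  unfold logDeriv
  rw [h.self_of_nhds]
  exact Filter.EventuallyEq.mfderiv_eq (h.mono fun x hx => by simp only [hx])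

theorem logDeriv_const (g : G) (q : F) : logDeriv E (fun _ : F => g) q = 0 := mfderiv_const

theorem mdifferentiableAt_mul {f k : F → G} {q : F}
    (hf : MDifferentiableAt 𝓘(ℝ, F) 𝓘(ℝ, E) f q) (hk : MDifferentiableAt 𝓘(ℝ, F) 𝓘(ℝ, E) k q) :
    MDifferentiableAt 𝓘(ℝ, F) 𝓘(ℝ, E) (fun x => f x * k x) q :=
  ((contMDiff_mul 𝓘(ℝ, E) ω).mdifferentiableAt (x := (f q, k q)) (by simp)).comp q (hf.prodMk hk)

theorem mdifferentiableAt_inv {f : F → G} {q : F}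
    (hf : MDifferentiableAt 𝓘(ℝ, F) 𝓘(ℝ, E) f q) :
    MDifferentiableAt 𝓘(ℝ, F) 𝓘(ℝ, E) (fun x => (f x)⁻¹) q :=
  ((contMDiff_inv 𝓘(ℝ, E) ω).mdifferentiableAt (x := f q) (by simp)).comp q hf

variable [LieAlgebra.IsSemisimple ℂ (GroupLieAlgebra 𝓘(ℂ, E) G)]

/-- After applying ad this is the Leibniz rule for Ad(f) Ad(k), the first term being conjugated by
Ad(k)⁻¹. -/
theorem logDeriv_mul {f k : F → G} {q : F}
    (hf : MDifferentiableAt 𝓘(ℝ, F) 𝓘(ℝ, E) f q) (hk : MDifferentiableAt 𝓘(ℝ, F) 𝓘(ℝ, E) k q)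
    (v : F) : logDeriv E (fun x => f x * k x) q v =
      AdL E G (k q)⁻¹ (logDeriv E f q v) + logDeriv E k q v := by
  refine adL_injective E G ?_
  rw [map_add, adL_AdL, inv_inv, adL_logDeriv (mdifferentiableAt_mul hf hk)]
  have h1 : fderiv ℝ (fun x => AdL E G (f x * k x)) q v =
      AdL E G (f q) * (AdL E G (k q) * adL E G (logDeriv E k q v)) +
        AdL E G (f q) * adL E G (logDeriv E f q v) * AdL E G (k q) := by
    have h2 := (hasFDerivAt_AdL_comp hf).mul' (hasFDerivAt_AdL_comp hk)
    have h3 : (fun x => AdL E G (f x * k x)) = (fun x => AdL E G (f x)) * fun x => AdL E G (k x) := by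
      ext x; simp
    rw [h3, h2.fderiv]
    rfl
  rw [h1, mul_inv_rev, map_mul, mul_add, add_comm]
  congr 1
  · simp only [mul_assoc]
    rw [← mul_assoc (AdL E G (f q)⁻¹), AdL_inv_mul, one_mul]
  · simp only [mul_assoc]
    rw [← mul_assoc (AdL E G (f q)⁻¹), AdL_inv_mul, one_mul, ← mul_assoc, AdL_inv_mul, one_mul]

theorem logDeriv_inv {f : F → G} {q : F} (hf : MDifferentiableAt 𝓘(ℝ, F) 𝓘(ℝ, E) f q) (v : F) :
    logDeriv E (fun x => (f x)⁻¹) q v = -AdL E G (f q) (logDeriv E f q v) := by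
  have h1 := logDeriv_mul hf (mdifferentiableAt_inv hf) v
  simp only [mul_inv_cancel, inv_inv] at h1
  rw [logDeriv_const] at h1
  exact (neg_eq_of_add_eq_zero_right h1.symm).symm

/-- No manifold structure on the subgroup is needed: Ad(f(q)⁻¹f(x)) - 1 stays in a closed subspace
of operators, so its derivative at q, which is ad of the logarithmic derivative, stays there too and
reveals the degrees. -/
theorem logDeriv_mem {gr : ℤ → Submodule ℂ E} {p : ℤ → E →L[ℂ] E} {h₀ : E}
    (h : IsLieGrading G gr p h₀) {S : Set ℤ} (hS : ∀ a ∈ S, ∀ b ∈ S, a + b ∈ S) {f : F → G} {q : F}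
    (hf : MDifferentiableAt 𝓘(ℝ, F) 𝓘(ℝ, E) f q) {g : G}
    (hmem : ∀ᶠ x in 𝓝 q, g⁻¹ * f x ∈ expSubgroup G (gradeSum gr S)) (v : F) :
    logDeriv E f q v ∈ gradeSum gr S := by
  refine h.mem_gradeSum_of_br h.adL_mem (adL_injective E G) ?_
  have h1 := (hasFDerivAt_AdL_inv_mul hf).sub_const (1 : E →L[ℂ] E)
  refine hasFDerivAt_apply_mem (W := (gradeEnd gr p S).restrictScalars ℝ)
    (gradeEnd gr p S).closed_of_finiteDimensional h1 (hmem.mono fun x hx => ?_) v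
  refine h.AdL_sub_one_mem hS ?_
  have h2 : (f q)⁻¹ * f x = (g⁻¹ * f q)⁻¹ * (g⁻¹ * f x) := by group
  rw [h2]
  exact mul_mem (inv_mem hmem.self_of_nhds) hx

theorem logDeriv_mem_zero {gr : ℤ → Submodule ℂ E} {p : ℤ → E →L[ℂ] E} {h₀ : E}
    (h : IsLieGrading G gr p h₀) {f : F → G} {q : F}
    (hf : MDifferentiableAt 𝓘(ℝ, F) 𝓘(ℝ, E) f q)
    (hmem : ∀ᶠ x in 𝓝 q, f x ∈ expSubgroup G (gr 0)) (v : F) :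
    logDeriv E f q v ∈ gr 0 := by
  rw [← h.gradeSum_singleton] at hmem ⊢
  exact logDeriv_mem h (by simp) hf (g := 1) (by simpa using hmem) v

theorem logDeriv_eq_adLeftInv {f : F → G} {q : F}
    (hf : MDifferentiableAt 𝓘(ℝ, F) 𝓘(ℝ, E) f q) (v : F) :
    logDeriv E f q v =
      adLeftInv E G (AdL E G (f q)⁻¹ * fderiv ℝ (fun x => AdL E G (f x)) q v) := by
  rw [← adL_logDeriv hf, adLeftInv_adL]

theorem contDiffOn_AdL_comp {f : F → G} {s : Set F} (hf : ContMDiffOn 𝓘(ℝ, F) 𝓘(ℝ, E) ∞ f s) :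
    ContDiffOn ℝ ∞ (fun x => AdL E G (f x)) s :=
  ((contMDiff_AdL_real.of_le (by simp)).comp_contMDiffOn hf).contDiffOn

theorem contMDiffOn_inv {f : F → G} {s : Set F} (hf : ContMDiffOn 𝓘(ℝ, F) 𝓘(ℝ, E) ∞ f s) :
    ContMDiffOn 𝓘(ℝ, F) 𝓘(ℝ, E) ∞ (fun x => (f x)⁻¹) s :=
  ((contMDiff_inv 𝓘(ℝ, E) ω).of_le (by simp)).comp_contMDiffOn hf

theorem contDiffOn_logDeriv {f : F → G} {s : Set F} (hs : IsOpen s)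
    (hf : ContMDiffOn 𝓘(ℝ, F) 𝓘(ℝ, E) ∞ f s) (v : F) :
    ContDiffOn ℝ ∞ (fun q => logDeriv E f q v) s := by
  have h1 : ContDiffOn ℝ ∞ (fun q => fderiv ℝ (fun x => AdL E G (f x)) q v) s :=
    ((contDiffOn_AdL_comp hf).fderiv_of_isOpen hs (by simp)).clm_apply contDiffOn_const
  have h2 := ((contDiffOn_AdL_comp (contMDiffOn_inv hf)).mul h1)
  have h3 := ((adLeftInv E G).restrictScalars ℝ).contDiff.comp_contDiffOn h2
  refine h3.congr fun q hq => ?_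
  exact logDeriv_eq_adLeftInv ((hf.contMDiffAt (hs.mem_nhds hq)).mdifferentiableAt (by simp)) v

/-- The Maurer-Cartan equation. -/
theorem fderiv_logDeriv {f : F → G} {s : Set F} (hs : IsOpen s)
    (hf : ContMDiffOn 𝓘(ℝ, F) 𝓘(ℝ, E) ∞ f s) {q : F} (hq : q ∈ s) (v w : F) :
    fderiv ℝ (fun x => logDeriv E f x w) q v - fderiv ℝ (fun x => logDeriv E f x v) q w +
      adL E G (logDeriv E f q v) (logDeriv E f q w) = 0 := by
  have hfd : MDifferentiableAt 𝓘(ℝ, F) 𝓘(ℝ, E) f q :=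
    (hf.contMDiffAt (hs.mem_nhds hq)).mdifferentiableAt (by simp)
  have hA := contDiffOn_AdL_comp hf
  let a : F → F →L[ℝ] (E →L[ℂ] E) := fderiv ℝ (fun x => AdL E G (f x))
  have ha : DifferentiableAt ℝ a q :=
    ((hA.fderiv_of_isOpen hs (m := ∞) (by simp)).contDiffAt (hs.mem_nhds hq)).differentiableAt
      (by simp)
  have hsymm : fderiv ℝ a q v w = fderiv ℝ a q w v :=
    ((hA.contDiffAt (hs.mem_nhds hq)).isSymmSndFDerivAt
      (by simp only [minSmoothness_of_isRCLikeNormedField]; exact ENat.LEInfty.out)) v w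
  -- The derivative of ad ω(w) = Ad(f)⁻¹ ∂_w Ad(f) along v. The second derivative is symmetric in v
  -- and w, so antisymmetrizing leaves only a commutator, which is ad of the bracket.
  have key : ∀ v w, adL E G (fderiv ℝ (fun x => logDeriv E f x w) q v) =
      AdL E G (f q)⁻¹ * fderiv ℝ a q v w - adL E G (logDeriv E f q v) * adL E G (logDeriv E f q w) := by
    intro v w
    have h1 := ((adL E G).restrictScalars ℝ).hasFDerivAt.comp q
      (((contDiffOn_logDeriv hs hf w).contDiffAt (hs.mem_nhds hq)).differentiableAt
        (by simp)).hasFDerivAt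
    have h2 := (hasFDerivAt_AdL_comp (mdifferentiableAt_inv hfd)).mul'
      (ha.hasFDerivAt.clm_apply (hasFDerivAt_const w q))
    have h3 : (⇑((adL E G).restrictScalars ℝ) ∘ fun x => logDeriv E f x w) =ᶠ[𝓝 q]
        (fun x => AdL E G (f x)⁻¹) * fun x => a x w := by
      filter_upwards [hs.mem_nhds hq] with x hx
      exact adL_logDeriv ((hf.contMDiffAt (hs.mem_nhds hx)).mdifferentiableAt (by simp)) w
    have h4 := (h1.unique (h2.congr_of_eventuallyEq h3))
    have h5 := congrArg (fun L : F →L[ℝ] (E →L[ℂ] E) => L v) h4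
    have h6 : adL E G (logDeriv E (fun x => (f x)⁻¹) q v) =
        -(AdL E G (f q) * adL E G (logDeriv E f q v) * AdL E G (f q)⁻¹) := by
      rw [logDeriv_inv hfd, map_neg, adL_AdL]
    have h7 : adL E G (fderiv ℝ (fun x => logDeriv E f x w) q v) =
        AdL E G (f q)⁻¹ * (a q 0 + fderiv ℝ a q v w) +
        AdL E G (f q)⁻¹ * adL E G (logDeriv E (fun x => (f x)⁻¹) q v) * a q w := h5
    have h8 : AdL E G (f q)⁻¹ * a q w = adL E G (logDeriv E f q w) := (adL_logDeriv hfd w).symm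
    rw [h7, h6, map_zero, zero_add, sub_eq_add_neg, mul_neg, neg_mul, ← h8]
    congr 2
    simp only [← mul_assoc, AdL_inv_mul, one_mul]
  refine adL_injective E G ?_
  rw [map_add, map_sub, key v w, key w v, hsymm, map_zero, adL_adL]
  abel

end Calculus

/-! ### Slices transversal to an orbit of H̃ -/

section OrbitLift

variable {E : Type*} [NormedAddCommGroup E] [NormedSpace ℂ E] [FiniteDimensional ℂ E]
  {G : Type*} [TopologicalSpace G] [ChartedSpace E G] [Group G] [LieGroup 𝓘(ℂ, E) ω G]

/-- A linear projection to a sum of subspaces splits into projections to the summands. -/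
theorem exists_splitting_of_le_sup {A Z : Submodule ℂ E} {P : E →L[ℂ] E}
    (hP : ∀ x, P x ∈ A ⊔ Z) :
    ∃ pA pZ : E →L[ℂ] E, (∀ x, pA x ∈ A) ∧ (∀ x, pZ x ∈ Z) ∧ pA + pZ = P := by
  let s : (A × Z) →ₗ[ℂ] E := A.subtype.coprod Z.subtype
  have hs : ∀ x, P x ∈ LinearMap.range s := by
    intro x
    have h1 := hP x
    rw [Submodule.sup_eq_range] at h1
    exact h1
  obtain ⟨r, hr⟩ := s.rangeRestrict.exists_rightInverse_of_surjective s.range_rangeRestrict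
  let t : E →ₗ[ℂ] (A × Z) := r ∘ₗ (P : E →ₗ[ℂ] E).codRestrict (LinearMap.range s) hs
  refine ⟨LinearMap.toContinuousLinearMap (A.subtype ∘ₗ LinearMap.fst ℂ A Z ∘ₗ t),
    LinearMap.toContinuousLinearMap (Z.subtype ∘ₗ LinearMap.snd ℂ A Z ∘ₗ t),
    fun x => Subtype.mem _, fun x => Subtype.mem _, ?_⟩
  ext x
  have h1 := congrArg (fun T : LinearMap.range s →ₗ[ℂ] LinearMap.range s => (T ⟨P x, hs x⟩ : E)) hr
  exact h1

variable (E G) in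
theorem contDiff_exp_adL_complex : ContDiff ℂ ω (fun x : E => NormedSpace.exp (adL E G x)) := by
  have : CompleteSpace E := FiniteDimensional.complete ℂ E
  have h1 : ContDiff ℂ ω (NormedSpace.exp : (E →L[ℂ] E) → (E →L[ℂ] E)) :=
    contDiff_iff_contDiffAt.2 fun T => (NormedSpace.exp_analytic (𝕂 := ℂ) T).contDiffAt
  exact h1.comp (adL E G).contDiff

variable (E G) in
theorem hasFDerivAt_exp_adL_zero :
    HasFDerivAt (fun x : E => NormedSpace.exp (adL E G x)) (adL E G) 0 := by
  have : CompleteSpace E := FiniteDimensional.complete ℂ E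
  have h1 : HasFDerivAt (NormedSpace.exp : (E →L[ℂ] E) → (E →L[ℂ] E))
      (ContinuousLinearMap.id ℂ (E →L[ℂ] E)) (adL E G 0) := by
    rw [map_zero]
    exact hasFDerivAt_exp_zero
  exact h1.comp (0 : E) (adL E G).hasFDerivAt

/-- The map `(a, y) ↦ exp (ad a) (x + y)` is a local chart on a transversal pair of subspaces. -/
theorem exists_sliceChart {A K : Submodule ℂ E} {x : E}
    (hA : ∀ a ∈ A, adL E G a x = 0 → a = 0) (hK : IsCompl (A.map ((adL E G).flip x : E →ₗ[ℂ] E)) K) :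
    ∃ e : OpenPartialHomeomorph (A × K) E, (0, 0) ∈ e.source ∧
      (∀ v ∈ e.source, e v = NormedSpace.exp (adL E G v.1) (x + v.2)) ∧
      ∀ᶠ y in 𝓝 x, DifferentiableAt ℂ e.symm y := by
  have : CompleteSpace E := FiniteDimensional.complete ℂ E
  have : CompleteSpace A := FiniteDimensional.complete ℂ A
  have : CompleteSpace K := FiniteDimensional.complete ℂ K
  let f : A × K → E := fun v => NormedSpace.exp (adL E G v.1) (x + v.2)
  have hf : ContDiff ℂ ω f := by
    refine ContDiff.clm_apply ?_ ?_
    · exact (contDiff_exp_adL_complex E G).comp (A.subtypeL.contDiff.comp contDiff_fst)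
    · exact contDiff_const.add (K.subtypeL.contDiff.comp contDiff_snd)
  let L : (A × K) →ₗ[ℂ] E :=
    (((adL E G).flip x : E →ₗ[ℂ] E) ∘ₗ A.subtype).coprod K.subtype
  -- `L`, that is (a, y) ↦ [a, x] + y, is the derivative of `f` at 0; transversality makes it
  -- bijective.
  have hL : Function.Bijective L := by
    constructor
    · refine (injective_iff_map_eq_zero L).2 ?_
      rintro ⟨a, y⟩ hay
      have h1 : adL E G a x + y = 0 := hay
      have h2 : adL E G a x ∈ A.map ((adL E G).flip x : E →ₗ[ℂ] E) := ⟨a, a.2, rfl⟩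
      have h3 : adL E G a x ∈ K := by
        rw [eq_neg_of_add_eq_zero_left h1]; exact K.neg_mem y.2
      have h4 : adL E G a x = 0 := Submodule.disjoint_def.1 hK.disjoint _ h2 h3
      have h5 : a = 0 := Subtype.ext (hA a a.2 h4)
      have h6 : y = 0 := by
        rw [h4, zero_add] at h1
        exact Subtype.ext h1
      rw [h5, h6]; rfl
    · intro w
      have h1 : w ∈ A.map ((adL E G).flip x : E →ₗ[ℂ] E) ⊔ K := by
        rw [hK.sup_eq_top]; trivial
      obtain ⟨_, ⟨a, ha, rfl⟩, y, hy, rfl⟩ := Submodule.mem_sup.1 h1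
      exact ⟨(⟨a, ha⟩, ⟨y, hy⟩), rfl⟩
  let Le : (A × K) ≃L[ℂ] E := (LinearEquiv.ofBijective L hL).toContinuousLinearEquiv
  have hd : HasFDerivAt f (Le : (A × K) →L[ℂ] E) 0 := by
    have h1 : HasFDerivAt (fun v : A × K => NormedSpace.exp (adL E G v.1))
        ((adL E G).comp (A.subtypeL.comp (ContinuousLinearMap.fst ℂ A K))) 0 :=
      HasFDerivAt.comp (g := fun a : E => NormedSpace.exp (adL E G a))
        (f := A.subtypeL.comp (ContinuousLinearMap.fst ℂ A K)) (0 : A × K)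
        (by rw [map_zero]; exact hasFDerivAt_exp_adL_zero E G)
        (A.subtypeL.comp (ContinuousLinearMap.fst ℂ A K)).hasFDerivAt
    have h2 : HasFDerivAt (fun v : A × K => x + (v.2 : E))
        (K.subtypeL.comp (ContinuousLinearMap.snd ℂ A K)) 0 :=
      (K.subtypeL.comp (ContinuousLinearMap.snd ℂ A K)).hasFDerivAt.const_add x
    refine (h1.clm_apply h2).congr_fderiv ?_
    refine ContinuousLinearMap.ext fun v => ?_
    change NormedSpace.exp (adL E G (0 : E)) (v.2 : E) + adL E G v.1 (x + (0 : E)) =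
      adL E G v.1 x + v.2
    rw [map_zero, NormedSpace.exp_zero, add_zero, add_comm]
    rfl
  have hf0 : f 0 = x := by
    change NormedSpace.exp (adL E G (0 : E)) (x + (0 : E)) = x
    rw [map_zero, NormedSpace.exp_zero, add_zero]
    rfl
  have hsymm := hf.contDiffAt.to_localInverse hd (by simp)
  rw [hf0] at hsymm
  exact ⟨hf.contDiffAt.toOpenPartialHomeomorph f hd (by simp),
    hf.contDiffAt.mem_toOpenPartialHomeomorph_source hd (by simp), fun v _ => rfl,
    (hsymm.eventually (by simp)).mono fun y hy => hy.differentiableAt (by simp)⟩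

variable [LieAlgebra.IsSemisimple ℂ (GroupLieAlgebra 𝓘(ℂ, E) G)]

namespace IsLieGrading

variable {gr : ℤ → Submodule ℂ E} {p : ℤ → E →L[ℂ] E} {h₀ : E} (h : IsLieGrading G gr p h₀)
include h

/-- An operator preserving degrees commutes with ad h₀; hence Ad(g)h₀ and h₀ have the same image
under the injective map ad. -/
theorem AdL_gradingElement {g : G} (hg : AdL E G g ∈ gradeEnd gr p {0}) : AdL E G g h₀ = h₀ := by
  refine adL_injective E G ?_
  rw [adL_AdL]
  have h1 : AdL E G g * adL E G h₀ = adL E G h₀ * AdL E G g := by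
    ext x
    obtain ⟨s, hs⟩ := h.sum x
    rw [hs, map_sum, map_sum]
    refine Finset.sum_congr rfl fun m _ => ?_
    have h2 : AdL E G g (p m x) ∈ gr m := by
      rw [← h.gradeSum_singleton]
      refine h.apply_mem_gradeSum (S' := {m}) (by simp) hg ?_
      rw [h.gradeSum_singleton]
      exact h.mem m x
    change AdL E G g (adL E G h₀ (p m x)) = adL E G h₀ (AdL E G g (p m x))
    rw [h.adL_eq m _ (h.mem m x), h.adL_eq m _ h2, map_smul]
  rw [h1, mul_assoc, AdL_mul_inv, mul_one]

/-- Near the identity, only exponentials of elements of degree `0` preserve the gradation. -/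
theorem eventually_eq_zero : ∀ᶠ w in 𝓝 (0 : E), p 0 w = 0 →
    AdL E G (expG E G w) ∈ gradeEnd gr p {0} → w = 0 := by
  have : CompleteSpace E := FiniteDimensional.complete ℂ E
  -- If Ad(exp w) preserves degrees it fixes h₀, so with p₀w = 0 it follows that f(w) = h₀ = f(0).
  -- The derivative w ↦ [w, h₀] + p₀w at 0 is injective, as the bracket detects the nonzero degrees
  -- and p₀ the degree 0; so f does not return to f(0) near 0.
  let f : E → E := fun w => NormedSpace.exp (adL E G w) h₀ + p 0 w
  let f' : E →L[ℂ] E := (adL E G).flip h₀ + p 0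
  have hf : HasFDerivAt f f' 0 := by
    refine HasFDerivAt.add ?_ (p 0).hasFDerivAt
    exact ((ContinuousLinearMap.apply ℂ E h₀).hasFDerivAt.comp (0 : E)
      (hasFDerivAt_exp_adL_zero E G))
  have hskew : ∀ w, adL E G w h₀ = -adL E G h₀ w := by
    intro w
    rw [adL_apply, adL_apply]
    exact (lie_skew (L := GroupLieAlgebra 𝓘(ℂ, E) G) _ _).symm
  have hinj : Function.Injective f' := by
    refine (injective_iff_map_eq_zero f').2 fun w hw => h.eq_zero fun m => ?_
    have h2 : -adL E G h₀ w + p 0 w = 0 := by rw [← hskew]; exact hw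
    have h3 := congrArg (p m) h2
    rw [map_add, map_neg, h.proj_adL, map_zero] at h3
    by_cases hm : m = 0
    · subst hm
      rw [h.same 0 _ (h.mem 0 w)] at h3
      simpa using h3
    · rw [h.ne m 0 hm _ (h.mem 0 w), add_zero, neg_eq_zero] at h3
      exact (smul_eq_zero.1 h3).resolve_left (by exact_mod_cast hm)
  have hanti : ∃ C, AntilipschitzWith C f' := by
    obtain ⟨C, -, hC⟩ := (LinearMap.injective_iff_antilipschitz (f' : E →ₗ[ℂ] E)).1 hinj
    exact ⟨C, hC⟩
  have h1 := hf.eventually_ne hanti (c := h₀)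
  rw [eventually_nhdsWithin_iff] at h1
  filter_upwards [h1] with w hw hw0 hwA
  by_contra hne
  refine hw hne ?_
  change NormedSpace.exp (adL E G w) h₀ + p 0 w = h₀
  rw [hw0, add_zero, ← AdL_expG, h.AdL_gradingElement hwA]

end IsLieGrading

end OrbitLift

/-! ### Lifting holomorphic curves from an orbit to H̃ -/

section OrbitLiftGlobal

variable {E : Type*} [NormedAddCommGroup E] [NormedSpace ℂ E] [FiniteDimensional ℂ E]
  {G : Type*} [TopologicalSpace G] [ChartedSpace E G] [Group G] [LieGroup 𝓘(ℂ, E) ω G]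

variable (G) in
/-- The centralizer of `x` in the component of degree `0`. -/
def centralizerZero (gr : ℤ → Submodule ℂ E) (x : E) : Submodule ℂ E :=
  gr 0 ⊓ LinearMap.ker ((adL E G).flip x : E →ₗ[ℂ] E)

variable [LieAlgebra.IsSemisimple ℂ (GroupLieAlgebra 𝓘(ℂ, E) G)]

namespace IsLieGrading

variable {gr : ℤ → Submodule ℂ E} {p : ℤ → E →L[ℂ] E} {h₀ : E} (h : IsLieGrading G gr p h₀)
include h

/-- Ad(k) embeds one centralizer in the other. Thus a dimension bound at the base point of an orbit
holds at all its points. -/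
theorem finrank_centralizerZero_le {k : G} (hk : k ∈ expSubgroup G (gr 0)) (x : E) :
    Module.finrank ℂ (centralizerZero G gr x) ≤
      Module.finrank ℂ (centralizerZero G gr (AdL E G k x)) := by
  have hinj : Function.Injective (AdL E G k : E →ₗ[ℂ] E) := by
    intro y z hyz
    have h1 := congrArg (AdL E G k⁻¹) hyz
    exact (AdL_inv_apply k y).symm.trans (h1.trans (AdL_inv_apply k z))
  rw [(Submodule.equivMapOfInjective _ hinj (centralizerZero G gr x)).finrank_eq]
  refine Submodule.finrank_mono ?_
  rintro _ ⟨c, hc, rfl⟩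
  refine ⟨h.AdL_apply_mem hk hc.1, ?_⟩
  have h1 : adL E G c x = 0 := hc.2
  change adL E G (AdL E G k c) (AdL E G k x) = 0
  rw [← AdL_adL_apply, h1, map_zero]

/-- Two points of a slice that are conjugate by an element near the identity coincide. -/
theorem eventually_eq_of_AdL_eq {A K : Submodule ℂ E} {x z : E} (hA : A ≤ gr 0)
    (hAz : ∀ a ∈ A, adL E G a z = 0 → a = 0) (hfin : Module.finrank ℂ (gr 0) ≤
      Module.finrank ℂ A + Module.finrank ℂ (centralizerZero G gr z))
    {e : OpenPartialHomeomorph (A × K) E}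
    (he : ∀ v ∈ e.source, e v = NormedSpace.exp (adL E G v.1) (x + v.2))
    {y : K} (hy : (0, y) ∈ e.source) (hz : z = x + y) :
    ∀ᶠ u in 𝓝 (1 : G), u ∈ expSubgroup G (gr 0) → ∀ y' : K, (0, y') ∈ e.source →
      AdL E G u z = x + y' → y' = y := by
  -- `A` meets the centralizer of z trivially, and by `hfin` their dimensions add up to at least
  -- that of gr 0.
  have hsup : A ⊔ centralizerZero G gr z = gr 0 := by
    refine Submodule.eq_of_le_of_finrank_le (sup_le hA inf_le_left) ?_
    have h1 : A ⊓ centralizerZero G gr z = ⊥ := by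
      rw [Submodule.eq_bot_iff]
      exact fun a ha => hAz a ha.1 ha.2.2
    have h2 := Submodule.finrank_sup_add_finrank_inf_eq A (centralizerZero G gr z)
    rw [h1, finrank_bot, add_zero] at h2
    rw [h2]; exact hfin
  obtain ⟨pA, pZ, hpA, hpZ, hpAZ⟩ := exists_splitting_of_le_sup (A := A)
    (Z := centralizerZero G gr z) (P := p 0) (fun w => by rw [hsup]; exact h.mem 0 w)
  let pQ : E →L[ℂ] E := ContinuousLinearMap.id ℂ E - p 0
  obtain ⟨Φ, h0, hΦ, -, -⟩ := exists_productChart G (pA.restrictScalars ℝ) (pZ.restrictScalars ℝ)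
    (pQ.restrictScalars ℝ) (by
      refine ContinuousLinearMap.ext fun w => ?_
      have h1 := congrArg (fun T : E →L[ℂ] E => T w) hpAZ
      change pA w + pZ w + (w - p 0 w) = w
      rw [← h1]
      change pA w + pZ w + (w - (pA w + pZ w)) = w
      abel)
  have hΦ0 : Φ 0 = 1 := by rw [hΦ 0 h0]; simp [expG_zero]
  have htgt : (1 : G) ∈ Φ.target := by rw [← hΦ0]; exact Φ.map_source h0
  have hlim : Tendsto Φ.symm (𝓝 1) (𝓝 0) := by
    have h1 := Φ.continuousAt_symm htgt
    rw [ContinuousAt] at h1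
    have h2 : Φ.symm 1 = 0 := by rw [← hΦ0, Φ.left_inv h0]
    rwa [h2] at h1
  have hQ : ∀ᶠ v in 𝓝 (0 : E), AdL E G (expG E G (pQ v)) ∈ gradeEnd gr p {0} → pQ v = 0 := by
    have h1 : Tendsto pQ (𝓝 0) (𝓝 0) := by
      have := pQ.continuous.tendsto 0
      rwa [map_zero] at this
    filter_upwards [h1.eventually h.eventually_eq_zero] with v hv
    refine hv ?_
    change p 0 (v - p 0 v) = 0
    rw [map_sub, h.same 0 _ (h.mem 0 v), sub_self]
  have hsrc : ∀ᶠ v in 𝓝 (0 : E), ((⟨pA v, hpA v⟩ : A), y) ∈ e.source := by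
    have h1 : Continuous fun v : E => ((⟨pA v, hpA v⟩ : A), y) :=
      (pA.continuous.subtype_mk hpA).prodMk continuous_const
    refine h1.continuousAt.eventually_mem (e.open_source.mem_nhds ?_)
    have h2 : (⟨pA 0, hpA 0⟩ : A) = 0 := Subtype.ext (map_zero pA)
    rw [h2]; exact hy
  filter_upwards [Φ.open_target.mem_nhds htgt, hlim.eventually hQ, hlim.eventually hsrc]
    with u hu hQu hsu huH y' hy' huz
  set v := Φ.symm u with hv
  -- The last factor lies in H̃ and has an exponent without degree 0 part, so it is 1; the middle
  -- factor fixes z. Hence Ad(u)z is the image of (pA v, y) in the slice chart as well as that of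
  -- (0, y'), and the chart is injective.
  have hueq : u = expG E G (pA v) * expG E G (pZ v) * expG E G (pQ v) := by
    have h1 := hΦ v (Φ.map_target hu)
    rwa [Φ.right_inv hu] at h1
  have hpAH : expG E G (pA v) ∈ expSubgroup G (gr 0) := expG_mem_expSubgroup (hA (hpA v))
  have hpZH : expG E G (pZ v) ∈ expSubgroup G (gr 0) := expG_mem_expSubgroup (hpZ v).1
  have hQ0 : pQ v = 0 := by
    refine hQu (h.AdL_mem_gradeEnd_singleton ?_)
    have h1 : expG E G (pQ v) = (expG E G (pA v) * expG E G (pZ v))⁻¹ * u := by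
      rw [hueq]; group
    rw [h1]
    exact mul_mem (inv_mem (mul_mem hpAH hpZH)) huH
  have hZz : AdL E G (expG E G (pZ v)) z = z := by
    have h1 : adL E G (pZ v) z = (0 : ℂ) • z := by
      rw [zero_smul]; exact (hpZ v).2
    rw [AdL_expG, exp_apply_of_eq_smul h1]
    simp
  have h1 : AdL E G u z = NormedSpace.exp (adL E G (pA v)) z := by
    rw [hueq, hQ0, expG_zero, mul_one, map_mul]
    change AdL E G _ (AdL E G _ z) = _
    rw [hZz, AdL_expG]
  have h2 : e (⟨pA v, hpA v⟩, y) = e (0, y') := by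
    rw [he _ hsu, he _ hy', ← hz]
    change NormedSpace.exp (adL E G (pA v)) z = NormedSpace.exp (adL E G (0 : E)) (x + y')
    rw [← h1, huz, map_zero, NormedSpace.exp_zero]
    rfl
  exact (congrArg Prod.snd (e.injOn hsu hy' h2)).symm

/-- An orbit of the subgroup of degree `0` meets a transversal slice in a countable set. -/
theorem countable_slice [ConnectedSpace G] {A K : Submodule ℂ E} {x : E} (hA : A ≤ gr 0)
    (hfin : Module.finrank ℂ (gr 0) ≤
      Module.finrank ℂ A + Module.finrank ℂ (centralizerZero G gr x))
    {e : OpenPartialHomeomorph (A × K) E}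
    (he : ∀ v ∈ e.source, e v = NormedSpace.exp (adL E G v.1) (x + v.2)) :
    {y : K | (0, y) ∈ e.source ∧ (∀ a ∈ A, adL E G a (x + y) = 0 → a = 0) ∧
      ∃ k ∈ expSubgroup G (gr 0), AdL E G k x = x + y}.Countable := by
  have : SecondCountableTopology G := secondCountable_of_lieGroup (E := E) G
  have : IsTopologicalGroup G := topologicalGroup_of_lieGroup 𝓘(ℂ, E) ω
  let T : Set G := {k | k ∈ expSubgroup G (gr 0) ∧ ∃ y : K, (0, y) ∈ e.source ∧
    (∀ a ∈ A, adL E G a (x + y) = 0 → a = 0) ∧ AdL E G k x = x + y}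
  choose! Y hY using fun (k : G) (hk : k ∈ T) => hk.2
  -- The slice coordinate is locally constant on `T`: k' near k differs from it by an element k'k⁻¹
  -- near 1, which moves one slice point to another.
  have hloc : ∀ k ∈ T, {k' | ∀ y' : K, (0, y') ∈ e.source → AdL E G k' x = x + y' → y' = Y k} ∈
      𝓝[T] k := by
    intro k hk
    obtain ⟨h1, h2, h3⟩ := hY k hk
    have h4 := h.eventually_eq_of_AdL_eq hA h2 (hfin.trans (by
      rw [← h3]; gcongr; exact h.finrank_centralizerZero_le hk.1 x)) he h1 rfl
    have h5 : Tendsto (fun k' => k' * k⁻¹) (𝓝 k) (𝓝 1) := by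
      have : Continuous fun k' : G => k' * k⁻¹ := continuous_id.mul continuous_const
      have h6 := this.tendsto k
      rwa [mul_inv_cancel] at h6
    rw [mem_nhdsWithin_iff_eventually]
    filter_upwards [h5.eventually h4] with k' hk' hk'T y' hy' hy'x
    refine hk' (mul_mem hk'T.1 (inv_mem hk.1)) y' hy' ?_
    rw [← h3, ← hy'x]
    change (AdL E G (k' * k⁻¹) * AdL E G k) x = _
    rw [← map_mul, inv_mul_cancel_right]
  -- Second countability of `G` makes countably many of these neighbourhoods cover `T`. H̃ is not
  -- assumed to be closed, so an orbit may well return to the slice infinitely often.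
  obtain ⟨t, -, htc, hcov⟩ := TopologicalSpace.countable_cover_nhdsWithin hloc
  refine (htc.image Y).mono ?_
  rintro y ⟨hy1, hy2, k, hk, hky⟩
  obtain ⟨k₀, hk₀, hk₀'⟩ := mem_iUnion₂.1 (hcov ⟨hk, y, hy1, hy2, hky⟩)
  exact ⟨k₀, hk₀, (hk₀' y hy1 hky).symm⟩

/-- A holomorphic curve in an orbit of the subgroup of degree `0` lifts locally. -/
theorem exists_orbit_lift [ConnectedSpace G] {Λ : ℂ → E} {q₀ : ℂ}
    (hΛ : ∀ᶠ q in 𝓝 q₀, DifferentiableAt ℂ Λ q)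
    (horb : ∀ᶠ q in 𝓝 q₀, ∃ k ∈ expSubgroup G (gr 0), Λ q = AdL E G k (Λ q₀)) :
    ∃ a : ℂ → E, (∀ q, a q ∈ gr 0) ∧ a q₀ = 0 ∧
      ∀ᶠ q in 𝓝 q₀, DifferentiableAt ℂ a q ∧ Λ q = AdL E G (expG E G (a q)) (Λ q₀) := by
  set x := Λ q₀ with hx
  obtain ⟨C, hC⟩ := Submodule.exists_isCompl (centralizerZero G gr x)
  -- A complement in gr 0 of the centralizer of x, so that a ↦ [a, x] maps it isomorphically onto
  -- [gr 0, x].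
  let A : Submodule ℂ E := C ⊓ gr 0
  have hAle : A ≤ gr 0 := inf_le_right
  have hAx : ∀ a ∈ A, adL E G a x = 0 → a = 0 := fun a ha hax =>
    Submodule.disjoint_def.1 hC.disjoint a ⟨ha.2, hax⟩ ha.1
  have hsup : centralizerZero G gr x ⊔ A = gr 0 := by
    have hle : centralizerZero G gr x ≤ gr 0 := inf_le_left
    have h1 := sup_inf_assoc_of_le C hle
    rw [hC.sup_eq_top, top_inf_eq] at h1
    exact h1.symm
  have hfin : Module.finrank ℂ (gr 0) ≤
      Module.finrank ℂ A + Module.finrank ℂ (centralizerZero G gr x) := by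
    rw [← hsup, add_comm]
    exact Submodule.finrank_add_le_finrank_add_finrank _ _
  obtain ⟨K, hK⟩ := Submodule.exists_isCompl (A.map ((adL E G).flip x : E →ₗ[ℂ] E))
  obtain ⟨e, he0, he, hesymm⟩ := exists_sliceChart hAx hK
  have hcount := h.countable_slice hAle hfin he
  have hex : e (0, 0) = x := by
    rw [he _ he0]
    change NormedSpace.exp (adL E G (0 : E)) (x + (0 : E)) = x
    rw [map_zero, NormedSpace.exp_zero, add_zero]
    rfl
  have hesx : e.symm x = (0, 0) := by rw [← hex, e.left_inv he0]
  have hxt : x ∈ e.target := by rw [← hex]; exact e.map_source he0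
  have hinj : ∀ᶠ y : K in 𝓝 0, ∀ a ∈ A, adL E G a (x + y) = 0 → a = 0 := by
    have hc : Continuous fun y : K => ((adL E G).flip (x + y)).comp A.subtypeL := by fun_prop
    have h1 : IsOpen {T : A →L[ℂ] E | Function.Injective T} := ContinuousLinearMap.isOpen_injective
    have h2 : ∀ᶠ y : K in 𝓝 0, Function.Injective (((adL E G).flip (x + y)).comp A.subtypeL) := by
      refine hc.continuousAt.eventually_mem (h1.mem_nhds ?_)
      refine (injective_iff_map_eq_zero _).2 fun a ha => Subtype.ext (hAx a a.2 ?_)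
      have h3 : adL E G a (x + (0 : E)) = 0 := ha
      rwa [add_zero] at h3
    filter_upwards [h2] with y hy a ha hay
    exact congrArg Subtype.val (hy (a₁ := ⟨a, ha⟩) (a₂ := 0) (hay.trans (map_zero _).symm))
  have hΛc : ContinuousAt Λ q₀ := hΛ.self_of_nhds.continuousAt
  have hsc : ContinuousAt e.symm x := e.continuousAt_symm hxt
  have hsΛ : Tendsto (fun q => e.symm (Λ q)) (𝓝 q₀) (𝓝 (0, 0)) := by
    have h1 := hsc.comp_of_eq hΛc hx.symm
    rw [ContinuousAt] at h1
    simpa only [Function.comp_def, ← hx, hesx] using h1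
  have hev : ∀ᶠ q in 𝓝 q₀, DifferentiableAt ℂ (fun q => e.symm (Λ q)) q ∧ Λ q ∈ e.target ∧
      (0, (e.symm (Λ q)).2) ∈ e.source ∧
      (∀ a ∈ A, adL E G a (x + (e.symm (Λ q)).2) = 0 → a = 0) ∧
      ∃ k ∈ expSubgroup G (gr 0), Λ q = AdL E G k x := by
    have h2 : Tendsto (fun q => (e.symm (Λ q)).2) (𝓝 q₀) (𝓝 0) :=
      (continuous_snd.tendsto _).comp hsΛ
    have h3 : ∀ᶠ y in 𝓝 (0 : K), ((0 : A), y) ∈ e.source :=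
      (Continuous.prodMk_right (0 : A)).continuousAt.eventually_mem (e.open_source.mem_nhds he0)
    filter_upwards [hΛ, hΛc.eventually hesymm, hΛc.eventually_mem (e.open_target.mem_nhds hxt),
      h2.eventually h3, h2.eventually hinj, horb] with q h4 h5 h6 h7 h8 h9
    exact ⟨h5.comp q h4, h6, h7, h8, h9⟩
  obtain ⟨r, hr, hball⟩ := Metric.eventually_nhds_iff_ball.1 hev
  have hval : ∀ q ∈ Metric.ball q₀ r,
      Λ q = AdL E G (expG E G (e.symm (Λ q)).1) (x + (e.symm (Λ q)).2) := by
    intro q hq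
    have h1 := he _ (e.map_target (hball q hq).2.1)
    rw [e.right_inv (hball q hq).2.1] at h1
    rw [AdL_expG]; exact h1
  -- Undoing exp(ad a) moves Λ(q) into the slice without leaving the orbit, so its slice coordinate
  -- lies in the countable set.
  have hmaps : MapsTo (fun q => (e.symm (Λ q)).2) (Metric.ball q₀ r) _ := fun q hq => by
    refine (show (e.symm (Λ q)).2 ∈ {y : K | (0, y) ∈ e.source ∧
      (∀ a ∈ A, adL E G a (x + y) = 0 → a = 0) ∧
      ∃ k ∈ expSubgroup G (gr 0), AdL E G k x = x + y} from ?_)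
    obtain ⟨-, -, h1, h2, k, hk, hkΛ⟩ := hball q hq
    refine ⟨h1, h2, (expG E G (e.symm (Λ q)).1)⁻¹ * k,
      mul_mem (inv_mem (expG_mem_expSubgroup (hAle (Subtype.mem _)))) hk, ?_⟩
    rw [map_mul]
    change AdL E G _ (AdL E G k x) = _
    rw [← hkΛ]
    exact (congrArg _ (hval q hq)).trans (AdL_inv_apply _ _)
  have hcont : ContinuousOn (fun q => (e.symm (Λ q)).2) (Metric.ball q₀ r) := fun q hq =>
    (continuous_snd.continuousAt.comp (hball q hq).1.continuousAt).continuousWithinAt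
  -- A connected subset of a countable set is at most a point.
  have hconst : ∀ q ∈ Metric.ball q₀ r, (e.symm (Λ q)).2 = 0 := by
    intro q hq
    have h1 : ((fun q => (e.symm (Λ q)).2) '' Metric.ball q₀ r).Subsingleton :=
      hcount.isTotallyDisconnected _ hmaps.image_subset
        ((convex_ball q₀ r).isPreconnected.image _ hcont)
    have h2 := h1 ⟨q, hq, rfl⟩ ⟨q₀, Metric.mem_ball_self hr, rfl⟩
    refine h2.trans ?_
    change (e.symm (Λ q₀)).2 = 0
    rw [← hx, hesx]
  refine ⟨fun q => (e.symm (Λ q)).1, fun q => hAle (Subtype.mem _), ?_, ?_⟩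
  · change ((e.symm (Λ q₀)).1 : E) = 0
    rw [← hx, hesx]; rfl
  · filter_upwards [Metric.ball_mem_nhds q₀ hr] with q hq
    refine ⟨?_, ?_⟩
    · exact (A.subtypeL.comp (ContinuousLinearMap.fst ℂ A K)).differentiableAt.comp q (hball q hq).1
    · have h1 := hval q hq
      rw [hconst q hq] at h1
      change Λ q = AdL E G _ (x + (0 : E)) at h1
      rwa [add_zero] at h1

end IsLieGrading

end OrbitLiftGlobal

/-! ### Wirtinger derivatives -/

section Wirtinger

variable {V : Type*} [NormedAddCommGroup V] [NormedSpace ℂ V]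

/-- The Wirtinger derivative `(∂_x + c ∂_y) / 2`: it is `∂_z` for `c = -√-1` and `∂_{z̄}` for
`c = √-1`. -/
def wirtinger (c : ℂ) (f : ℂ → V) (q : ℂ) : V :=
  (1 / 2 : ℂ) • (fderiv ℝ f q 1 + c • fderiv ℝ f q Complex.I)

theorem wirtinger_congr (c : ℂ) {f f' : ℂ → V} {q : ℂ} (h : f =ᶠ[𝓝 q] f') :
    wirtinger c f q = wirtinger c f' q := by
  unfold wirtinger
  rw [h.fderiv_eq]

theorem apply_I_eq_of_half_smul_eq_zero {x y c : V} {d : ℂ} (hd : d * d = -1)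
    (h : (1 / 2 : ℂ) • (x + d • y) = c) (hc : c = 0) : y = d • x := by
  rw [hc] at h
  have h1 : x + d • y = 0 := (smul_eq_zero.1 h).resolve_left (by norm_num)
  rw [eq_neg_of_add_eq_zero_left h1, smul_neg, smul_smul, hd, neg_smul, one_smul, neg_neg]

theorem apply_mul_I_of_apply_I {L : ℂ →L[ℝ] V} {d : ℂ} (hd : d * d = -1)
    (h : L Complex.I = d • L 1) (v : ℂ) : L (Complex.I * v) = d • L v := by
  have h1 : ∀ v : ℂ, L v = (v.re : ℂ) • L 1 + (v.im : ℂ) • L Complex.I := by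
    intro v
    have h2 : v = v.re • (1 : ℂ) + v.im • Complex.I := by
      simp
    conv_lhs => rw [h2]
    rw [map_add, map_smul, map_smul, Complex.coe_smul, Complex.coe_smul]
  rw [h1 (Complex.I * v), h1 v, h]
  simp only [smul_add, smul_smul, Complex.mul_re, Complex.mul_im, Complex.I_re, Complex.I_im,
    zero_mul, one_mul, zero_sub, zero_add, Complex.ofReal_neg]
  rw [show d * ((v.im : ℂ) * d) = (v.im : ℂ) * (d * d) by ring, hd, mul_comm d]
  simp only [mul_neg, mul_one, neg_smul]
  abel

end Wirtinger

/-! ### The (1,0)- and (0,1)-components of the connection of a map from ℂ -/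

section Connection

variable {E : Type*} [NormedAddCommGroup E] [NormedSpace ℂ E] [FiniteDimensional ℂ E]
  {G : Type*} [TopologicalSpace G] [ChartedSpace E G] [Group G] [LieGroup 𝓘(ℂ, E) ω G]

variable (E) in
/-- The component `(ω(∂_x) + c ω(∂_y)) / 2` of the logarithmic derivative `ω` of a map from the
complex line: it is the (1,0)-component for `c = -√-1` and the (0,1)-component for `c = √-1`. -/
def conn (c : ℂ) (f : ℂ → G) (q : ℂ) : E :=
  (1 / 2 : ℂ) • (logDeriv E f q 1 + c • logDeriv E f q Complex.I)

theorem conn_congr (c : ℂ) {f f' : ℂ → G} {q : ℂ} (h : f =ᶠ[𝓝 q] f') :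
    conn E c f q = conn E c f' q := by
  unfold conn
  rw [logDeriv_congr h]

theorem conn_const (c : ℂ) (g : G) (q : ℂ) : conn E c (fun _ => g) q = 0 := by
  unfold conn
  rw [logDeriv_const]
  simp

theorem IsCompatible.conn_comp {gr : ℤ → Submodule ℂ E} {S : G ≃* G}
    (hS : IsCompatible (E := E) gr S) (c : ℂ) {f : ℂ → G} {q : ℂ}
    (hf : MDifferentiableAt 𝓘(ℝ, ℂ) 𝓘(ℝ, E) f q) :
    conn E c (fun x => S (f x)) q = autDiff E S (conn E (starRingEnd ℂ c) f q) := by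
  unfold conn
  rw [hS.logDeriv_comp hf, hS.autDiff_smul, map_add, hS.autDiff_smul, Complex.conj_conj,
    show starRingEnd ℂ (1 / 2) = 1 / 2 by rw [map_div₀, map_one, map_ofNat]]
  rfl

/-- The differential of a map to `G` is the left translate of its logarithmic derivative, and left
translations are holomorphic. -/
theorem exists_rdiff_eq (f : ℂ → G) {q : ℂ} (hf : MDifferentiableAt 𝓘(ℝ, ℂ) 𝓘(ℝ, E) f q) :
    ∃ D : E →L[ℂ] E, ∀ v, rdiff ℂ E f q v = D (logDeriv E f q v) := by
  let D₀ : ℂ →L[ℝ] E := logDeriv E f q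
  have h1 : HasMFDerivAt 𝓘(ℝ, ℂ) 𝓘(ℝ, E) (fun x => (f q)⁻¹ * f x) q D₀ :=
    (mdifferentiableAt_inv_mul hf _).hasMFDerivAt
  let D : E →L[ℂ] E := mfderiv 𝓘(ℂ, E) 𝓘(ℂ, E) (fun x : G => f q * x) ((f q)⁻¹ * f q)
  have h2 : HasMFDerivAt 𝓘(ℂ, E) 𝓘(ℂ, E) (fun x : G => f q * x) ((f q)⁻¹ * f q) D :=
    ((contMDiff_mul_left (I := 𝓘(ℂ, E)) (n := ω) (a := f q)).mdifferentiableAt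
      (by simp)).hasMFDerivAt
  have h3 := HasMFDerivAt.comp q (hasMFDerivAt_restrictScalars h2) h1
  have h4 : (fun x : G => f q * x) ∘ (fun x => (f q)⁻¹ * f x) = f := by
    ext x; simp
  rw [h4] at h3
  exact ⟨D, fun v => congrArg (fun L : ℂ →L[ℝ] E => L v) h3.mfderiv⟩

theorem antiholomorphicOn_of_conn_eq_zero {f : ℂ → G} {s : Set ℂ} (hs : IsOpen s)
    (hf : ContMDiffOn 𝓘(ℝ, ℂ) 𝓘(ℝ, E) ∞ f s) (h : ∀ q ∈ s, conn E (-Complex.I) f q = 0) :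
    AntiholomorphicOn ℂ E f s := by
  refine ⟨hf, fun q hq v => ?_⟩
  obtain ⟨D, hD⟩ := exists_rdiff_eq f
    ((hf.contMDiffAt (hs.mem_nhds hq)).mdifferentiableAt (by simp))
  have h1 := apply_I_eq_of_half_smul_eq_zero (by simp) rfl (h q hq)
  have h2 := apply_mul_I_of_apply_I (by simp) h1 v
  rw [hD, hD, smul_eq_mul, h2]
  simp

theorem mdifferentiableOn_of_conn_eq_zero {f : ℂ → G} {s : Set ℂ} (hs : IsOpen s)
    (hf : ContMDiffOn 𝓘(ℝ, ℂ) 𝓘(ℝ, E) ∞ f s) (h : ∀ q ∈ s, conn E Complex.I f q = 0) :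
    MDifferentiableOn 𝓘(ℂ, ℂ) 𝓘(ℂ, E) f s := by
  intro q hq
  have hd := (hf.contMDiffAt (hs.mem_nhds hq)).mdifferentiableAt (by simp)
  obtain ⟨D, hD⟩ := exists_rdiff_eq f hd
  have h1 := apply_I_eq_of_half_smul_eq_zero (by simp) rfl (h q hq)
  refine (mdifferentiableAt_of_rdiff_smul hd fun v => ?_).mdifferentiableWithinAt
  rw [hD, hD, smul_eq_mul, apply_mul_I_of_apply_I (by simp) h1 v]
  simp

variable [LieAlgebra.IsSemisimple ℂ (GroupLieAlgebra 𝓘(ℂ, E) G)]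

theorem conn_mul (c : ℂ) {f k : ℂ → G} {q : ℂ}
    (hf : MDifferentiableAt 𝓘(ℝ, ℂ) 𝓘(ℝ, E) f q) (hk : MDifferentiableAt 𝓘(ℝ, ℂ) 𝓘(ℝ, E) k q) :
    conn E c (fun x => f x * k x) q = AdL E G (k q)⁻¹ (conn E c f q) + conn E c k q := by
  unfold conn
  rw [logDeriv_mul hf hk, logDeriv_mul hf hk]
  simp only [map_smul, map_add, smul_add]
  abel

theorem conn_mem {gr : ℤ → Submodule ℂ E} {p : ℤ → E →L[ℂ] E} {h₀ : E}
    (h : IsLieGrading G gr p h₀) {S : Set ℤ} (hS : ∀ a ∈ S, ∀ b ∈ S, a + b ∈ S) (c : ℂ)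
    {f : ℂ → G} {q : ℂ} (hf : MDifferentiableAt 𝓘(ℝ, ℂ) 𝓘(ℝ, E) f q) {g : G}
    (hmem : ∀ᶠ x in 𝓝 q, g⁻¹ * f x ∈ expSubgroup G (gradeSum gr S)) :
    conn E c f q ∈ gradeSum gr S :=
  Submodule.smul_mem _ _ (Submodule.add_mem _ (logDeriv_mem h hS hf hmem _)
    (Submodule.smul_mem _ _ (logDeriv_mem h hS hf hmem _)))

theorem conn_mem_zero {gr : ℤ → Submodule ℂ E} {p : ℤ → E →L[ℂ] E} {h₀ : E}
    (h : IsLieGrading G gr p h₀) (c : ℂ)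
    {f : ℂ → G} {q : ℂ} (hf : MDifferentiableAt 𝓘(ℝ, ℂ) 𝓘(ℝ, E) f q)
    (hmem : ∀ᶠ x in 𝓝 q, f x ∈ expSubgroup G (gr 0)) : conn E c f q ∈ gr 0 :=
  Submodule.smul_mem _ _ (Submodule.add_mem _ (logDeriv_mem_zero h hf hmem _)
    (Submodule.smul_mem _ _ (logDeriv_mem_zero h hf hmem _)))

theorem contDiffOn_conn (c : ℂ) {f : ℂ → G} {s : Set ℂ} (hs : IsOpen s)
    (hf : ContMDiffOn 𝓘(ℝ, ℂ) 𝓘(ℝ, E) ∞ f s) : ContDiffOn ℝ ∞ (conn E c f) s := by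
  unfold conn
  exact ((contDiffOn_logDeriv hs hf 1).add ((contDiffOn_logDeriv hs hf Complex.I).const_smul
    c)).const_smul (1 / 2 : ℂ)

/-- The Maurer-Cartan equation in a complex coordinate. -/
theorem wirtinger_conn {f : ℂ → G} {s : Set ℂ} (hs : IsOpen s)
    (hf : ContMDiffOn 𝓘(ℝ, ℂ) 𝓘(ℝ, E) ∞ f s) {q : ℂ} (hq : q ∈ s) :
    wirtinger (-Complex.I) (conn E Complex.I f) q - wirtinger Complex.I (conn E (-Complex.I) f) q +
      adL E G (conn E (-Complex.I) f q) (conn E Complex.I f q) = 0 := by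
  have hd : ∀ v : ℂ, HasFDerivAt (fun x => logDeriv E f x v)
      (fderiv ℝ (fun x => logDeriv E f x v) q) q := fun v =>
    (((contDiffOn_logDeriv hs hf v).contDiffAt (hs.mem_nhds hq)).differentiableAt
      (by simp)).hasFDerivAt
  have hc : ∀ c : ℂ, fderiv ℝ (conn E c f) q = (1 / 2 : ℂ) •
      (fderiv ℝ (fun x => logDeriv E f x 1) q +
        c • fderiv ℝ (fun x => logDeriv E f x Complex.I) q) := fun c =>
    (((hd 1).add ((hd Complex.I).const_smul c)).const_smul (1 / 2 : ℂ)).fderiv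
  have hMC := fderiv_logDeriv hs hf hq 1 Complex.I
  have hskew : ∀ x y : E, adL E G x y = -adL E G y x := by
    intro x y
    rw [adL_apply, adL_apply]
    exact (lie_skew (L := GroupLieAlgebra 𝓘(ℂ, E) G) _ _).symm
  have hself : ∀ x : E, adL E G x x = 0 := by
    intro x
    rw [adL_apply]
    exact lie_self (L := GroupLieAlgebra 𝓘(ℂ, E) G) x
  unfold wirtinger
  rw [hc, hc]
  unfold conn
  generalize fderiv ℝ (fun x => logDeriv E f x 1) q = D1 at *
  generalize fderiv ℝ (fun x => logDeriv E f x Complex.I) q = D2 at *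
  generalize logDeriv E f q 1 = x at *
  generalize logDeriv E f q Complex.I = y at *
  have h1 : D2 1 = D1 Complex.I - adL E G x y := by
    rw [← sub_eq_zero, ← hMC]; abel
  simp only [smul_apply, add_apply, map_smul, map_add, smul_add, hself, hskew y x, h1]
  match_scalars <;> ring_nf

/-- The logarithmic derivative of the exponential of a map. -/
theorem adL_logDeriv_expG {b : ℂ → E} {q : ℂ} (hb : DifferentiableAt ℝ b q)
    (he : MDifferentiableAt 𝓘(ℝ, ℂ) 𝓘(ℝ, E) (fun x => expG E G (b x)) q) (v : ℂ) :
    adL E G (logDeriv E (fun x => expG E G (b x)) q v) = AdL E G (expG E G (b q))⁻¹ *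
      fderiv ℂ (fun x : E => NormedSpace.exp (adL E G x)) (b q) (fderiv ℝ b q v) := by
  have h1 : (fun x => AdL E G (expG E G (b x))) =
      (fun x : E => NormedSpace.exp (adL E G x)) ∘ b := by
    ext x; rw [AdL_expG]; rfl
  have h2 := (((contDiff_exp_adL_complex E G).differentiable (by simp)
    (b q)).hasFDerivAt.restrictScalars ℝ).comp q hb.hasFDerivAt
  rw [adL_logDeriv he, h1, h2.fderiv]
  rfl

/-- x ↦ exp(ad x) is complex analytic, so ad of the logarithmic derivative depends complex linearly
on the derivative of b; a relation between the two partial derivatives of b is inherited. Thus d =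
√-1 treats holomorphic b and d = -√-1 antiholomorphic b. -/
theorem conn_expG_eq_zero {b : ℂ → E} {q d : ℂ} (hd : d * d = -1) (hb : DifferentiableAt ℝ b q)
    (hbI : fderiv ℝ b q Complex.I = d • fderiv ℝ b q 1)
    (he : MDifferentiableAt 𝓘(ℝ, ℂ) 𝓘(ℝ, E) (fun x => expG E G (b x)) q) :
    conn E d (fun x => expG E G (b x)) q = 0 := by
  have h1 : logDeriv E (fun x => expG E G (b x)) q Complex.I =
      d • logDeriv E (fun x => expG E G (b x)) q 1 := by
    refine adL_injective E G ?_
    rw [map_smul, adL_logDeriv_expG hb he, adL_logDeriv_expG hb he, hbI, map_smul, mul_smul_comm]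
  unfold conn
  rw [h1, smul_smul, hd, neg_smul, one_smul, add_neg_cancel, smul_zero]

/-- An antiholomorphic curve in an orbit of the subgroup of degree `0` lifts locally. -/
theorem IsLieGrading.exists_antiholomorphic_lift [ConnectedSpace G] {gr : ℤ → Submodule ℂ E}
    {p : ℤ → E →L[ℂ] E} {h₀ : E} (h : IsLieGrading G gr p h₀) {Λ : ℂ → E} {q₀ : ℂ}
    (hΛ : ∀ᶠ q in 𝓝 q₀, DifferentiableAt ℝ Λ q ∧
      fderiv ℝ Λ q Complex.I = -Complex.I • fderiv ℝ Λ q 1)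
    (horb : ∀ᶠ q in 𝓝 q₀, ∃ k ∈ expSubgroup G (gr 0), Λ q = AdL E G k (Λ q₀)) :
    ∃ γ : ℂ → G, (∀ q, γ q ∈ expSubgroup G (gr 0)) ∧
      ∀ᶠ q in 𝓝 q₀, ContMDiffAt 𝓘(ℝ, ℂ) 𝓘(ℝ, E) ∞ γ q ∧ conn E (-Complex.I) γ q = 0 ∧
        Λ q = AdL E G (γ q) (Λ q₀) := by
  let J : ℂ → ℂ := starRingEnd ℂ
  let JL : ℂ →L[ℝ] ℂ := Complex.conjCLE
  have hJ : ∀ q, HasFDerivAt J JL q := fun q => JL.hasFDerivAt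
  have hJJ : ∀ q, J (J q) = q := Complex.conj_conj
  have hJL : ∀ v, JL v = J v := fun v => rfl
  have hJt : ∀ q, Tendsto J (𝓝 q) (𝓝 (J q)) := fun q => (hJ q).continuousAt
  have hJt' : Tendsto J (𝓝 (J q₀)) (𝓝 q₀) := by
    have := hJt (J q₀)
    rwa [hJJ] at this
  have hcomp : ∀ (f : ℂ → E) (q : ℂ), DifferentiableAt ℝ f (J q) →
      fderiv ℝ (f ∘ J) q = (fderiv ℝ f (J q)).comp JL := fun f q hf =>
    (hf.hasFDerivAt.comp q (hJ q)).fderiv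
  have hJ1 : J 1 = 1 := map_one _
  have hJI : J Complex.I = -Complex.I := Complex.conj_I
  -- Composing with complex conjugation turns the curve into a holomorphic one; the lift is
  -- conjugated back below.
  obtain ⟨a, ha0, haq, ha⟩ := h.exists_orbit_lift (Λ := Λ ∘ J) (q₀ := J q₀) (by
    filter_upwards [hJt'.eventually hΛ] with q hq
    rw [differentiableAt_complex_iff_differentiableAt_real]
    refine ⟨hq.1.comp q (hJ q).differentiableAt, ?_⟩
    rw [hcomp _ _ hq.1]
    change fderiv ℝ Λ (J q) (J Complex.I) = Complex.I • fderiv ℝ Λ (J q) (J 1)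
    rw [hJ1, hJI, map_neg, hq.2, neg_smul, neg_neg]) (by
    filter_upwards [hJt'.eventually horb] with q hq
    simpa only [Function.comp_apply, hJJ] using hq)
  obtain ⟨r, hr, hexp⟩ := exists_contMDiffOn_expG E G
  have ha1 : ∀ᶠ q in 𝓝 (J q₀), DifferentiableAt ℂ a q := ha.mono fun q hq => hq.1
  -- The exponent vanishes at the base point, so near it stays in the ball where exp is known to be
  -- smooth.
  have hball : ∀ᶠ q in 𝓝 (J q₀), a q ∈ Metric.ball (0 : E) r := by
    refine ha1.self_of_nhds.continuousAt.eventually_mem ?_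
    rw [haq]
    exact Metric.ball_mem_nhds _ hr
  refine ⟨fun q => expG E G (a (J q)), fun q => expG_mem_expSubgroup (ha0 _), ?_⟩
  filter_upwards [(hJt q₀).eventually ha, (hJt q₀).eventually hball,
    (hJt q₀).eventually ha1.eventually_nhds] with q hq hqb hqd
  have hc : ContDiffAt ℝ ∞ (a ∘ J) q :=
    ((Complex.analyticAt_iff_eventually_differentiableAt.2 hqd).contDiffAt.restrict_scalars ℝ).comp q
      JL.contDiff.contDiffAt
  have hs : ContMDiffAt 𝓘(ℝ, ℂ) 𝓘(ℝ, E) ∞ (fun q => expG E G (a (J q))) q :=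
    ((hexp.contMDiffAt (Metric.isOpen_ball.mem_nhds hqb)).of_le (by simp)).comp q hc.contMDiffAt
  refine ⟨hs, conn_expG_eq_zero (b := a ∘ J) (by simp) (hc.differentiableAt (by simp)) ?_
    (hs.mdifferentiableAt (by simp)), ?_⟩
  · have h1 := differentiableAt_complex_iff_differentiableAt_real.1 hq.1
    rw [hcomp _ _ h1.1]
    change fderiv ℝ a (J q) (J Complex.I) = -Complex.I • fderiv ℝ a (J q) (J 1)
    rw [hJ1, hJI, map_neg, h1.2, neg_smul]
  · have h1 := hq.2
    simpa only [Function.comp_apply, hJJ] using h1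

end Connection

/-! ### The Toda equation from two Gauss decompositions -/

section LocalToda

variable {E : Type*} [NormedAddCommGroup E] [NormedSpace ℂ E] [FiniteDimensional ℂ E]
  {G : Type*} [TopologicalSpace G] [ChartedSpace E G] [Group G] [LieGroup 𝓘(ℂ, E) ω G]

theorem contMDiffOn_mul {F : Type*} [NormedAddCommGroup F] [NormedSpace ℝ F]
    {X : Type*} [TopologicalSpace X] [ChartedSpace F X] {f f' : X → G} {s : Set X}
    (hf : ContMDiffOn 𝓘(ℝ, F) 𝓘(ℝ, E) ∞ f s) (hf' : ContMDiffOn 𝓘(ℝ, F) 𝓘(ℝ, E) ∞ f' s) :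
    ContMDiffOn 𝓘(ℝ, F) 𝓘(ℝ, E) ∞ (fun q => f q * f' q) s := by
  have : LieGroup 𝓘(ℝ, E) ∞ G := LieGroup.of_le (n := ω) (by simp)
  exact hf.mul hf'

theorem mdifferentiableAt_of_contMDiffOn {f : ℂ → G} {s : Set ℂ} (hs : IsOpen s)
    (hf : ContMDiffOn 𝓘(ℝ, ℂ) 𝓘(ℝ, E) ∞ f s) {q : ℂ} (hq : q ∈ s) :
    MDifferentiableAt 𝓘(ℝ, ℂ) 𝓘(ℝ, E) f q :=
  (hf.contMDiffAt (hs.mem_nhds hq)).mdifferentiableAt (by simp)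

variable [LieAlgebra.IsSemisimple ℂ (GroupLieAlgebra 𝓘(ℂ, E) G)]

namespace IsLieGrading

variable {gr : ℤ → Submodule ℂ E} {p : ℤ → E →L[ℂ] E} {h₀ : E} (h : IsLieGrading G gr p h₀)
include h

theorem AdL_sub_mem {S T U : Set ℤ} (hS : ∀ a ∈ S, ∀ b ∈ S, a + b ∈ S)
    (hU : ∀ a ∈ S, ∀ b ∈ T, a + b ∈ U) {g : G} (hg : g ∈ expSubgroup G (gradeSum gr S)) {x : E}
    (hx : x ∈ gradeSum gr T) : AdL E G g x - x ∈ gradeSum gr U :=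
  h.apply_mem_gradeSum hU (h.AdL_sub_one_mem hS hg) hx

theorem mem_gradeSum_of_mem {S : Set ℤ} {m : ℤ} (hm : m ∈ S) {x : E} (hx : x ∈ gr m) :
    x ∈ gradeSum gr S := by
  rw [← h.gradeSum_singleton] at hx
  exact gradeSum_mono (singleton_subset_iff.2 hm) hx

/-- The connection of a product `μ ν k` modulo the contributions of `ν`. -/
theorem conn_mul_mul_sub_mem {S U : Set ℤ} (hS : ∀ a ∈ S, ∀ b ∈ S, a + b ∈ S) (hSU : S ⊆ U)
    {m : ℤ} (hm : ∀ a ∈ S, a + m ∈ U) (c : ℂ) {W : Set ℂ} (hW : IsOpen W) {f μ ν k : ℂ → G}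
    (hμ : ContMDiffOn 𝓘(ℝ, ℂ) 𝓘(ℝ, E) ∞ μ W) (hν : ContMDiffOn 𝓘(ℝ, ℂ) 𝓘(ℝ, E) ∞ ν W)
    (hk : ContMDiffOn 𝓘(ℝ, ℂ) 𝓘(ℝ, E) ∞ k W) (hf : ∀ q ∈ W, f q = μ q * (ν q * k q))
    (hνm : ∀ q ∈ W, ν q ∈ expSubgroup G (gradeSum gr S)) (hkm : ∀ q ∈ W, k q ∈ expSubgroup G (gr 0))
    {q : ℂ} (hq : q ∈ W) (hX : conn E c μ q ∈ gr m) :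
    conn E c f q - AdL E G (k q)⁻¹ (conn E c μ q) - conn E c k q ∈ gradeSum gr U := by
  have hd : ∀ {f : ℂ → G}, ContMDiffOn 𝓘(ℝ, ℂ) 𝓘(ℝ, E) ∞ f W → MDifferentiableAt 𝓘(ℝ, ℂ) 𝓘(ℝ, E) f q :=
    fun hf => mdifferentiableAt_of_contMDiffOn hW hf hq
  have h1 : conn E c f q = AdL E G (k q)⁻¹ (AdL E G (ν q)⁻¹ (conn E c μ q)) +
      (AdL E G (k q)⁻¹ (conn E c ν q) + conn E c k q) := by
    rw [conn_congr (f' := fun q => μ q * (ν q * k q)) c (by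
      filter_upwards [hW.mem_nhds hq] with x hx using hf x hx),
      conn_mul c (hd hμ) (hd (contMDiffOn_mul hν hk)), conn_mul c (hd hν) (hd hk), mul_inv_rev,
      map_mul]
    rfl
  have h2 : conn E c f q - AdL E G (k q)⁻¹ (conn E c μ q) - conn E c k q =
      AdL E G (k q)⁻¹ ((AdL E G (ν q)⁻¹ (conn E c μ q) - conn E c μ q) + conn E c ν q) := by
    rw [h1, map_add, map_sub]; abel
  rw [h2]
  refine h.AdL_apply_mem_gradeSum (inv_mem (hkm q hq)) (Submodule.add_mem _ ?_ ?_)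
  · refine h.AdL_sub_mem hS (T := {m}) ?_ (inv_mem (hνm q hq)) (by rwa [h.gradeSum_singleton])
    rintro a ha _ rfl
    exact hm a ha
  · refine gradeSum_mono hSU (conn_mem h hS c (hd hν) (g := 1) ?_)
    filter_upwards [hW.mem_nhds hq] with x hx
    simpa using hνm x hx

/-- The Toda equation for the map `γ` defined by two Gauss decompositions
`f = μ₊ ν₋ (γ₊ γ) = μ₋ ν₊ γ₋`. -/
theorem wirtinger_conn_toda {W : Set ℂ} (hW : IsOpen W) {xp xm : E} (hxp : xp ∈ gr 1)
    (hxm : xm ∈ gr (-1)) {f μp μm νp νm γp γm γ : ℂ → G}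
    (hμp : ContMDiffOn 𝓘(ℝ, ℂ) 𝓘(ℝ, E) ∞ μp W) (hμm : ContMDiffOn 𝓘(ℝ, ℂ) 𝓘(ℝ, E) ∞ μm W)
    (hνp : ContMDiffOn 𝓘(ℝ, ℂ) 𝓘(ℝ, E) ∞ νp W) (hνm : ContMDiffOn 𝓘(ℝ, ℂ) 𝓘(ℝ, E) ∞ νm W)
    (hγp : ContMDiffOn 𝓘(ℝ, ℂ) 𝓘(ℝ, E) ∞ γp W) (hγm : ContMDiffOn 𝓘(ℝ, ℂ) 𝓘(ℝ, E) ∞ γm W)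
    (hγ : ContMDiffOn 𝓘(ℝ, ℂ) 𝓘(ℝ, E) ∞ γ W)
    (hνp' : ∀ q ∈ W, νp q ∈ expSubgroup G (gradeSum gr (Ioi 0)))
    (hνm' : ∀ q ∈ W, νm q ∈ expSubgroup G (gradeSum gr (Iio 0)))
    (hγp' : ∀ q ∈ W, γp q ∈ expSubgroup G (gr 0)) (hγm' : ∀ q ∈ W, γm q ∈ expSubgroup G (gr 0))
    (hγ' : ∀ q ∈ W, γ q ∈ expSubgroup G (gr 0))
    (hf : ContMDiffOn 𝓘(ℝ, ℂ) 𝓘(ℝ, E) ∞ f W)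
    (hfp : ∀ q ∈ W, f q = μp q * (νm q * (γp q * γ q)))
    (hfm : ∀ q ∈ W, f q = μm q * (νp q * γm q))
    (hp0 : ∀ q ∈ W, conn E (-Complex.I) μp q = 0)
    (hp1 : ∀ q ∈ W, conn E Complex.I μp q = Complex.I • AdL E G (γp q) xp)
    (hm0 : ∀ q ∈ W, conn E Complex.I μm q = 0)
    (hm1 : ∀ q ∈ W, conn E (-Complex.I) μm q = Complex.I • AdL E G (γm q) xm)
    (hγp0 : ∀ q ∈ W, conn E (-Complex.I) γp q = 0) (hγm0 : ∀ q ∈ W, conn E Complex.I γm q = 0)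
    {q : ℂ} (hq : q ∈ W) :
    wirtinger Complex.I (conn E (-Complex.I) γ) q = adL E G (AdL E G (γ q)⁻¹ xp) xm := by
  have hd : ∀ {f : ℂ → G} {q : ℂ}, q ∈ W → ContMDiffOn 𝓘(ℝ, ℂ) 𝓘(ℝ, E) ∞ f W →
      MDifferentiableAt 𝓘(ℝ, ℂ) 𝓘(ℝ, E) f q :=
    fun hq hf => mdifferentiableAt_of_contMDiffOn hW hf hq
  have hk := contMDiffOn_mul hγp hγ
  have hk' : ∀ q ∈ W, γp q * γ q ∈ expSubgroup G (gr 0) := fun q hq => mul_mem (hγp' q hq) (hγ' q hq)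
  have hzero : ∀ (c : ℂ) {k : ℂ → G}, ContMDiffOn 𝓘(ℝ, ℂ) 𝓘(ℝ, E) ∞ k W →
      (∀ q ∈ W, k q ∈ expSubgroup G (gr 0)) → ∀ q ∈ W, conn E c k q ∈ gr 0 := by
    intro c k hk hk' q hq
    refine conn_mem_zero h c (hd hq hk) ?_
    filter_upwards [hW.mem_nhds hq] with x hx using hk' x hx
  have hpos : ∀ a ∈ Ioi (0 : ℤ), ∀ b ∈ Ioi (0 : ℤ), a + b ∈ Ioi (0 : ℤ) := by
    intro a ha b hb; simp only [mem_Ioi] at *; omega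
  have hneg : ∀ a ∈ Iio (0 : ℤ), ∀ b ∈ Iio (0 : ℤ), a + b ∈ Iio (0 : ℤ) := by
    intro a ha b hb; simp only [mem_Iio] at *; omega
  -- In the minus factorization only ν₊ contributes, so all degrees are positive; in the plus
  -- factorization everything apart from √-1 Ad(γ⁻¹)x₊ has degree at most 0.
  have h01 : ∀ q ∈ W, conn E Complex.I f q = Complex.I • AdL E G (γ q)⁻¹ xp := by
    intro q hq
    have hx1 : Complex.I • AdL E G (γ q)⁻¹ xp ∈ gr 1 :=
      Submodule.smul_mem _ _ (h.AdL_apply_mem (inv_mem (hγ' q hq)) hxp)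
    have h1 := h.conn_mul_mul_sub_mem hpos subset_rfl (m := 0) (by simp) Complex.I hW hμm hνp hγm
      hfm hνp' hγm' hq (by rw [hm0 q hq]; exact Submodule.zero_mem _)
    rw [hm0 q hq, hγm0 q hq, map_zero, sub_zero, sub_zero] at h1
    have h2 := h.conn_mul_mul_sub_mem hneg (U := Iic 0) Iio_subset_Iic_self (m := 1) (by
      intro a ha; simp only [mem_Iio, mem_Iic] at *; omega) Complex.I hW hμp hνm hk hfp hνm' hk' hq
      (by rw [hp1 q hq]; exact Submodule.smul_mem _ _ (h.AdL_apply_mem (hγp' q hq) hxp))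
    have h3 : AdL E G (γp q * γ q)⁻¹ (conn E Complex.I μp q) =
        Complex.I • AdL E G (γ q)⁻¹ xp := by
      rw [hp1 q hq, mul_inv_rev, map_mul, map_smul]
      exact congrArg (fun y => Complex.I • AdL E G (γ q)⁻¹ y) (AdL_inv_apply _ _)
    rw [h3] at h2
    have h4 := Submodule.add_mem _ h2
      (h.mem_gradeSum_of_mem (S := Iic 0) (by simp) (hzero Complex.I hk hk' q hq))
    rw [sub_add_cancel] at h4
    exact sub_eq_zero.1 (h.eq_zero_of_mem_mem (S := Ioi 0) (S' := Iic 0) (by simp)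
      (Submodule.sub_mem _ h1 (h.mem_gradeSum_of_mem (by simp) hx1)) h4)
  -- The plus factorization gives the component of γ modulo negative degrees, the minus
  -- factorization gives √-1 x₋ modulo nonnegative degrees; so the difference of the two sides has
  -- degrees of both kinds and vanishes.
  have h10 : ∀ q ∈ W, conn E (-Complex.I) f q = conn E (-Complex.I) γ q + Complex.I • xm := by
    intro q hq
    have h1 := h.conn_mul_mul_sub_mem hneg subset_rfl (m := 0) (by simp) (-Complex.I) hW hμp hνm hk
      hfp hνm' hk' hq (by rw [hp0 q hq]; exact Submodule.zero_mem _)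
    rw [hp0 q hq, conn_mul _ (hd hq hγp) (hd hq hγ), hγp0 q hq, map_zero, map_zero, sub_zero,
      zero_add] at h1
    have h2 := h.conn_mul_mul_sub_mem hpos (U := Ici 0) Ioi_subset_Ici_self (m := -1) (by
      intro a ha; simp only [mem_Ioi, mem_Ici] at *; omega) (-Complex.I) hW hμm hνp hγm hfm hνp' hγm'
      hq (by rw [hm1 q hq]; exact Submodule.smul_mem _ _ (h.AdL_apply_mem (hγm' q hq) hxm))
    have h3 : AdL E G (γm q)⁻¹ (conn E (-Complex.I) μm q) = Complex.I • xm := by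
      rw [hm1 q hq, map_smul, AdL_inv_apply]
    rw [h3] at h2
    have h4 := Submodule.add_mem _ h2
      (h.mem_gradeSum_of_mem (S := Ici 0) (by simp) (hzero (-Complex.I) hγm hγm' q hq))
    rw [sub_add_cancel] at h4
    have h5 := Submodule.sub_mem _ h1 (h.mem_gradeSum_of_mem (S := Iio 0) (by simp)
      (Submodule.smul_mem _ Complex.I hxm))
    have h6 := Submodule.sub_mem _ h4 (h.mem_gradeSum_of_mem (S := Ici 0) (by simp)
      (hzero (-Complex.I) hγ hγ' q hq))
    rw [sub_right_comm] at h6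
    rw [← sub_eq_zero, ← sub_sub]
    exact h.eq_zero_of_mem_mem (S := Iio 0) (S' := Ici 0) (by simp) h5 h6
  have hMC := wirtinger_conn hW hf hq
  have hnhds := hW.mem_nhds hq
  have hcγ := ((contDiffOn_conn (-Complex.I) hW hγ).contDiffAt hnhds).differentiableAt (by simp)
  have hcf := ((contDiffOn_conn Complex.I hW hf).contDiffAt hnhds).differentiableAt (by simp)
  have hw1 : wirtinger Complex.I (conn E (-Complex.I) f) q =
      wirtinger Complex.I (conn E (-Complex.I) γ) q := by
    rw [wirtinger_congr (f' := fun q => conn E (-Complex.I) γ q + Complex.I • xm) _ (by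
      filter_upwards [hnhds] with x hx using h10 x hx)]
    unfold wirtinger
    rw [fderiv_add_const]
  have hw2 : p 0 (wirtinger (-Complex.I) (conn E Complex.I f) q) = 0 := by
    have h1 : ∀ v, fderiv ℝ (conn E Complex.I f) q v ∈ gr 1 := by
      refine hasFDerivAt_apply_mem (W := (gr 1).restrictScalars ℝ) (gr 1).closed_of_finiteDimensional
        hcf.hasFDerivAt ?_
      filter_upwards [hnhds] with x hx
      rw [h01 x hx]
      exact Submodule.smul_mem _ _ (h.AdL_apply_mem (inv_mem (hγ' x hx)) hxp)
    refine h.ne 0 1 (by simp) _ ?_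
    exact Submodule.smul_mem _ _ (Submodule.add_mem _ (h1 _) (Submodule.smul_mem _ _ (h1 _)))
  have hw3 : wirtinger Complex.I (conn E (-Complex.I) γ) q ∈ gr 0 := by
    have h1 : ∀ v, fderiv ℝ (conn E (-Complex.I) γ) q v ∈ gr 0 := by
      refine hasFDerivAt_apply_mem (W := (gr 0).restrictScalars ℝ) (gr 0).closed_of_finiteDimensional
        hcγ.hasFDerivAt ?_
      filter_upwards [hnhds] with x hx using hzero _ hγ hγ' x hx
    exact Submodule.smul_mem _ _ (Submodule.add_mem _ (h1 _) (Submodule.smul_mem _ _ (h1 _)))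
  have hAx : AdL E G (γ q)⁻¹ xp ∈ gr 1 := h.AdL_apply_mem (inv_mem (hγ' q hq)) hxp
  -- In degree 0 the ∂_z-term drops out, being of degree 1, and so does the bracket of the component
  -- of γ with a degree 1 element. What remains is [√-1 x₋, √-1 Ad(γ⁻¹)x₊] = [Ad(γ⁻¹)x₊, x₋].
  have h2 := congrArg (p 0) hMC
  rw [hw1, h01 q hq, h10 q hq, map_add, map_sub, hw2, h.same 0 _ hw3, map_zero, map_add] at h2
  have h3 : p 0 (adL E G (conn E (-Complex.I) γ q) (Complex.I • AdL E G (γ q)⁻¹ xp)) = 0 :=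
    h.ne 0 (0 + 1) (by simp) _
      (h.adL_mem 0 1 _ (hzero _ hγ hγ' q hq) _ (Submodule.smul_mem _ _ hAx))
  have h4 : p 0 (adL E G (Complex.I • xm) (Complex.I • AdL E G (γ q)⁻¹ xp)) =
      adL E G (AdL E G (γ q)⁻¹ xp) xm := by
    have h5 : adL E G (AdL E G (γ q)⁻¹ xp) xm ∈ gr 0 := h.adL_mem 1 (-1) _ hAx _ hxm
    have h6 : adL E G (Complex.I • xm) (Complex.I • AdL E G (γ q)⁻¹ xp) =
        adL E G (AdL E G (γ q)⁻¹ xp) xm := by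
      rw [map_smul, map_smul, smul_apply, smul_smul, Complex.I_mul_I, neg_smul, one_smul]
      rw [adL_apply, adL_apply]
      exact lie_skew (L := GroupLieAlgebra 𝓘(ℂ, E) G) _ _
    rw [h6, h.same 0 _ h5]
  rw [add_apply, map_add, h3, h4, zero_add, zero_sub] at h2
  exact (neg_add_eq_zero.1 h2)

end IsLieGrading

end LocalToda

/-! ### Local Gauss decompositions with lifts -/

section LocalGauss

variable {E : Type*} [NormedAddCommGroup E] [NormedSpace ℂ E] [FiniteDimensional ℂ E]
  {G : Type*} [TopologicalSpace G] [ChartedSpace E G] [Group G] [LieGroup 𝓘(ℂ, E) ω G]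

/-- A Gauss decomposition `φ = μ ν η` of a map from the complex line, together with a lift `γ`
of the (0,1)-component of the connection of `μ`. -/
structure IsLocalGauss (gr : ℤ → Submodule ℂ E) (xp : E) (g : G) (φ : ℂ → G) (W : Set ℂ)
    (μ ν η γ : ℂ → G) : Prop where
  smooth_μ : ContMDiffOn 𝓘(ℝ, ℂ) 𝓘(ℝ, E) ∞ μ W
  smooth_ν : ContMDiffOn 𝓘(ℝ, ℂ) 𝓘(ℝ, E) ∞ ν W
  smooth_η : ContMDiffOn 𝓘(ℝ, ℂ) 𝓘(ℝ, E) ∞ η W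
  smooth_γ : ContMDiffOn 𝓘(ℝ, ℂ) 𝓘(ℝ, E) ∞ γ W
  mem_μ : ∀ q ∈ W, g⁻¹ * μ q ∈ expSubgroup G (gradeSum gr (Ioi 0))
  mem_ν : ∀ q ∈ W, ν q ∈ expSubgroup G (gradeSum gr (Iio 0))
  mem_η : ∀ q ∈ W, η q ∈ expSubgroup G (gr 0)
  mem_γ : ∀ q ∈ W, γ q ∈ expSubgroup G (gr 0)
  decomp : ∀ q ∈ W, φ q = μ q * ν q * η q
  type_μ : ∀ q ∈ W, conn E (-Complex.I) μ q = 0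
  antihol_γ : ∀ q ∈ W, conn E (-Complex.I) γ q = 0
  lift_γ : ∀ q ∈ W, conn E Complex.I μ q = Complex.I • AdL E G (γ q) xp

variable [LieAlgebra.IsSemisimple ℂ (GroupLieAlgebra 𝓘(ℂ, E) G)]

namespace IsLieGrading

variable {gr : ℤ → Submodule ℂ E} {p : ℤ → E →L[ℂ] E} {h₀ : E} (h : IsLieGrading G gr p h₀)
include h

/-- With b = mk, m in Ñ₋ and k in H̃, the shifted map (gn)⁻¹φ(mk)⁻¹ passes through 1 at q₀ and is
factored by the product chart. To restore mk on the right, m is moved past the H̃-factor, which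
normalizes Ñ₋. -/
theorem exists_local_decomposition [ConnectedSpace G] {Ω : Set ℂ} (hΩ : IsOpen Ω) {φ : ℂ → G}
    (hφ : ContMDiffOn 𝓘(ℝ, ℂ) 𝓘(ℝ, E) ∞ φ Ω) {q₀ : ℂ} (hq₀ : q₀ ∈ Ω) {g n b : G}
    (hn : n ∈ expSubgroup G (gradeSum gr (Ioi 0))) (hb : b ∈ expSubgroup G (gradeSum gr (Iic 0)))
    (hgnb : φ q₀ = g * n * b) :
    ∃ W ⊆ Ω, IsOpen W ∧ q₀ ∈ W ∧ ∃ μ ν η : ℂ → G,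
      ContMDiffOn 𝓘(ℝ, ℂ) 𝓘(ℝ, E) ∞ μ W ∧ ContMDiffOn 𝓘(ℝ, ℂ) 𝓘(ℝ, E) ∞ ν W ∧
      ContMDiffOn 𝓘(ℝ, ℂ) 𝓘(ℝ, E) ∞ η W ∧
      (∀ q ∈ W, g⁻¹ * μ q ∈ expSubgroup G (gradeSum gr (Ioi 0))) ∧
      (∀ q ∈ W, ν q ∈ expSubgroup G (gradeSum gr (Iio 0))) ∧
      (∀ q ∈ W, η q ∈ expSubgroup G (gr 0)) ∧ ∀ q ∈ W, φ q = μ q * ν q * η q := by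
  obtain ⟨m, hm, k, hk, rfl⟩ := h.exists_eq_mul hb
  obtain ⟨qp, qm, hqp, hqm, hq⟩ := exists_splitting h.toIsGradingProj
  obtain ⟨Φ, h0, hΦ, hsm, hsymm⟩ := exists_productChart G (qp.restrictScalars ℝ)
    (qm.restrictScalars ℝ) ((p 0).restrictScalars ℝ)
    (by ext x; exact congrArg (fun T : E →L[ℂ] E => T x) hq)
  have hΦ0 : Φ 0 = 1 := by rw [hΦ 0 h0]; simp [expG_zero]
  have htgt : (1 : G) ∈ Φ.target := by rw [← hΦ0]; exact Φ.map_source h0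
  have hconst : ∀ a : G, ContMDiffOn 𝓘(ℝ, ℂ) 𝓘(ℝ, E) ∞ (fun _ : ℂ => a) Ω := fun a => contMDiffOn_const
  let θ : ℂ → G := fun q => (g * n)⁻¹ * (φ q * (m * k)⁻¹)
  have hθ : ContMDiffOn 𝓘(ℝ, ℂ) 𝓘(ℝ, E) ∞ θ Ω :=
    contMDiffOn_mul (hconst _) (contMDiffOn_mul hφ (hconst _))
  have hθ0 : θ q₀ = 1 := by simp only [θ, hgnb]; group
  let W : Set ℂ := Ω ∩ θ ⁻¹' Φ.target
  have hW : IsOpen W := hθ.continuousOn.isOpen_inter_preimage hΩ Φ.open_target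
  let v : ℂ → E := fun q => Φ.symm (θ q)
  have hv : ContMDiffOn 𝓘(ℝ, ℂ) 𝓘(ℝ, E) ∞ v W :=
    (hsymm.of_le (by simp)).comp (hθ.mono inter_subset_left) fun q hq => hq.2
  have hvs : MapsTo v W Φ.source := fun q hq => Φ.map_target hq.2
  have hcomp : ∀ P ∈ [qp.restrictScalars ℝ, qm.restrictScalars ℝ, (p 0).restrictScalars ℝ],
      ContMDiffOn 𝓘(ℝ, ℂ) 𝓘(ℝ, E) ∞ (fun q => expG E G (P (v q))) W := fun P hP =>
    ((hsm P hP).of_le (by simp)).comp hv hvs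
  have hp : ContMDiffOn 𝓘(ℝ, ℂ) 𝓘(ℝ, E) ∞ (fun q => expG E G (qp (v q))) W :=
    hcomp (qp.restrictScalars ℝ) (by simp)
  have hm' : ContMDiffOn 𝓘(ℝ, ℂ) 𝓘(ℝ, E) ∞ (fun q => expG E G (qm (v q))) W :=
    hcomp (qm.restrictScalars ℝ) (by simp)
  have h0' : ContMDiffOn 𝓘(ℝ, ℂ) 𝓘(ℝ, E) ∞ (fun q => expG E G (p 0 (v q))) W :=
    hcomp ((p 0).restrictScalars ℝ) (by simp)
  have hc : ∀ a : G, ContMDiffOn 𝓘(ℝ, ℂ) 𝓘(ℝ, E) ∞ (fun _ : ℂ => a) W := fun a => contMDiffOn_const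
  have h0m : ∀ q, expG E G (p 0 (v q)) ∈ expSubgroup G (gr 0) := fun q =>
    expG_mem_expSubgroup (h.mem 0 _)
  refine ⟨W, inter_subset_left, hW, ⟨hq₀, by change θ q₀ ∈ Φ.target; rw [hθ0]; exact htgt⟩,
    fun q => g * n * expG E G (qp (v q)),
    fun q => expG E G (qm (v q)) * (expG E G (p 0 (v q)) * m * (expG E G (p 0 (v q)))⁻¹),
    fun q => expG E G (p 0 (v q)) * k,
    contMDiffOn_mul (hc _) hp,
    contMDiffOn_mul hm' (contMDiffOn_mul (contMDiffOn_mul h0' (hc _)) (contMDiffOn_inv h0')),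
    contMDiffOn_mul h0' (hc _), fun q _ => ?_, fun q _ => ?_, fun q _ => ?_, fun q hq => ?_⟩
  · have h1 : g⁻¹ * (g * n * expG E G (qp (v q))) = n * expG E G (qp (v q)) := by group
    rw [h1]
    exact mul_mem hn (expG_mem_expSubgroup (hqp _))
  · exact mul_mem (expG_mem_expSubgroup (hqm _)) (h.conj_mem (h0m q) hm)
  · exact mul_mem (h0m q) hk
  · have h1 : θ q = expG E G (qp (v q)) * expG E G (qm (v q)) * expG E G (p 0 (v q)) := by
      have h2 := hΦ _ (hvs hq)
      rwa [Φ.right_inv hq.2] at h2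
    have h2 : φ q = g * n * θ q * (m * k) := by simp only [θ]; group
    rw [h2, h1]; group

/-- The connection of μ has positive degrees and equals Ad(νη) of the connection of φ minus that of
νη. Its (1,0)-component also has degrees at most 0, so it vanishes. Its (0,1)-component has degrees
at most 1, so it is Ad(η) of the degree 1 part for φ and stays in the orbit of x₊. Maurer-Cartan
then makes the latter antiholomorphic, and it lifts. -/
theorem exists_isLocalGauss [ConnectedSpace G] {Ω : Set ℂ} (hΩ : IsOpen Ω) {φ : ℂ → G}
    (hφ : ContMDiffOn 𝓘(ℝ, ℂ) 𝓘(ℝ, E) ∞ φ Ω) {xp : E} (hxp : xp ∈ gr 1)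
    (h10 : ∀ q ∈ Ω, conn E (-Complex.I) φ q ∈ gradeSum gr (Iic 0))
    (h01 : ∀ q ∈ Ω, conn E Complex.I φ q ∈ gradeSum gr (Iic 1))
    (horb : ∀ q ∈ Ω, ∃ k ∈ expSubgroup G (gr 0), p 1 (conn E Complex.I φ q) = AdL E G k xp)
    {q₀ : ℂ} (hq₀ : q₀ ∈ Ω) {g n b : G}
    (hn : n ∈ expSubgroup G (gradeSum gr (Ioi 0))) (hb : b ∈ expSubgroup G (gradeSum gr (Iic 0)))
    (hgnb : φ q₀ = g * n * b) :
    ∃ W ⊆ Ω, IsOpen W ∧ q₀ ∈ W ∧ ∃ μ ν η γ : ℂ → G, IsLocalGauss gr xp g φ W μ ν η γ := by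
  obtain ⟨W, hWΩ, hW, hqW, μ, ν, η, hμ, hν, hη, hμm, hνm, hηm, hdec⟩ :=
    h.exists_local_decomposition hΩ hφ hq₀ hn hb hgnb
  have hd : ∀ {f : ℂ → G} {q : ℂ}, q ∈ W → ContMDiffOn 𝓘(ℝ, ℂ) 𝓘(ℝ, E) ∞ f W →
      MDifferentiableAt 𝓘(ℝ, ℂ) 𝓘(ℝ, E) f q :=
    fun hq hf => mdifferentiableAt_of_contMDiffOn hW hf hq
  have hpos : ∀ a ∈ Ioi (0 : ℤ), ∀ b ∈ Ioi (0 : ℤ), a + b ∈ Ioi (0 : ℤ) := by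
    intro a ha b hb; simp only [mem_Ioi] at *; omega
  have hneg : ∀ a ∈ Iio (0 : ℤ), ∀ b ∈ Iio (0 : ℤ), a + b ∈ Iio (0 : ℤ) := by
    intro a ha b hb; simp only [mem_Iio] at *; omega
  have hnonpos : ∀ a ∈ Iic (0 : ℤ), ∀ b ∈ Iic (0 : ℤ), a + b ∈ Iic (0 : ℤ) := by
    intro a ha b hb; simp only [mem_Iic] at *; omega
  have hk := contMDiffOn_mul hν hη
  have hkm : ∀ q ∈ W, ν q * η q ∈ expSubgroup G (gradeSum gr (Iic 0)) := fun q hq =>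
    mul_mem (expSubgroup_mono (gradeSum_mono Iio_subset_Iic_self) (hνm q hq))
      (expSubgroup_mono (h.grade_zero_le (by simp)) (hηm q hq))
  have hconnk : ∀ c, ∀ q ∈ W, conn E c (fun q => ν q * η q) q ∈ gradeSum gr (Iic 0) := by
    intro c q hq
    refine conn_mem h hnonpos c (hd hq hk) (g := 1) ?_
    filter_upwards [hW.mem_nhds hq] with x hx
    simpa using hkm x hx
  have hconnμ : ∀ c, ∀ q ∈ W, conn E c μ q ∈ gradeSum gr (Ioi 0) := by
    intro c q hq
    refine conn_mem h hpos c (hd hq hμ) (g := g) ?_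
    filter_upwards [hW.mem_nhds hq] with x hx using hμm x hx
  have hmul : ∀ c, ∀ q ∈ W, AdL E G (ν q) (AdL E G (η q) (conn E c φ q -
      conn E c (fun q => ν q * η q) q)) = conn E c μ q := by
    intro c q hq
    rw [conn_congr (f' := fun q => μ q * (ν q * η q)) c (by
      filter_upwards [hW.mem_nhds hq] with x hx
      rw [hdec x hx, mul_assoc]), conn_mul c (hd hq hμ) (hd hq hk), add_sub_cancel_right]
    have h1 := AdL_apply_inv (ν q * η q) (conn E c μ q)
    rw [map_mul] at h1
    exact h1
  have htype : ∀ q ∈ W, conn E (-Complex.I) μ q = 0 := by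
    intro q hq
    refine h.eq_zero_of_mem_mem (S := Ioi 0) (S' := Iic 0) (by simp) (hconnμ _ q hq) ?_
    rw [← hmul _ q hq]
    have h1 := Submodule.sub_mem _ (h10 q (hWΩ hq)) (hconnk (-Complex.I) q hq)
    have h2 := h.AdL_apply_mem_gradeSum (hηm q hq) h1
    have h3 := h.AdL_sub_mem hneg (T := Iic 0) (U := Iic 0) (by
      intro a ha b hb; simp only [mem_Iio, mem_Iic] at *; omega) (hνm q hq) h2
    have h4 := Submodule.add_mem _ h3 h2
    rwa [sub_add_cancel] at h4
  have hΛorb : ∀ q ∈ W, ∃ k ∈ expSubgroup G (gr 0), conn E Complex.I μ q = AdL E G k xp := by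
    intro q hq
    obtain ⟨k, hk, hkx⟩ := horb q (hWΩ hq)
    refine ⟨η q * k, mul_mem (hηm q hq) hk, ?_⟩
    have hle : gradeSum gr (Iic 0) ≤ gradeSum gr (Iic 1) :=
      gradeSum_mono (Iic_subset_Iic.2 (by norm_num))
    set Y := conn E Complex.I φ q - conn E Complex.I (fun q => ν q * η q) q with hY
    have h1 : Y ∈ gradeSum gr (Iic 1) := Submodule.sub_mem _ (h01 q (hWΩ hq))
      (hle (hconnk Complex.I q hq))
    have h2 : Y - AdL E G k xp ∈ gradeSum gr (Iic 0) := by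
      rw [← hkx]
      rw [h.mem_gradeSum] at h1 ⊢
      intro m hm
      by_cases hm1 : m = 1
      · subst hm1
        rw [map_sub, hY, map_sub, h.same 1 _ (h.mem 1 _),
          h.mem_gradeSum.1 (hconnk Complex.I q hq) 1 (by simp), sub_zero, sub_self]
      · have hm' : m ∉ Iic (1 : ℤ) := by simp only [mem_Iic] at *; omega
        rw [map_sub, h1 m hm', h.ne m 1 hm1 _ (h.mem 1 _), sub_self]
    have h3 := h.AdL_apply_mem_gradeSum (hηm q hq) h2
    have h4 := h.AdL_sub_mem hneg (T := Iic 1) (U := Iic 0) (by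
      intro a ha b hb; simp only [mem_Iio, mem_Iic] at *; omega) (hνm q hq)
      (h.AdL_apply_mem_gradeSum (hηm q hq) h1)
    have h5 := Submodule.add_mem _ h4 h3
    rw [hmul _ q hq, map_sub (AdL E G (η q)) Y, sub_add_sub_cancel] at h5
    have h6 : AdL E G (η q) (AdL E G k xp) ∈ gr 1 := h.AdL_apply_mem (hηm q hq)
      (h.AdL_apply_mem hk hxp)
    rw [map_mul]
    exact sub_eq_zero.1 (h.eq_zero_of_mem_mem (S := Ioi 0) (S' := Iic 0) (by simp)
      (Submodule.sub_mem _ (hconnμ _ q hq) (h.mem_gradeSum_of_mem (by simp) h6)) h5)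
  obtain ⟨k₀, hk₀, hk₀x⟩ := hΛorb q₀ hqW
  obtain ⟨γ, hγm, hγ⟩ := h.exists_antiholomorphic_lift (Λ := conn E Complex.I μ) (q₀ := q₀) (by
    filter_upwards [hW.mem_nhds hqW] with q hq
    refine ⟨((contDiffOn_conn Complex.I hW hμ).contDiffAt (hW.mem_nhds hq)).differentiableAt
      (by simp), ?_⟩
    have hMC := wirtinger_conn hW hμ hq
    have h1 : wirtinger Complex.I (conn E (-Complex.I) μ) q = 0 := by
      rw [wirtinger_congr (f' := fun _ => (0 : E)) _ (by
        filter_upwards [hW.mem_nhds hq] with x hx using htype x hx)]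
      simp [wirtinger]
    rw [h1, htype q hq, map_zero, zero_apply, sub_zero, add_zero] at hMC
    exact apply_I_eq_of_half_smul_eq_zero (by simp) rfl hMC) (by
    filter_upwards [hW.mem_nhds hqW] with q hq
    obtain ⟨k, hk, hkx⟩ := hΛorb q hq
    refine ⟨k * k₀⁻¹, mul_mem hk (inv_mem hk₀), ?_⟩
    rw [hk₀x, hkx, map_mul]
    exact congrArg (AdL E G k) (AdL_inv_apply k₀ xp).symm)
  obtain ⟨W', hW'sub, hW', hqW'⟩ := eventually_nhds_iff.1 hγ
  -- Absorbs the factor √-1 required of the lift: exp(-(π/2)√-1 h₀) multiplies degree 1 by -√-1.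
  let k₁ : G := k₀ * expG E G (-(Real.pi / 2 * Complex.I) • h₀)
  have hk₁ : k₁ ∈ expSubgroup G (gr 0) := mul_mem hk₀
    (expG_mem_expSubgroup (Submodule.smul_mem _ _ h.gradingElement_mem))
  have hk₁x : Complex.I • AdL E G k₁ xp = AdL E G k₀ xp := by
    have h1 : AdL E G k₁ xp = AdL E G k₀ (AdL E G (expG E G (-(Real.pi / 2 * Complex.I) • h₀)) xp) := by
      simp only [k₁, map_mul]; rfl
    rw [h1, h.AdL_expG_smul _ hxp, map_smul, smul_smul, Int.cast_one, mul_one, Complex.exp_neg,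
      Complex.exp_pi_div_two_mul_I, mul_inv_cancel₀ Complex.I_ne_zero, one_smul]
  have hγs : ContMDiffOn 𝓘(ℝ, ℂ) 𝓘(ℝ, E) ∞ γ (W ∩ W') := fun q hq =>
    (hW'sub q hq.2).1.contMDiffWithinAt
  refine ⟨W ∩ W', inter_subset_left.trans hWΩ, hW.inter hW', ⟨hqW, hqW'⟩, μ, ν, η,
    fun q => γ q * k₁, ⟨hμ.mono inter_subset_left, hν.mono inter_subset_left,
    hη.mono inter_subset_left, contMDiffOn_mul hγs contMDiffOn_const, fun q hq => hμm q hq.1,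
    fun q hq => hνm q hq.1, fun q hq => hηm q hq.1, fun q hq => mul_mem (hγm q) hk₁,
    fun q hq => hdec q hq.1, fun q hq => htype q hq.1, fun q hq => ?_, fun q hq => ?_⟩⟩
  · rw [conn_mul _ ((hW'sub q hq.2).1.mdifferentiableAt (by simp))
      mdifferentiableAt_const, (hW'sub q hq.2).2.1, conn_const, map_zero, add_zero]
  · rw [(hW'sub q hq.2).2.2, hk₀x, map_mul, ← hk₁x, map_smul]
    rfl

end IsLieGrading

end LocalGauss

/-! ### Passing between the Riemann surface and a coordinate -/

section Coordinate

variable {M : Type*} [TopologicalSpace M] [ChartedSpace ℂ M] [IsManifold 𝓘(ℂ, ℂ) ω M]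
  {z : OpenPartialHomeomorph M ℂ} (hz : z ∈ IsManifold.maximalAtlas 𝓘(ℂ, ℂ) ω M)
include hz

theorem contMDiffOn_coord : ContMDiffOn 𝓘(ℝ, ℂ) 𝓘(ℝ, ℂ) ∞ z z.source := fun q hq =>
  ((contMDiffAt_restrictScalars (I := 𝓘(ℂ, ℂ)) (I' := 𝓘(ℝ, ℂ))
    rfl rfl ((contMDiffOn_of_mem_maximalAtlas hz).contMDiffAt
    (z.open_source.mem_nhds hq))).of_le (by simp)).contMDiffWithinAt

theorem contMDiffOn_coord_symm : ContMDiffOn 𝓘(ℝ, ℂ) 𝓘(ℝ, ℂ) ∞ z.symm z.target := fun q hq =>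
  ((contMDiffAt_restrictScalars (I := 𝓘(ℂ, ℂ)) (I' := 𝓘(ℝ, ℂ))
    rfl rfl ((contMDiffOn_symm_of_mem_maximalAtlas hz).contMDiffAt
    (z.open_target.mem_nhds hq))).of_le (by simp)).contMDiffWithinAt

theorem exists_hasMFDerivAt_coord {q : M} (hq : q ∈ z.source) :
    ∃ D : ℂ →L[ℂ] ℂ, HasMFDerivAt 𝓘(ℝ, ℂ) 𝓘(ℝ, ℂ) z q (D.restrictScalars ℝ : ℂ →L[ℝ] ℂ) ∧
      D (coordVec z q) = 1 := by
  let D : ℂ →L[ℂ] ℂ := mfderiv 𝓘(ℂ, ℂ) 𝓘(ℂ, ℂ) z q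
  have hD : HasMFDerivAt 𝓘(ℂ, ℂ) 𝓘(ℂ, ℂ) z q D :=
    (((contMDiffOn_of_mem_maximalAtlas hz).contMDiffAt
      (z.open_source.mem_nhds hq)).mdifferentiableAt (by simp)).hasMFDerivAt
  have h1 : HasMFDerivAt 𝓘(ℝ, ℂ) 𝓘(ℝ, ℂ) z q (D.restrictScalars ℝ : ℂ →L[ℝ] ℂ) :=
    hasMFDerivAt_restrictScalars hD
  refine ⟨D, h1, ?_⟩
  let D' : ℂ →L[ℝ] ℂ := mfderiv 𝓘(ℝ, ℂ) 𝓘(ℝ, ℂ) z.symm (z q)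
  have hD' : HasMFDerivAt 𝓘(ℝ, ℂ) 𝓘(ℝ, ℂ) z.symm (z q) D' :=
    (((contMDiffOn_coord_symm hz).contMDiffAt
      (z.open_target.mem_nhds (z.map_source hq))).mdifferentiableAt (by simp)).hasMFDerivAt
  have h2 : HasMFDerivAt 𝓘(ℝ, ℂ) 𝓘(ℝ, ℂ) z (z.symm (z q)) (D.restrictScalars ℝ : ℂ →L[ℝ] ℂ) := by
    have h3 : ∀ k, k = q → HasMFDerivAt 𝓘(ℝ, ℂ) 𝓘(ℝ, ℂ) z k (D.restrictScalars ℝ : ℂ →L[ℝ] ℂ) := by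
      rintro _ rfl; exact h1
    exact h3 _ (z.left_inv hq)
  have h3 : HasMFDerivAt 𝓘(ℝ, ℂ) 𝓘(ℝ, ℂ) (z ∘ z.symm) (z q)
      ((D.restrictScalars ℝ : ℂ →L[ℝ] ℂ).comp D') := HasMFDerivAt.comp (z q) h2 hD'
  have h4 : HasFDerivAt (z ∘ z.symm) ((D.restrictScalars ℝ : ℂ →L[ℝ] ℂ).comp D') (z q) :=
    h3.hasFDerivAt
  have h5 : HasFDerivAt (z ∘ z.symm) (ContinuousLinearMap.id ℝ ℂ) (z q) :=
    (hasFDerivAt_id (z q)).congr_of_eventuallyEq (by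
      filter_upwards [z.open_target.mem_nhds (z.map_source hq)] with w hw using z.right_inv hw)
  exact congrArg (fun L : ℂ →L[ℝ] ℂ => L 1) (h4.unique h5)

/-- The differential of z is complex linear and sends the coordinate vector to 1, hence its multiple
by √-1 to √-1. -/
theorem dbar_comp_coord {V : Type*} [NormedAddCommGroup V] [NormedSpace ℂ V] {F : M → V} {K : ℂ → V}
    {q : M} (hq : q ∈ z.source) (hF : F =ᶠ[𝓝 q] K ∘ z) (hK : DifferentiableAt ℝ K (z q)) :
    dbar z F q = wirtinger Complex.I K (z q) := by
  obtain ⟨D, hD, hDv⟩ := exists_hasMFDerivAt_coord hz hq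
  have h1 : HasMFDerivAt 𝓘(ℝ, ℂ) 𝓘(ℝ, V) (K ∘ z) q
      ((fderiv ℝ K (z q)).comp (D.restrictScalars ℝ : ℂ →L[ℝ] ℂ)) :=
    HasMFDerivAt.comp q hK.hasFDerivAt.hasMFDerivAt hD
  have h2 : ∀ v, rdiff ℂ V F q v = fderiv ℝ K (z q) (D v) := fun v =>
    congrArg (fun L : ℂ →L[ℝ] V => L v) (hF.mfderiv_eq.trans h1.mfderiv)
  have h3 : D (Complex.I * coordVec z q) = Complex.I := by
    rw [← smul_eq_mul, map_smul, hDv, smul_eq_mul, mul_one]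
  unfold dbar wirtinger
  rw [h2, h2, h3, hDv]

variable {E : Type*} [NormedAddCommGroup E] [NormedSpace ℂ E] [FiniteDimensional ℂ E]
  {G : Type*} [TopologicalSpace G] [ChartedSpace E G] [Group G] [LieGroup 𝓘(ℂ, E) ω G]

theorem rdiff_comp_coord {f : ℂ → G} {q : M} (hq : q ∈ z.source)
    (hf : MDifferentiableAt 𝓘(ℝ, ℂ) 𝓘(ℝ, E) f (z q)) :
    ∃ D : ℂ →L[ℂ] ℂ, ∀ v, rdiff ℂ E (f ∘ z) q v = rdiff ℂ E f (z q) (D v) := by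
  obtain ⟨D, hD, -⟩ := exists_hasMFDerivAt_coord hz hq
  let D₀ : ℂ →L[ℝ] E := mfderiv 𝓘(ℝ, ℂ) 𝓘(ℝ, E) f (z q)
  have h0 : HasMFDerivAt 𝓘(ℝ, ℂ) 𝓘(ℝ, E) f (z q) D₀ := hf.hasMFDerivAt
  have h1 : HasMFDerivAt 𝓘(ℝ, ℂ) 𝓘(ℝ, E) (f ∘ z) q (D₀.comp (D.restrictScalars ℝ : ℂ →L[ℝ] ℂ)) :=
    HasMFDerivAt.comp q h0 hD
  exact ⟨D, fun v => congrArg (fun L : ℂ →L[ℝ] E => L v) h1.mfderiv⟩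

theorem pullMC_comp_coord {f : M → G} {f' : ℂ → G} {q : M} (hq : q ∈ z.source)
    (hff' : f =ᶠ[𝓝 q] f' ∘ z) (hf' : MDifferentiableAt 𝓘(ℝ, ℂ) 𝓘(ℝ, E) f' (z q)) :
    pullMC E f q (coordVec z q) = logDeriv E f' (z q) 1 ∧
      pullMC E f q (Complex.I * coordVec z q) = logDeriv E f' (z q) Complex.I := by
  obtain ⟨D, hD, hDv⟩ := exists_hasMFDerivAt_coord hz hq
  let D₀ : ℂ →L[ℝ] E := logDeriv E f' (z q)
  have h0 : HasMFDerivAt 𝓘(ℝ, ℂ) 𝓘(ℝ, E) (fun x => (f' (z q))⁻¹ * f' x) (z q) D₀ :=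
    (mdifferentiableAt_inv_mul hf' _).hasMFDerivAt
  have h1 : HasMFDerivAt 𝓘(ℝ, ℂ) 𝓘(ℝ, E) ((fun x => (f' (z q))⁻¹ * f' x) ∘ z) q
      (D₀.comp (D.restrictScalars ℝ : ℂ →L[ℝ] ℂ)) := HasMFDerivAt.comp q h0 hD
  have h2 : (fun x => (f q)⁻¹ * f x) =ᶠ[𝓝 q] (fun x => (f' (z q))⁻¹ * f' x) ∘ z := by
    have h3 : f q = f' (z q) := hff'.self_of_nhds
    filter_upwards [hff'] with x hx
    rw [h3, hx]; rfl
  have h3 : mfderiv 𝓘(ℝ, ℂ) 𝓘(ℝ, E) (fun x => (f q)⁻¹ * f x) q =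
      D₀.comp (D.restrictScalars ℝ : ℂ →L[ℝ] ℂ) := (h1.congr_of_eventuallyEq h2).mfderiv
  have h4 : ∀ v, pullMC E f q v = D₀ (D v) := fun v =>
    congrArg (fun L : ℂ →L[ℝ] E => L v) h3
  have h5 : D (Complex.I * coordVec z q) = Complex.I := by
    rw [← smul_eq_mul, map_smul, hDv, smul_eq_mul, mul_one]
  exact ⟨(h4 _).trans (congrArg D₀ hDv), (h4 _).trans (congrArg D₀ h5)⟩

theorem conn10_comp_coord {f : M → G} {f' : ℂ → G} {q : M} (hq : q ∈ z.source)
    (hff' : f =ᶠ[𝓝 q] f' ∘ z) (hf' : MDifferentiableAt 𝓘(ℝ, ℂ) 𝓘(ℝ, E) f' (z q)) :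
    conn10 E f q (coordVec z q) = conn E (-Complex.I) f' (z q) := by
  obtain ⟨h1, h2⟩ := pullMC_comp_coord hz hq hff' hf'
  have h3 : ∀ x y : E, (1 / 2 : ℂ) • (x - Complex.I • y) = (1 / 2 : ℂ) • (x + -Complex.I • y) := by
    intro x y; rw [neg_smul, sub_eq_add_neg]
  refine Eq.trans ?_ (h3 _ _)
  unfold conn10
  rw [h1, h2]
  rfl

theorem conn01_comp_coord {f : M → G} {f' : ℂ → G} {q : M} (hq : q ∈ z.source)
    (hff' : f =ᶠ[𝓝 q] f' ∘ z) (hf' : MDifferentiableAt 𝓘(ℝ, ℂ) 𝓘(ℝ, E) f' (z q)) :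
    conn01 E f q (coordVec z q) = conn E Complex.I f' (z q) := by
  obtain ⟨h1, h2⟩ := pullMC_comp_coord hz hq hff' hf'
  unfold conn01
  rw [h1, h2]
  rfl

end Coordinate

/-! ### The Σ-symmetric choices and the Toda mapping -/

section TodaMap

variable {E : Type*} [NormedAddCommGroup E] [NormedSpace ℂ E] [FiniteDimensional ℂ E]
  {G : Type*} [TopologicalSpace G] [ChartedSpace E G] [Group G] [LieGroup 𝓘(ℂ, E) ω G]
  [LieAlgebra.IsSemisimple ℂ (GroupLieAlgebra 𝓘(ℂ, E) G)]

theorem contMDiffOn_aut {gr : ℤ → Submodule ℂ E} {S : G ≃* G} (hS : IsCompatible (E := E) gr S)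
    {X : Type*} [TopologicalSpace X] [ChartedSpace ℂ X] {f : X → G} {s : Set X}
    (hf : ContMDiffOn 𝓘(ℝ, ℂ) 𝓘(ℝ, E) ∞ f s) :
    ContMDiffOn 𝓘(ℝ, ℂ) 𝓘(ℝ, E) ∞ (fun q => S (f q)) s :=
  hS.contMDiff.comp_contMDiffOn hf

/-- The factor `η₊ = Σ(η₋) ψ⁻¹`, where `Σ ∘ φ = φ ψ`. -/
def etaPlus (S : G ≃* G) (φ η : ℂ → G) (w : ℂ) : G := S (η w) * ((φ w)⁻¹ * S (φ w))⁻¹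

/-- The Toda mapping `γ₊⁻¹ η₋ η₊⁻¹ γ₋` with `γ₋ = Σ ∘ γ₊`. -/
def todaMap (S : G ≃* G) (φ η γ : ℂ → G) (w : ℂ) : G :=
  (γ w)⁻¹ * (η w * (etaPlus S φ η w)⁻¹) * S (γ w)

/-- The mapping equals γ₊⁻¹η₋ψS(η₋)⁻¹S(γ₊) with ψ = φ⁻¹S(φ), and S(ψ) = ψ⁻¹. -/
theorem star_todaMap {S : G ≃* G} (hS : ∀ g, S (S g) = g) (φ η γ : ℂ → G) (w : ℂ) :
    star S (todaMap S φ η γ w) = todaMap S φ η γ w := by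
  simp only [star, todaMap, etaPlus, map_mul, map_inv, mul_inv_rev, inv_inv, hS]
  group

namespace IsLocalGauss

variable {gr : ℤ → Submodule ℂ E} {p : ℤ → E →L[ℂ] E} {h₀ : E} (h : IsLieGrading G gr p h₀)
  {S : G ≃* G} (hS : IsCompatible (E := E) gr S) {xp : E} {g : G} {φ : ℂ → G} {W : Set ℂ}
  {μ ν η γ : ℂ → G} (hG : IsLocalGauss gr xp g φ W μ ν η γ)
include h hS hG

theorem contMDiffOn_etaPlus (hφ : ContMDiffOn 𝓘(ℝ, ℂ) 𝓘(ℝ, E) ∞ φ W) :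
    ContMDiffOn 𝓘(ℝ, ℂ) 𝓘(ℝ, E) ∞ (etaPlus S φ η) W :=
  contMDiffOn_mul (contMDiffOn_aut hS hG.smooth_η)
    (contMDiffOn_inv (contMDiffOn_mul (contMDiffOn_inv hφ) (contMDiffOn_aut hS hφ)))

theorem contMDiffOn_todaMap (hφ : ContMDiffOn 𝓘(ℝ, ℂ) 𝓘(ℝ, E) ∞ φ W) :
    ContMDiffOn 𝓘(ℝ, ℂ) 𝓘(ℝ, E) ∞ (todaMap S φ η γ) W :=
  contMDiffOn_mul (contMDiffOn_mul (contMDiffOn_inv hG.smooth_γ) (contMDiffOn_mul hG.smooth_η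
    (contMDiffOn_inv (hG.contMDiffOn_etaPlus h hS hφ)))) (contMDiffOn_aut hS hG.smooth_γ)

theorem etaPlus_mem (hφS : ∀ q ∈ W, (φ q)⁻¹ * S (φ q) ∈ expSubgroup G (gr 0)) {q : ℂ} (hq : q ∈ W) :
    etaPlus S φ η q ∈ expSubgroup G (gr 0) :=
  mul_mem (hS.map_mem_zero h.toIsGradingProj (hG.mem_η q hq)) (inv_mem (hφS q hq))

theorem todaMap_mem (hφS : ∀ q ∈ W, (φ q)⁻¹ * S (φ q) ∈ expSubgroup G (gr 0)) {q : ℂ} (hq : q ∈ W) :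
    todaMap S φ η γ q ∈ expSubgroup G (gr 0) :=
  mul_mem (mul_mem (inv_mem (hG.mem_γ q hq)) (mul_mem (hG.mem_η q hq)
    (inv_mem (hG.etaPlus_mem h hS hφS hq)))) (hS.map_mem_zero h.toIsGradingProj (hG.mem_γ q hq))

omit h hS in
-- Apply S to the plus decomposition and use φ = S(φ)ψ⁻¹.
theorem decomp_minus {q : ℂ} (hq : q ∈ W) : φ q = S (μ q) * S (ν q) * etaPlus S φ η q := by
  have h1 : S (φ q) = S (μ q) * S (ν q) * S (η q) := by rw [hG.decomp q hq, map_mul, map_mul]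
  rw [etaPlus, ← mul_assoc, ← h1]
  group

theorem conn_aut_type (hW : IsOpen W) {q : ℂ} (hq : q ∈ W) :
    conn E Complex.I (fun q => S (μ q)) q = 0 := by
  rw [hS.conn_comp _ (mdifferentiableAt_of_contMDiffOn hW hG.smooth_μ hq), Complex.conj_I,
    hG.type_μ q hq, map_zero]

/-- σ is conjugate linear, so it exchanges the types and changes the sign of √-1; the sign in σ(x₊)
= -x₋ compensates. -/
theorem conn_aut_lift (hW : IsOpen W) {xm : E} (hx : autDiff E S xp = -xm) {q : ℂ} (hq : q ∈ W) :
    conn E (-Complex.I) (fun q => S (μ q)) q = Complex.I • AdL E G (S (γ q)) xm := by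
  rw [hS.conn_comp _ (mdifferentiableAt_of_contMDiffOn hW hG.smooth_μ hq), map_neg, Complex.conj_I,
    neg_neg, hG.lift_γ q hq, hS.autDiff_smul, Complex.conj_I, hS.autDiff_AdL, hx, map_neg, neg_smul,
    smul_neg, neg_neg]

theorem conn_aut_hol (hW : IsOpen W) {q : ℂ} (hq : q ∈ W) :
    conn E Complex.I (fun q => S (γ q)) q = 0 := by
  rw [hS.conn_comp _ (mdifferentiableAt_of_contMDiffOn hW hG.smooth_γ hq), Complex.conj_I,
    hG.antihol_γ q hq, map_zero]

/-- Right multiplication of φ by η₊⁻¹γ₋ turns the H̃-factors of its two decompositions into γ₊γ and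
γ₋, the form in which `IsLieGrading.wirtinger_conn_toda` applies. -/
theorem wirtinger_todaMap (hW : IsOpen W) (hφ : ContMDiffOn 𝓘(ℝ, ℂ) 𝓘(ℝ, E) ∞ φ W)
    (hφS : ∀ q ∈ W, (φ q)⁻¹ * S (φ q) ∈ expSubgroup G (gr 0)) {xm : E} (hxp : xp ∈ gr 1)
    (hxm : xm ∈ gr (-1)) (hx : autDiff E S xp = -xm) {q : ℂ} (hq : q ∈ W) :
    wirtinger Complex.I (conn E (-Complex.I) (todaMap S φ η γ)) q =
      adL E G (AdL E G (todaMap S φ η γ q)⁻¹ xp) xm := by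
  have hη := hG.contMDiffOn_etaPlus h hS hφ
  refine h.wirtinger_conn_toda hW hxp hxm
    (f := fun q => φ q * ((etaPlus S φ η q)⁻¹ * S (γ q))) (νp := fun q => S (ν q))
    hG.smooth_μ (contMDiffOn_aut hS hG.smooth_μ) (contMDiffOn_aut hS hG.smooth_ν) hG.smooth_ν
    hG.smooth_γ (contMDiffOn_aut hS hG.smooth_γ) (hG.contMDiffOn_todaMap h hS hφ)
    (fun q hq => ?_) hG.mem_ν hG.mem_γ
    (fun q hq => hS.map_mem_zero h.toIsGradingProj (hG.mem_γ q hq))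
    (fun q hq => hG.todaMap_mem h hS hφS hq)
    (contMDiffOn_mul hφ (contMDiffOn_mul (contMDiffOn_inv hη) (contMDiffOn_aut hS hG.smooth_γ)))
    (fun q hq => ?_) (fun q hq => ?_) hG.type_μ hG.lift_γ (fun q hq => hG.conn_aut_type h hS hW hq)
    (fun q hq => hG.conn_aut_lift h hS hW hx hq) hG.antihol_γ
    (fun q hq => hG.conn_aut_hol h hS hW hq) hq
  · have h1 := hS.map_mem h.toIsGradingProj (hG.mem_ν q hq)
    rwa [neg_Iio, neg_zero] at h1
  · simp only [todaMap, hG.decomp q hq]; group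
  · conv_lhs => rw [hG.decomp_minus (S := S) hq]
    group

end IsLocalGauss

variable {M : Type*} [TopologicalSpace M] [ChartedSpace ℂ M] [IsManifold 𝓘(ℂ, ℂ) ω M]
  {z : OpenPartialHomeomorph M ℂ}

/-- The Toda data on a Riemann surface defined by a Gauss decomposition in a coordinate. -/
def IsLocalGauss.todaData {gr : ℤ → Submodule ℂ E} {p : ℤ → E →L[ℂ] E} {h₀ : E}
    (h : IsLieGrading G gr p h₀) {S : G ≃* G} (hS : IsCompatible (E := E) gr S) {xp xm : E} {g : G}
    {φ : M → G} {φ' : ℂ → G} {W : Set ℂ} {μ ν η γ : ℂ → G} (hG : IsLocalGauss gr xp g φ' W μ ν η γ)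
    (hz : z ∈ IsManifold.maximalAtlas 𝓘(ℂ, ℂ) ω M) (hW : IsOpen W)
    (hφ : ContMDiffOn 𝓘(ℝ, ℂ) 𝓘(ℝ, E) ∞ φ' W)
    (hφS : ∀ q ∈ W, (φ' q)⁻¹ * S (φ' q) ∈ expSubgroup G (gr 0))
    (hx : autDiff E S xp = -xm) (hφφ' : ∀ q ∈ z.source, φ q = φ' (z q)) :
    TodaData (E := E) gr xp xm g (S g) φ z (z.source ∩ z ⁻¹' W) :=
  have hsm : ∀ {f : ℂ → G}, ContMDiffOn 𝓘(ℝ, ℂ) 𝓘(ℝ, E) ∞ f W →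
      ContMDiffOn 𝓘(ℝ, ℂ) 𝓘(ℝ, E) ∞ (f ∘ z) (z.source ∩ z ⁻¹' W) := fun hf =>
    hf.comp ((contMDiffOn_coord hz).mono inter_subset_left) fun _ hq => hq.2
  have hd : ∀ {f : ℂ → G} {q : M}, q ∈ z.source ∩ z ⁻¹' W → ContMDiffOn 𝓘(ℝ, ℂ) 𝓘(ℝ, E) ∞ f W →
      MDifferentiableAt 𝓘(ℝ, ℂ) 𝓘(ℝ, E) f (z q) := fun hq hf =>
    mdifferentiableAt_of_contMDiffOn hW hf hq.2
  have hSμ := contMDiffOn_aut hS hG.smooth_μ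
  have hSγ := contMDiffOn_aut hS hG.smooth_γ
  { μp := μ ∘ z
    μm := (fun w => S (μ w)) ∘ z
    νp := (fun w => S (ν w)) ∘ z
    νm := ν ∘ z
    ηp := etaPlus S φ' η ∘ z
    ηm := η ∘ z
    γp := γ ∘ z
    γm := (fun w => S (γ w)) ∘ z
    smooth_μp := hsm hG.smooth_μ
    smooth_μm := hsm hSμ
    smooth_νp := hsm (contMDiffOn_aut hS hG.smooth_ν)
    smooth_νm := hsm hG.smooth_ν
    smooth_ηp := hsm (hG.contMDiffOn_etaPlus h hS hφ)
    smooth_ηm := hsm hG.smooth_η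
    mem_μp := fun q hq => hG.mem_μ _ hq.2
    mem_μm := fun q hq => by
      have h1 := hS.map_mem h.toIsGradingProj (hG.mem_μ _ hq.2)
      rw [neg_Ioi, neg_zero, map_mul, map_inv] at h1
      exact h1
    mem_νp := fun q hq => by
      have h1 := hS.map_mem h.toIsGradingProj (hG.mem_ν _ hq.2)
      rw [neg_Iio, neg_zero] at h1
      exact h1
    mem_νm := fun q hq => hG.mem_ν _ hq.2
    mem_ηp := fun q hq => hG.etaPlus_mem h hS hφS hq.2
    mem_ηm := fun q hq => hG.mem_η _ hq.2
    decomp_plus := fun q hq => (hφφ' q hq.1).trans (hG.decomp _ hq.2)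
    decomp_minus := fun q hq => (hφφ' q hq.1).trans (hG.decomp_minus hq.2)
    mem_γp := fun q hq => hG.mem_γ _ hq.2
    mem_γm := fun q hq => hS.map_mem_zero h.toIsGradingProj (hG.mem_γ _ hq.2)
    antihol_γp := by
      refine ⟨hsm hG.smooth_γ, fun q hq v => ?_⟩
      obtain ⟨D, hD⟩ := rdiff_comp_coord hz hq.1 (hd hq hG.smooth_γ)
      rw [hD, hD, map_smul]
      exact (antiholomorphicOn_of_conn_eq_zero hW hG.smooth_γ hG.antihol_γ).2 _ hq.2 _
    hol_γm := by
      have h1 := mdifferentiableOn_of_conn_eq_zero hW hSγ fun q hq => hG.conn_aut_hol h hS hW hq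
      exact h1.comp (((contMDiffOn_of_mem_maximalAtlas hz).mdifferentiableOn (by simp)).mono
        inter_subset_left) fun _ hq => hq.2
    lift_γp := fun q hq => (conn01_comp_coord hz hq.1 (EventuallyEq.refl _ _)
      (hd hq hG.smooth_μ)).trans (hG.lift_γ _ hq.2)
    type_μp := fun q hq => (conn10_comp_coord hz hq.1 (EventuallyEq.refl _ _)
      (hd hq hG.smooth_μ)).trans (hG.type_μ _ hq.2)
    lift_γm := fun q hq => (conn10_comp_coord hz hq.1 (EventuallyEq.refl _ _)
      (hd hq hSμ)).trans (hG.conn_aut_lift h hS hW hx hq.2)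
    type_μm := fun q hq => (conn01_comp_coord hz hq.1 (EventuallyEq.refl _ _)
      (hd hq hSμ)).trans (hG.conn_aut_type h hS hW hq.2) }

end TodaMap

/-! ### Existence of hermitean Toda mappings -/

section Main

variable {E : Type*} [NormedAddCommGroup E] [NormedSpace ℂ E] [FiniteDimensional ℂ E]
  {G : Type*} [TopologicalSpace G] [ChartedSpace E G] [Group G] [LieGroup 𝓘(ℂ, E) ω G]
  [LieAlgebra.IsSemisimple ℂ (GroupLieAlgebra 𝓘(ℂ, E) G)]
  {M : Type*} [TopologicalSpace M] [ChartedSpace ℂ M] [IsManifold 𝓘(ℂ, ℂ) ω M]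
  {gr : ℤ → Submodule ℂ E} {p : ℤ → E →L[ℂ] E} {h₀ : E}

theorem isTodaSolution_of_isLocalGauss (h : IsLieGrading G gr p h₀) {S : G ≃* G}
    (hS : IsCompatible (E := E) gr S) {xp xm : E} {g : G} {φ : ℂ → G} {W : Set ℂ} {μ ν η γ : ℂ → G}
    (hG : IsLocalGauss gr xp g φ W μ ν η γ) {z : OpenPartialHomeomorph M ℂ}
    (hz : z ∈ IsManifold.maximalAtlas 𝓘(ℂ, ℂ) ω M) (hW : IsOpen W)
    (hφ : ContMDiffOn 𝓘(ℝ, ℂ) 𝓘(ℝ, E) ∞ φ W)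
    (hφS : ∀ q ∈ W, (φ q)⁻¹ * S (φ q) ∈ expSubgroup G (gr 0)) (hxp : xp ∈ gr 1)
    (hxm : xm ∈ gr (-1)) (hx : autDiff E S xp = -xm) :
    IsTodaSolution (E := E) gr xp xm (todaMap S φ η γ ∘ z) z (z.source ∩ z ⁻¹' W) := by
  have hγ := hG.contMDiffOn_todaMap h hS hφ
  refine ⟨hγ.comp ((contMDiffOn_coord hz).mono inter_subset_left) fun _ hq => hq.2,
    fun q hq => hG.todaMap_mem h hS hφS hq.2, fun q hq => ?_⟩
  have hopen : IsOpen (z.source ∩ z ⁻¹' W) := z.isOpen_inter_preimage hW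
  have h1 : dbar (V := E) z (fun q' => conn10 E (todaMap S φ η γ ∘ z) q' (coordVec z q')) q =
      wirtinger Complex.I (conn E (-Complex.I) (todaMap S φ η γ)) (z q) := by
    refine dbar_comp_coord hz hq.1 ?_
      (((contDiffOn_conn _ hW hγ).contDiffAt (hW.mem_nhds hq.2)).differentiableAt (by simp))
    filter_upwards [hopen.mem_nhds hq] with x hx
    exact conn10_comp_coord hz hx.1 (EventuallyEq.refl _ _)
      (mdifferentiableAt_of_contMDiffOn hW hγ hx.2)
  refine h1.trans ((hG.wirtinger_todaMap h hS hW hφ hφS hxp hxm hx hq.2).trans ?_)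
  rw [adL_apply]
  rfl

theorem exists_todaData [ConnectedSpace G] (h : IsLieGrading G gr p h₀) {S : G ≃* G}
    (hS : IsCompatible (E := E) gr S) {φ : M → G} {xp xm : E} (hxp : xp ∈ gr 1)
    (hxm : xm ∈ gr (-1)) (hx : autDiff E S xp = -xm) (hφ : IsAdmissible (E := E) gr xp xm φ)
    (hφS : ∀ q, (φ q)⁻¹ * S (φ q) ∈ expSubgroup G (gr 0)) {z : OpenPartialHomeomorph M ℂ}
    (hz : z ∈ IsManifold.maximalAtlas 𝓘(ℂ, ℂ) ω M) {q₀ : M} (hq₀ : q₀ ∈ z.source) {g n b : G}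
    (hn : n ∈ expSubgroup G (gradeSum gr (Ioi 0))) (hb : b ∈ expSubgroup G (gradeSum gr (Iic 0)))
    (hgnb : φ q₀ = g * n * b) :
    ∃ W : Set M, IsOpen W ∧ q₀ ∈ W ∧ W ⊆ z.source ∧
      ∃ D : TodaData (E := E) gr xp xm g (S g) φ z W,
        (∀ q ∈ W, star S (D.toda q) = D.toda q) ∧
        IsTodaSolution (E := E) gr xp xm D.toda z W := by
  let φ' : ℂ → G := φ ∘ z.symm
  have hφ' : ContMDiffOn 𝓘(ℝ, ℂ) 𝓘(ℝ, E) ∞ φ' z.target :=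
    hφ.smooth.comp_contMDiffOn (contMDiffOn_coord_symm hz)
  have hφφ' : ∀ q ∈ z.source, φ q = φ' (z q) := fun q hq => by
    simp only [φ', Function.comp_apply, z.left_inv hq]
  have hev : ∀ q ∈ z.source, φ =ᶠ[𝓝 q] φ' ∘ z := fun q hq => by
    filter_upwards [z.open_source.mem_nhds hq] with x hx using hφφ' x hx
  have hd : ∀ q ∈ z.source, MDifferentiableAt 𝓘(ℝ, ℂ) 𝓘(ℝ, E) φ' (z q) := fun q hq =>
    mdifferentiableAt_of_contMDiffOn z.open_target hφ' (z.map_source hq)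
  have hv : ∀ q ∈ z.source, coordVec z q ≠ 0 := by
    intro q hq h0
    obtain ⟨D, -, hD⟩ := exists_hasMFDerivAt_coord hz hq
    rw [h0, map_zero] at hD
    exact zero_ne_one hD
  have hz' : ∀ w ∈ z.target, ∃ q ∈ z.source, z q = w := fun w hw =>
    ⟨z.symm w, z.map_target hw, z.right_inv hw⟩
  have hle : ∀ {S : Set ℤ} {i j : ℤ}, i ∈ S → j ∈ S → gr i ⊔ gr j ≤ gradeSum gr S := fun hi hj =>
    sup_le (fun _ hy => h.mem_gradeSum_of_mem hi hy) (fun _ hy => h.mem_gradeSum_of_mem hj hy)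
  obtain ⟨W, hWΩ, hW, hqW, μ, ν, η, γ, hG⟩ := h.exists_isLocalGauss z.open_target hφ' hxp
    (fun w hw => by
      obtain ⟨q, hq, rfl⟩ := hz' w hw
      have h1 : conn E (-Complex.I) φ' (z q) ∈ gr (-1) ⊔ gr 0 := by
        rw [← conn10_comp_coord hz hq (hev q hq) (hd q hq)]
        exact hφ.grading10 q _
      exact hle (by simp) (by simp) h1)
    (fun w hw => by
      obtain ⟨q, hq, rfl⟩ := hz' w hw
      have h1 : conn E Complex.I φ' (z q) ∈ gr 0 ⊔ gr 1 := by
        rw [← conn01_comp_coord hz hq (hev q hq) (hd q hq)]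
        exact hφ.grading01 q _
      exact hle (by simp) (by simp) h1)
    (fun w hw => by
      obtain ⟨q, hq, rfl⟩ := hz' w hw
      -- Degree 1 survives modulo b̃₋, so its component turns the tangency condition into membership
      -- in the orbit of x₊.
      obtain ⟨y, ⟨k, hk, hky⟩, hyq⟩ := hφ.tangentPlus q _ (hv q hq)
      let y' : E := y
      have h1 : y' - conn E Complex.I φ' (z q) ∈ gradeSum gr (Iic 0) := by
        rw [← conn01_comp_coord hz hq (hev q hq) (hd q hq)]
        exact (Submodule.Quotient.eq _).1 hyq
      have h2 : y' = AdL E G k xp := hky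
      refine ⟨k, hk, ?_⟩
      have h3 := h.mem_gradeSum.1 h1 1 (by simp)
      rw [map_sub, h2, h.same 1 _ (h.AdL_apply_mem hk hxp)] at h3
      exact (sub_eq_zero.1 h3).symm)
    (z.map_source hq₀) hn hb ((hφφ' q₀ hq₀).symm.trans hgnb)
  have hφW := hφ'.mono hWΩ
  have hφSW : ∀ w ∈ W, (φ' w)⁻¹ * S (φ' w) ∈ expSubgroup G (gr 0) := fun w _ => hφS _
  exact ⟨z.source ∩ z ⁻¹' W, z.isOpen_inter_preimage hW, ⟨hq₀, hqW⟩, inter_subset_left,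
    hG.todaData h hS hz hW hφW hφSW hx hφφ',
    fun q _ => star_todaMap hS.apply_apply φ' η γ (z q),
    isTodaSolution_of_isLocalGauss h hS hG hz hW hφW hφSW hxp hxm hx⟩

end Main

end Toda

/-! ### The theorem -/

theorem theorem3p2
    {E : Type*} [NormedAddCommGroup E] [NormedSpace ℂ E] [FiniteDimensional ℂ E] [CompleteSpace E]
    {G : Type*} [TopologicalSpace G] [ChartedSpace E G] [Group G] [LieGroup 𝓘(ℂ, E) ω G]
    [ConnectedSpace G] [LieAlgebra.IsSemisimple ℂ (GroupLieAlgebra 𝓘(ℂ, E) G)]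
    (gr : ℤ → Submodule ℂ (GroupLieAlgebra 𝓘(ℂ, E) G)) [GradedLieAlgebra gr]
    {M : Type*} [TopologicalSpace M] [ChartedSpace ℂ M] [IsManifold 𝓘(ℂ, ℂ) ω M]
    (S : G ≃* G) (hS : Toda.IsCompatible gr S)
    (φ : M → G) (hφ : ContMDiff 𝓘(ℝ, ℂ) 𝓘(ℝ, E) ∞ φ) :
    (Toda.RealityCondition hS φ ↔
      ∃ ψ : M → G, ContMDiff 𝓘(ℝ, ℂ) 𝓘(ℝ, E) ∞ ψ ∧ (∀ p, ψ p ∈ Toda.HZero gr) ∧ ∀ p, S (φ p) = φ p * ψ p) ∧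
    (∀ xp xm : GroupLieAlgebra 𝓘(ℂ, E) G, xp ∈ gr 1 → xm ∈ gr (-1) → xp ≠ 0 → xm ≠ 0 →
      Toda.diffOne E S xp = -xm → Toda.IsAdmissible gr xp xm φ → Toda.RealityCondition hS φ →
      ∀ z ∈ IsManifold.maximalAtlas 𝓘(ℂ, ℂ) ω M, ∀ p ∈ z.source, ∀ g : G,
        (∃ n ∈ Toda.NPlus gr, ∃ b ∈ Toda.BMinus gr, φ p = g * n * b) →
        ∃ W : Set M, IsOpen W ∧ p ∈ W ∧ W ⊆ z.source ∧
          ∃ D : Toda.TodaData gr xp xm g (S g) φ z W,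
            (∀ q ∈ W, Toda.star S (D.toda q) = D.toda q) ∧
            Toda.IsTodaSolution gr xp xm D.toda z W) := by
  obtain ⟨p, h₀, h⟩ := Toda.exists_isLieGrading (E := E) (G := G) gr
  have hreal := fun φ : M → G => hS.realityCondition_iff h φ
  refine ⟨(hreal φ).trans ⟨fun hφS => ⟨fun q => (φ q)⁻¹ * S (φ q), ?_, hφS, fun q => by simp⟩, ?_⟩,
    ?_⟩
  · exact contMDiffOn_univ.1 (Toda.contMDiff_inv_mul hφ.contMDiffOn
      (hS.contMDiff.comp_contMDiffOn hφ.contMDiffOn))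
  · rintro ⟨ψ, -, hψ, hψS⟩ q
    rw [hψS, inv_mul_cancel_left]
    exact hψ q
  · rintro xp xm hxp hxm - - hσ hadm hR z hz p hp g ⟨n, hn, b, hb, hgnb⟩
    exact Toda.exists_todaData h hS hxp hxm hσ hadm ((hreal φ).1 hR) hz hp hn hb hgnb

end
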